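/- Let $G$ be a finite connected bridgeless cubic planar multigraph with $n$ vertices (parallel edges are allowed; loops cannot occur, since a loop in a cubic graph forces a bridge). A circuit of $G$ is a connected 2-regular subgraph of $G$ (two parallel edges form a circuit of length 2), and a circuit double cover of $G$ is a multiset of circuits of $G$ such that every edge of $G$ belongs to exactly two of its members, counted with multiplicity. Then $G$ has at least $$\left(\tfrac{5}{2}\right)^{n/4-1/2}$$ circuit double covers. -/

import Mathlib

/-! Finite multigraphs are Mathlib's `Graph α β` (vertices in `α`, edges in `β`; parallel edges and
loops are allowed). Connectivity, degrees, circuits, double covers and planarity follow. -/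

namespace Graph

/-- Two vertices are joined by a (possibly trivial) walk. -/
def Reachable {α β : Type*} (G : Graph α β) (x y : α) : Prop :=
  Relation.ReflTransGen G.Adj x y

/-- A graph is connected if it has a vertex and any two of its vertices are joined by a walk. -/
def IsConnected {α β : Type*} (G : Graph α β) : Prop :=
  G.vertexSet.Nonempty ∧ ∀ x ∈ G.vertexSet, ∀ y ∈ G.vertexSet, G.Reachable x y

/-- The number of edge ends at a vertex: every incident edge counts once, and loops once more. -/
noncomputable def eDegree {α β : Type*} (G : Graph α β) (x : α) : ℕ∞ :=
  (G.incidenceSet x).encard + (G.loopSet x).encard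

/-- All vertices have degree `k`. -/
def IsRegular {α β : Type*} (G : Graph α β) (k : ℕ) : Prop :=
  ∀ x ∈ G.vertexSet, G.eDegree x = k

/-- A bridge: an edge whose deletion separates its two ends. -/
def IsBridge {α β : Type*} (G : Graph α β) (e : β) : Prop :=
  ∃ x y, G.IsLink e x y ∧ ¬ (G.deleteEdges {e}).Reachable x y

/-- A graph without bridges. -/
def IsBridgeless {α β : Type*} (G : Graph α β) : Prop :=
  ∀ e, ¬ G.IsBridge e

/-- A circuit of `G`: a connected 2-regular subgraph (two parallel edges form a circuit). -/
def IsCircuitOf {α β : Type*} (C G : Graph α β) : Prop :=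
  C ≤ G ∧ C.IsConnected ∧ C.IsRegular 2

open Classical in
/-- A circuit double cover: a multiset of circuits such that each edge is contained in exactly
two of its members, counted with multiplicity. -/
def IsCircuitDoubleCover {α β : Type*} (G : Graph α β) (𝒞 : Multiset (Graph α β)) : Prop :=
  (∀ C ∈ 𝒞, C.IsCircuitOf G) ∧ ∀ e ∈ G.edgeSet, 𝒞.countP (fun C => e ∈ C.edgeSet) = 2

/-- The number `ν(G)` of circuit double covers. -/
noncomputable def numCircuitDoubleCovers {α β : Type*} (G : Graph α β) : ℕ :=
  {𝒞 : Multiset (Graph α β) | G.IsCircuitDoubleCover 𝒞}.ncard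

/-- The darts of `G`: each edge has two, one for each of its orientations. -/
abbrev Darts {α β : Type*} (G : Graph α β) : Type _ := G.edgeSet × Bool

/-- Reversing a dart. -/
def flip {α β : Type*} (G : Graph α β) : Equiv.Perm G.Darts :=
  Equiv.prodCongr (Equiv.refl G.edgeSet) Equiv.boolNot

/-- A rotation system: a cyclic order of the darts leaving each vertex. It is the combinatorial
description of a cellular embedding of (each component of) `G` in a closed oriented surface. -/
structure RotationSystem {α β : Type*} (G : Graph α β) where
  /-- The vertex from which a dart leaves. -/
  tail : G.Darts → α
  isLink : ∀ e : G.edgeSet, G.IsLink e (tail (e, false)) (tail (e, true))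
  /-- The next dart in the cyclic order around the same vertex. -/
  rot : Equiv.Perm G.Darts
  sameCycle_iff : ∀ d d' : G.Darts, rot.SameCycle d d' ↔ tail d = tail d'

/-- The number of cycles of a permutation, fixed points included. -/
noncomputable def numCycles {D : Type*} (f : Equiv.Perm D) : ℕ :=
  Nat.card (Quotient (Equiv.Perm.SameCycle.setoid f))

namespace RotationSystem

/-- Face tracing: after walking along a dart, leave its head along the dart that follows the
reversed dart in the rotation. The cycles of this permutation are the faces of the embedding. -/
def face {α β : Type*} {G : Graph α β} (R : G.RotationSystem) : Equiv.Perm G.Darts :=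
  R.rot * G.flip

/-- The number of connected components that contain an edge. -/
noncomputable def numComponents {α β : Type*} {G : Graph α β} (R : G.RotationSystem) : ℕ :=
  Nat.card (MulAction.orbitRel.Quotient (Subgroup.closure {R.rot, G.flip}) G.Darts)

/-- The embedding lies in the sphere (in one sphere for each component): `V - E + F = 2 c`, where
`c` is the number of components and isolated vertices, which have no darts, are left out. The cycles
of `rot` are the non-isolated vertices and the cycles of `face` the faces. For a connected graph
with an edge this reads `V - E + F = 2`. -/
def IsPlane {α β : Type*} {G : Graph α β} (R : G.RotationSystem) : Prop :=
  numCycles R.rot + numCycles R.face = numCycles G.flip + 2 * R.numComponents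

end RotationSystem

/-- A (finite) graph is planar if it has an embedding in the sphere, given by a rotation system. -/
def IsPlanar {α β : Type*} (G : Graph α β) : Prop :=
  ∃ R : G.RotationSystem, R.IsPlane

end Graph

/-! In a cubic graph a circuit double cover uses each of the three corners (pairs of edges) of every
vertex exactly once. It is therefore determined by saying, for each edge, how the two corners at one
end continue into the two corners at the other. Once a rotation is fixed at each vertex, these two
choices become a Boolean twist of the edge. Following the continuations decomposes the corners into
strands, and a twist `T` gives a cover when no strand meets two corners of one vertex
(`StrandsValid`). Distinct valid twists give distinct covers (`CubicModel.numCovers_le`), so it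
suffices to bound the number ν of valid twists from below.

The bound is proved by induction on the number n of vertices, replacing a short face by something
smaller. A digon becomes an edge, or a triangle a vertex: ν ≥ 2ν' and n drops by 2. In a
quadrilateral the four outgoing edges are joined in two pairs of neighbours, in both ways: ν ≥ 2(ν₁
+ ν₂) and n drops by 4. In a pentagon two neighbouring outgoing edges are joined and the other three
meet in a new vertex, in five ways: 2ν ≥ ν₁ + ... + ν₅ and n drops by 4. The pentagon is the
extremal case and gives the factor 5/2 for four vertices; the other factors suffice because 4 ≥ 5/2
and 2² ≥ 5/2. The base case is n = 2, where the bound is 1.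

These inequalities are local. For a fixed twist outside the face, the outside matters only through
the pairing of its strand ends at the loose ends and through the pairs of outer strands that
conflict, that is, meet different corners of a common vertex. A 2-colouring of the ends encodes the
pairing as a permutation without fixed points (`OpenMap.exists_pathLabel`). The inequality is
verified for every such permutation and every conflict relation by a finite search
(`Gadget.sum_count_le_of_check`) and is then summed over the outer twists (`sum_numCovers_le`).

The reduced maps must again be planar and 2-edge-connected. For this the face is taken inside an
atom, a minimal vertex set with at least two elements that is left by at most three edges. Euler's
inequality, proved for permutations in `Equiv.Perm.numClasses_add_numClasses_le`, provides a face of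
length at most 5 inside it (`IsAtom.exists_short_face`). By minimality this face has no chord, and
by uncrossing (`IsAtom.false_of_cut_le`) the reduction creates no bridge. Planarity is carried along
as a labelling of the corners, constant along faces, with at least n/2 + 2 labels: a reduction loses
the label of the inner face and, in the last two cases, merges two others. -/

section

/-! ### Counting the classes generated by a relation -/

namespace Relation

variable {D : Type*}

/-- The number of classes of the equivalence relation generated by `r`. -/
noncomputable def numClasses (r : D → D → Prop) : ℕ := Nat.card (Quot r)

/-- The relation `r` together with one more pair. -/
def addPair (r : D → D → Prop) (a b : D) : D → D → Prop := fun x y => r x y ∨ (x = a ∧ y = b)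

variable {r s : D → D → Prop}

theorem eqvGen_of_forall (h : ∀ x y, r x y → EqvGen s x y) {x y : D} (hxy : EqvGen r x y) :
    EqvGen s x y := by
  induction hxy with
  | rel x y h' => exact h x y h'
  | refl x => exact EqvGen.refl x
  | symm x y _ ih => exact EqvGen.symm _ _ ih
  | trans x y z _ _ ih1 ih2 => exact EqvGen.trans _ _ _ ih1 ih2

theorem EqvGen.apply_eq {E : Type*} {f : D → E} (hf : ∀ x y, r x y → f x = f y) {x y : D}
    (h : EqvGen r x y) : f x = f y := by
  induction h with
  | rel x y h' => exact hf x y h'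
  | refl x => rfl
  | symm x y _ ih => exact ih.symm
  | trans x y z _ _ ih1 ih2 => exact ih1.trans ih2

theorem EqvGen.map_rel {E : Type*} {s : E → E → Prop} {f : D → E}
    (hf : ∀ x y, r x y → EqvGen s (f x) (f y)) {x y : D} (h : EqvGen r x y) :
    EqvGen s (f x) (f y) := by
  induction h with
  | rel x y h' => exact hf x y h'
  | refl x => exact EqvGen.refl _
  | symm x y _ ih => exact EqvGen.symm _ _ ih
  | trans x y z _ _ ih1 ih2 => exact EqvGen.trans _ _ _ ih1 ih2

theorem numClasses_le_of_forall [Finite D] (h : ∀ x y, r x y → EqvGen s x y) :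
    numClasses s ≤ numClasses r := by
  refine Nat.card_le_card_of_surjective
    (Quot.lift (fun x => Quot.mk s x) (fun x y hxy => Quot.eqvGen_sound (h x y hxy))) ?_
  rintro ⟨x⟩
  exact ⟨Quot.mk r x, rfl⟩

/-- One extra pair can merge only the classes of `a` and `b`; this replaces any analysis of chains
in the counting below. -/
theorem eqvGen_addPair {a b x y : D} (h : EqvGen (addPair r a b) x y) :
    EqvGen r x y ∨ ((EqvGen r x a ∨ EqvGen r x b) ∧ (EqvGen r y a ∨ EqvGen r y b)) := by
  induction h with
  | rel x y h' =>
    rcases h' with h' | ⟨rfl, rfl⟩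
    · exact Or.inl (EqvGen.rel _ _ h')
    · exact Or.inr ⟨Or.inl (EqvGen.refl _), Or.inr (EqvGen.refl _)⟩
  | refl x => exact Or.inl (EqvGen.refl _)
  | symm x y _ ih =>
    rcases ih with ih | ih
    · exact Or.inl (EqvGen.symm _ _ ih)
    · exact Or.inr ih.symm
  | trans x y z _ _ ih1 ih2 =>
    rcases ih1 with ih1 | ih1 <;> rcases ih2 with ih2 | ih2
    · exact Or.inl (EqvGen.trans _ _ _ ih1 ih2)
    · exact Or.inr ⟨ih2.1.imp (EqvGen.trans _ _ _ ih1) (EqvGen.trans _ _ _ ih1), ih2.2⟩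
    · exact Or.inr ⟨ih1.1, ih1.2.imp (EqvGen.trans _ _ _ (EqvGen.symm _ _ ih2))
        (EqvGen.trans _ _ _ (EqvGen.symm _ _ ih2))⟩
    · exact Or.inr ⟨ih1.1, ih2.2⟩

theorem numClasses_addPair_le [Finite D] (a b : D) :
    numClasses (addPair r a b) ≤ numClasses r :=
  numClasses_le_of_forall fun _ _ h => EqvGen.rel _ _ (Or.inl h)

theorem numClasses_le_addPair [Finite D] (a b : D) :
    numClasses r ≤ numClasses (addPair r a b) + 1 := by
  classical
  have : Finite (Quot (addPair r a b)) := inferInstance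
  rw [numClasses, numClasses, ← Finite.card_option]
  -- The class of `a` is set aside as `none`; the remaining classes stay distinct, since a merger
  -- would involve the class of `a`.
  refine Nat.card_le_card_of_injective (fun q : Quot r =>
    if q = Quot.mk r a then none else some (Quot.lift (fun x => Quot.mk (addPair r a b) x)
      (fun x y hxy => Quot.sound (Or.inl hxy)) q)) ?_
  rintro ⟨x⟩ ⟨y⟩ hxy
  change (if Quot.mk r x = Quot.mk r a then none else some (Quot.mk (addPair r a b) x)) =
    (if Quot.mk r y = Quot.mk r a then none else some (Quot.mk (addPair r a b) y)) at hxy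
  split_ifs at hxy with h1 h2 h2
  · rw [h1, h2]
  · have h3 := Quot.eqvGen_exact (Option.some.inj hxy)
    rcases eqvGen_addPair h3 with h | ⟨hx, hy⟩
    · exact Quot.eqvGen_sound h
    · have hx' := hx.resolve_left fun h => h1 (Quot.eqvGen_sound h)
      have hy' := hy.resolve_left fun h => h2 (Quot.eqvGen_sound h)
      exact Quot.eqvGen_sound (EqvGen.trans _ _ _ hx' (EqvGen.symm _ _ hy'))

theorem numClasses_addPair_of_eqvGen [Finite D] {a b : D} (h : EqvGen r a b) :
    numClasses r ≤ numClasses (addPair r a b) := by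
  refine numClasses_le_of_forall ?_
  rintro x y (hxy | ⟨rfl, rfl⟩)
  · exact EqvGen.rel _ _ hxy
  · exact h

theorem numClasses_addPair_lt [Finite D] {a b : D} (h : ¬ EqvGen r a b) :
    numClasses (addPair r a b) + 1 ≤ numClasses r := by
  classical
  let f : Quot r → Quot (addPair r a b) := Quot.lift (fun x => Quot.mk (addPair r a b) x)
      (fun x y hxy => Quot.sound (Or.inl hxy))
  have hsurj : Function.Surjective f := by
    rintro ⟨x⟩
    exact ⟨Quot.mk r x, rfl⟩
  have hle := Nat.card_le_card_of_surjective f hsurj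
  rcases Nat.lt_or_ge (Nat.card (Quot (addPair r a b))) (Nat.card (Quot r)) with hlt | hge
  · exact hlt
  · exfalso
    have hcard : Nat.card (Quot r) = Nat.card (Quot (addPair r a b)) := le_antisymm hge hle
    have hbij := (Nat.bijective_iff_surjective_and_card f).2 ⟨hsurj, hcard⟩
    have : Quot.mk r a = Quot.mk r b := hbij.1 (Quot.sound (Or.inr ⟨rfl, rfl⟩))
    exact h (Quot.eqvGen_exact this)

end Relation

/-! ### An Euler inequality for permutations -/

namespace Equiv.Perm

open Relation

variable {D : Type*}

/-- One step of a permutation. -/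
def Step (f : Perm D) (x y : D) : Prop := f x = y

variable [DecidableEq D]

theorem eqvGen_step_mul_swap (f : Perm D) (a b : D) {x y : D}
    (h : Step (f * swap a b) x y) : EqvGen (addPair (Step f) a b) x y := by
  have hs : ∀ z, EqvGen (addPair (Step f) a b) z (f z) := fun z => EqvGen.rel _ _ (Or.inl rfl)
  have hab : EqvGen (addPair (Step f) a b) a b := EqvGen.rel _ _ (Or.inr ⟨rfl, rfl⟩)
  have h' : f (swap a b x) = y := h
  subst h'
  refine EqvGen.trans _ (swap a b x) _ ?_ (hs _)
  by_cases hxa : x = a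
  · subst hxa
    simpa using hab
  · by_cases hxb : x = b
    · subst hxb
      simpa using EqvGen.symm _ _ hab
    · rw [swap_apply_of_ne_of_ne hxa hxb]
      exact EqvGen.refl _

theorem numClasses_addPair_mul_swap [Finite D] (f : Perm D) (a b : D) :
    numClasses (addPair (Step f) a b) ≤ numClasses (addPair (Step (f * swap a b)) a b) := by
  refine numClasses_le_of_forall ?_
  rintro x y (h | ⟨rfl, rfl⟩)
  · exact eqvGen_step_mul_swap f a b h
  · exact EqvGen.rel _ _ (Or.inr ⟨rfl, rfl⟩)

/-- Once `a` and `b` are identified the transposition becomes invisible. The cycle counts of `f` and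
`f * swap a b` are compared through this common quotient. -/
theorem numClasses_addPair_mul_swap_eq [Finite D] (f : Perm D) (a b : D) :
    numClasses (addPair (Step (f * swap a b)) a b) = numClasses (addPair (Step f) a b) := by
  refine le_antisymm ?_ (numClasses_addPair_mul_swap f a b)
  have := numClasses_addPair_mul_swap (f * swap a b) a b
  rwa [mul_assoc, swap_mul_self, mul_one] at this

theorem numClasses_mul_swap_le [Finite D] (f : Perm D) (a b : D) :
    numClasses (Step (f * swap a b)) ≤ numClasses (Step f) + 1 := by
  have h1 := numClasses_le_addPair (r := Step (f * swap a b)) a b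
  rw [numClasses_addPair_mul_swap_eq] at h1
  have h2 := numClasses_addPair_le (r := Step f) a b
  omega

/-- A transposition across two cycles merges them: from `a` the new permutation jumps to `f b` and
then follows the old cycle of `b` until it returns to `b`. -/
theorem eqvGen_mul_swap_of_not [Finite D] {f : Perm D} {a b : D}
    (h : ¬ EqvGen (Step f) a b) : EqvGen (Step (f * swap a b)) a b := by
  by_contra hc
  -- If `b` were never reached, `S` would be closed under `f`. Being finite, `f` would be onto `S`,
  -- so the preimage `b` of `f b` would lie in `S`.
  let S : Set D := {x | EqvGen (Step f) b x ∧ EqvGen (Step (f * swap a b)) a x}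
  have hfb : f b ∈ S := by
    refine ⟨EqvGen.rel _ _ rfl, EqvGen.rel _ _ ?_⟩
    simp [Step]
  have hmaps : ∀ x ∈ S, f x ∈ S := by
    rintro x ⟨h1, h2⟩
    refine ⟨EqvGen.trans _ _ _ h1 (EqvGen.rel _ _ rfl), ?_⟩
    have hxa : x ≠ a := by
      rintro rfl
      exact h (EqvGen.symm _ _ h1)
    have hxb : x ≠ b := by
      rintro rfl
      exact hc h2
    refine EqvGen.trans _ _ _ h2 (EqvGen.rel _ _ ?_)
    simp [Step, swap_apply_of_ne_of_ne hxa hxb]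
  have hinj : Function.Injective fun x : S => (⟨f x, hmaps x x.2⟩ : S) := fun x y hxy =>
    Subtype.ext (f.injective (congrArg Subtype.val hxy))
  obtain ⟨⟨x, hx⟩, hxb⟩ := Finite.surjective_of_injective hinj ⟨f b, hfb⟩
  have : x = b := f.injective (congrArg Subtype.val hxb)
  subst this
  exact hc hx.2

theorem numClasses_mul_swap_of_not [Finite D] {f : Perm D} {a b : D}
    (h : ¬ EqvGen (Step f) a b) : numClasses (Step (f * swap a b)) + 1 ≤ numClasses (Step f) := by
  have h1 := numClasses_addPair_of_eqvGen (eqvGen_mul_swap_of_not h)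
  rw [numClasses_addPair_mul_swap_eq] at h1
  have h2 := numClasses_addPair_lt h
  omega

/-- The product of the transpositions in a list of pairs. -/
def swapProd (l : List (D × D)) : Perm D := (l.map fun p => swap p.1 p.2).prod

/-- Steps of a permutation together with a list of pairs. -/
def StepOr (f : Perm D) (l : List (D × D)) (x y : D) : Prop := Step f x y ∨ (x, y) ∈ l

theorem eqvGen_step_mul_swapProd (f : Perm D) (l : List (D × D)) {x y : D}
    (h : EqvGen (Step (f * swapProd l)) x y) : EqvGen (StepOr f l) x y := by
  induction l using List.reverseRecOn generalizing x y with
  | nil => 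
    simp only [swapProd, List.map_nil, List.prod_nil, mul_one] at h
    exact eqvGen_of_forall (fun _ _ h => EqvGen.rel _ _ (Or.inl h)) h
  | append_singleton l p ih =>
    have hp : f * swapProd (l ++ [p]) = f * swapProd l * swap p.1 p.2 := by
      simp [swapProd, mul_assoc]
    rw [hp] at h
    have hmono : ∀ x y, EqvGen (StepOr f l) x y → EqvGen (StepOr f (l ++ [p])) x y := by
      intro x y hxy
      refine eqvGen_of_forall ?_ hxy
      rintro u v (huv | huv)
      · exact EqvGen.rel _ _ (Or.inl huv)
      · exact EqvGen.rel _ _ (Or.inr (List.mem_append_left _ huv))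
    refine eqvGen_of_forall ?_ h
    intro u v huv
    refine eqvGen_of_forall ?_ (eqvGen_step_mul_swap _ _ _ huv)
    rintro u v (huv | ⟨rfl, rfl⟩)
    · exact hmono _ _ (ih (EqvGen.rel _ _ huv))
    · exact EqvGen.rel _ _ (Or.inr (by simp))

/-- Euler's inequality: if `f` is multiplied by a product of transpositions, then the numbers of
cycles of the two permutations are bounded by the number of transpositions and of joint orbits. -/
theorem numClasses_add_numClasses_le [Finite D] (f : Perm D) (l : List (D × D)) :
    numClasses (Step f) + numClasses (Step (f * swapProd l)) ≤
      l.length + 2 * numClasses (StepOr f l) := by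
  induction l using List.reverseRecOn with
  | nil =>
    have : numClasses (Step f) ≤ numClasses (StepOr f []) :=
      numClasses_le_of_forall fun x y h => EqvGen.rel _ _ (by simpa [StepOr] using h)
    simp only [swapProd, List.map_nil, List.prod_nil, mul_one, List.length_nil]
    omega
  | append_singleton l p ih =>
    have hp : f * swapProd (l ++ [p]) = f * swapProd l * swap p.1 p.2 := by
      simp [swapProd, mul_assoc]
    have hadd : numClasses (addPair (StepOr f l) p.1 p.2) ≤ numClasses (StepOr f (l ++ [p])) := by
      refine numClasses_le_of_forall ?_
      rintro x y (h | h)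
      · exact EqvGen.rel _ _ (Or.inl (Or.inl h))
      · rcases List.mem_append.1 h with h | h
        · exact EqvGen.rel _ _ (Or.inl (Or.inr h))
        · simp only [List.mem_singleton] at h
          subst h
          exact EqvGen.rel _ _ (Or.inr ⟨rfl, rfl⟩)
    rw [hp, List.length_append, List.length_singleton]
    -- Within one joint orbit the cycle count grows by at most one, which the longer list pays for.
    -- Across two orbits the right side may fall by one, but then two cycles merge.
    by_cases hc : EqvGen (StepOr f l) p.1 p.2
    · have h1 := numClasses_addPair_of_eqvGen hc
      have h2 := numClasses_mul_swap_le (f * swapProd l) p.1 p.2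
      omega
    · have h1 := numClasses_le_addPair (r := StepOr f l) p.1 p.2
      have h2 := numClasses_mul_swap_of_not (f := f * swapProd l)
        fun h => hc (eqvGen_step_mul_swapProd f l h)
      omega

end Equiv.Perm

end

section

/-! ### Cubic maps -/

/-- A cubic map: the darts are `V × Fin 3`, the rotation at a vertex is `(v, i) ↦ (v, i + 1)`, and
the edges are the orbits of a fixed point free involution of the darts. -/
structure CubicMap (V : Type*) where
  /-- Reversing a dart. -/
  inv : V × Fin 3 → V × Fin 3
  inv_inv : ∀ d, inv (inv d) = d
  inv_ne : ∀ d, inv d ≠ d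

/-- The corner `(v, i)` lies at `v` opposite to the dart `(v, i)`; `crn d b` is the corner on the
side `b` of the dart `d`. -/
def crn {V : Type*} (d : V × Fin 3) (b : Bool) : V × Fin 3 :=
  (d.1, bif b then d.2 + 2 else d.2 + 1)

namespace CubicMap

open Finset Relation

variable {V : Type*} (M : CubicMap V)

theorem inv_injective : Function.Injective M.inv := fun x y h => by
  rw [← M.inv_inv x, h, M.inv_inv]

/-- The involution as a permutation. -/
def invPerm : Equiv.Perm (V × Fin 3) := ⟨M.inv, M.inv, M.inv_inv, M.inv_inv⟩

/-- The face permutation: walk along a dart, then turn to the next dart in the rotation. -/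
def face : Equiv.Perm (V × Fin 3) :=
  M.invPerm.trans (Equiv.prodCongr (Equiv.refl V) (Equiv.addRight 1))

theorem face_apply (d : V × Fin 3) : M.face d = ((M.inv d).1, (M.inv d).2 + 1) := rfl

/-! ### Edge cuts and atoms -/

section cut

variable [Fintype V] [DecidableEq V]

/-- The number of darts leading from `P` to `Q`. -/
def between (P Q : Finset V) : ℕ := #{d : V × Fin 3 | d.1 ∈ P ∧ (M.inv d).1 ∈ Q}

/-- The number of edges leaving a set of vertices. -/
def cut (X : Finset V) : ℕ := #{d : V × Fin 3 | d.1 ∈ X ∧ (M.inv d).1 ∉ X}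

/-- Connected and without bridges: every proper nonempty vertex set is left by two edges. -/
def TwoConn : Prop := ∀ X : Finset V, X.Nonempty → X ≠ univ → 2 ≤ M.cut X

/-- A planar map, given by a labelling of the corners with as many labels as a spherical embedding
has faces. -/
def Planar : Prop :=
  ∃ L : V × Fin 3 → ℕ, (∀ d b, L (crn d b) = L (crn (M.inv d) (!b))) ∧
    Fintype.card V + 4 ≤ 2 * #(univ.image L)

theorem between_comm (P Q : Finset V) : M.between P Q = M.between Q P := by
  refine Finset.card_bij (fun d _ => M.inv d) ?_ (fun _ _ _ _ h => M.inv_injective h) ?_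
  · intro d hd
    simp only [mem_filter, mem_univ, true_and] at hd ⊢
    rw [M.inv_inv]
    exact hd.symm
  · intro d hd
    refine ⟨M.inv d, ?_, M.inv_inv d⟩
    simp only [mem_filter, mem_univ, true_and] at hd ⊢
    rw [M.inv_inv]
    exact hd.symm

theorem cut_eq_between (X Y Z W : Finset V) (h : ∀ v, v ∉ X ↔ v ∈ Y ∨ v ∈ Z ∨ v ∈ W)
    (hYZ : Disjoint Y Z) (hYW : Disjoint Y W) (hZW : Disjoint Z W) :
    M.cut X = M.between X Y + M.between X Z + M.between X W := by
  simp only [cut, between, card_filter, ← sum_add_distrib]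
  refine sum_congr rfl fun d _ => ?_
  have h1 : (M.inv d).1 ∈ Y → (M.inv d).1 ∉ Z := fun h h' => disjoint_left.1 hYZ h h'
  have h2 : (M.inv d).1 ∈ Y → (M.inv d).1 ∉ W := fun h h' => disjoint_left.1 hYW h h'
  have h3 : (M.inv d).1 ∈ Z → (M.inv d).1 ∉ W := fun h h' => disjoint_left.1 hZW h h'
  have h4 := h (M.inv d).1
  clear h
  by_cases a : d.1 ∈ X <;> by_cases b : (M.inv d).1 ∈ Y <;> by_cases c : (M.inv d).1 ∈ Z <;>
    by_cases e : (M.inv d).1 ∈ W <;> simp_all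

theorem cut_union_eq_between (P Q R S : Finset V) (h : ∀ v, v ∉ P ∪ Q ↔ v ∈ R ∨ v ∈ S)
    (hPQ : Disjoint P Q) (hRS : Disjoint R S) :
    M.cut (P ∪ Q) = M.between P R + M.between P S + M.between Q R + M.between Q S := by
  simp only [cut, between, card_filter, ← sum_add_distrib]
  refine sum_congr rfl fun d _ => ?_
  have h1 : d.1 ∈ P → d.1 ∉ Q := fun h h' => disjoint_left.1 hPQ h h'
  have h2 : (M.inv d).1 ∈ R → (M.inv d).1 ∉ S := fun h h' => disjoint_left.1 hRS h h'
  have h4 := h (M.inv d).1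
  clear h
  by_cases a : d.1 ∈ P <;> by_cases b : d.1 ∈ Q <;> by_cases c : (M.inv d).1 ∈ R <;>
    by_cases e : (M.inv d).1 ∈ S <;> simp_all

theorem between_eq_zero_of_empty {P : Finset V} (h : ¬ P.Nonempty) (Q : Finset V) :
    M.between P Q = 0 := by
  rw [not_nonempty_iff_eq_empty] at h
  simp [between, h]

/-- A minimal vertex set with at least two elements that is left by at most three edges. -/
structure IsAtom (A : Finset V) : Prop where
  two_le_card : 2 ≤ #A
  cut_le : M.cut A ≤ 3
  four_le_cut : ∀ B, B ⊂ A → 2 ≤ #B → 4 ≤ M.cut B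

theorem cut_univ : M.cut univ = 0 := by simp [cut]

theorem exists_isAtom (h : 2 ≤ Fintype.card V) : ∃ A, M.IsAtom A := by
  obtain ⟨A, hA⟩ := (Set.toFinite {A : Finset V | 2 ≤ #A ∧ M.cut A ≤ 3}).exists_minimal
    ⟨univ, by simpa [cut_univ] using h⟩
  refine ⟨A, hA.1.1, hA.1.2, fun B hB h2 => ?_⟩
  by_contra hc
  exact hB.2 (hA.2 ⟨h2, by omega⟩ hB.1)

variable {M}

/-- Uncrossing. Both parts of `A` have cut at least 4 by minimality, while `A` and `X` have cut at
most 3. Submodularity leaves cut at most 2 for `X \ A` and for the complement of `A ∪ X`. By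
two-connectedness both cuts are then exactly 2 and no edge joins diagonally opposite quarters, and
the remaining edge counts have no integral solution. -/
theorem IsAtom.false_of_cut_le {A : Finset V} (hA : M.IsAtom A) (hM : M.TwoConn) {X : Finset V}
    (hX : M.cut X ≤ 3) (h1 : 2 ≤ #(A ∩ X)) (h2 : 2 ≤ #(A \ X)) : False := by
  have hP : 4 ≤ M.cut (A ∩ X) := by
    refine hA.four_le_cut _ ⟨inter_subset_left, fun h => ?_⟩ h1
    obtain ⟨v, hv⟩ := card_pos.1 (by omega : 0 < #(A \ X))
    exact (mem_sdiff.1 hv).2 (mem_inter.1 (h (mem_sdiff.1 hv).1)).2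
  have hQ : 4 ≤ M.cut (A \ X) := by
    refine hA.four_le_cut _ ⟨sdiff_subset, fun h => ?_⟩ h2
    obtain ⟨v, hv⟩ := card_pos.1 (by omega : 0 < #(A ∩ X))
    exact (mem_sdiff.1 (h (mem_inter.1 hv).1)).2 (mem_inter.1 hv).2
  have e1 := M.cut_eq_between (A ∩ X) (A \ X) (X \ A) (A ∪ X)ᶜ
    (by intro v; simp; tauto) (by rw [disjoint_left]; simp; tauto)
    (by rw [disjoint_left]; simp; tauto) (by rw [disjoint_left]; simp; tauto)
  have e2 := M.cut_eq_between (A \ X) (A ∩ X) (X \ A) (A ∪ X)ᶜ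
    (by intro v; simp; tauto) (by rw [disjoint_left]; simp; tauto)
    (by rw [disjoint_left]; simp; tauto) (by rw [disjoint_left]; simp; tauto)
  have e3 := M.cut_union_eq_between (A ∩ X) (A \ X) (X \ A) (A ∪ X)ᶜ
    (by intro v; simp; tauto) (by rw [disjoint_left]; simp; tauto)
    (by rw [disjoint_left]; simp; tauto)
  have e4 := M.cut_union_eq_between (A ∩ X) (X \ A) (A \ X) (A ∪ X)ᶜ
    (by intro v; simp; tauto) (by rw [disjoint_left]; simp; tauto)
    (by rw [disjoint_left]; simp; tauto)
  have e5 := M.cut_eq_between (X \ A) (A \ X) (A ∩ X) (A ∪ X)ᶜ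
    (by intro v; simp; tauto) (by rw [disjoint_left]; simp; tauto)
    (by rw [disjoint_left]; simp; tauto) (by rw [disjoint_left]; simp; tauto)
  have e6 := M.cut_eq_between (A ∪ X)ᶜ (A \ X) (A ∩ X) (X \ A)
    (by intro v; simp; tauto) (by rw [disjoint_left]; simp; tauto)
    (by rw [disjoint_left]; simp; tauto) (by rw [disjoint_left]; simp; tauto)
  rw [show A ∩ X ∪ A \ X = A by ext; simp; tauto] at e3
  rw [show A ∩ X ∪ X \ A = X by ext; simp; tauto] at e4
  have c1 := M.between_comm (A ∩ X) (A \ X)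
  have c2 := M.between_comm (A ∩ X) (X \ A)
  have c3 := M.between_comm (A ∩ X) (A ∪ X)ᶜ
  have c4 := M.between_comm (A \ X) (X \ A)
  have c5 := M.between_comm (A \ X) (A ∪ X)ᶜ
  have c6 := M.between_comm (X \ A) (A ∪ X)ᶜ
  have hA3 := hA.cut_le
  have hne1 : X \ A ≠ univ := by
    rintro h
    obtain ⟨v, hv⟩ := card_pos.1 (by omega : 0 < #(A \ X))
    have hv' : v ∈ X \ A := h ▸ mem_univ v
    exact (mem_sdiff.1 hv').2 (mem_sdiff.1 hv).1
  have hne2 : (A ∪ X)ᶜ ≠ univ := by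
    rintro h
    obtain ⟨v, hv⟩ := card_pos.1 (by omega : 0 < #(A \ X))
    have hv' : v ∈ (A ∪ X)ᶜ := h ▸ mem_univ v
    exact mem_compl.1 hv' (mem_union_left _ (mem_sdiff.1 hv).1)
  -- An empty quarter is not covered by `hM`. The vanishing count obtained instead makes all edges
  -- that leave one part of `A` count in the cut of `X`, against `hX`.
  have hR : 2 ≤ M.cut (X \ A) ∨ M.between (X \ A) (A ∩ X) = 0 := by
    by_cases h : (X \ A).Nonempty
    · exact Or.inl (hM _ h hne1)
    · exact Or.inr (M.between_eq_zero_of_empty h _)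
  have hS : 2 ≤ M.cut (A ∪ X)ᶜ ∨ M.between (A ∪ X)ᶜ (A \ X) = 0 := by
    by_cases h : ((A ∪ X)ᶜ).Nonempty
    · exact Or.inl (hM _ h hne2)
    · exact Or.inr (M.between_eq_zero_of_empty h _)
  omega

end cut

end CubicMap

end

section

set_option linter.unusedSectionVars false

/-! ### Short faces -/

namespace Relation

open Finset

theorem card_image_le_numClasses {D E : Type*} [Fintype D] [DecidableEq E] {r : D → D → Prop}
    (f : D → E) (hf : ∀ x y, r x y → f x = f y) : #(univ.image f) ≤ numClasses r := by
  classical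
  have : Fintype (Quot r) := Fintype.ofFinite _
  rw [numClasses, Nat.card_eq_fintype_card, ← card_univ]
  refine (card_le_card ?_).trans (card_image_le (f := Quot.lift f hf))
  intro e he
  obtain ⟨x, -, rfl⟩ := mem_image.1 he
  exact mem_image.2 ⟨Quot.mk r x, mem_univ _, rfl⟩

theorem numClasses_le_card {D E : Type*} [Finite D] {r : D → D → Prop} (f : D → E)
    (S : Finset E) (hS : ∀ x, f x ∈ S) (hf : ∀ x y, f x = f y → EqvGen r x y) :
    numClasses r ≤ #S := by
  have : #S = Nat.card S := by simp
  rw [numClasses, this]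
  refine Nat.card_le_card_of_injective (fun q : Quot r => (⟨f q.out, hS _⟩ : S)) ?_
  intro p q hpq
  rw [← Quot.out_eq p, ← Quot.out_eq q]
  exact Quot.eqvGen_sound (hf _ _ (congrArg Subtype.val hpq))

end Relation

namespace Equiv.Perm

open Relation _root_.Finset

/-- With no period up to 5, the first six iterates of a point are distinct and lie in its cycle. -/
theorem six_mul_card_image_le {D : Type*} [Fintype D] [DecidableEq D] (f : Perm D) (P : D → Prop)
    [DecidablePred P] [DecidableEq (Quot (Step f))] (hP : ∀ x, P x → P (f x))
    (h : ∀ x, P x → ∀ k, 1 ≤ k → k ≤ 5 → (f ^ k) x ≠ x) :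
    6 * #((univ.filter P).image (Quot.mk (Step f))) ≤ #(univ.filter P) := by
  refine Finset.mul_card_image_le_card _ _ ?_
  intro q hq
  obtain ⟨x, hx, rfl⟩ := mem_image.1 hq
  simp only [mem_filter, mem_univ, true_and] at hx
  have hpow : ∀ k : ℕ, P ((f ^ k) x) ∧ EqvGen (Step f) x ((f ^ k) x) := by
    intro k
    induction k with
    | zero => exact ⟨hx, EqvGen.refl _⟩
    | succ k ih =>
      rw [pow_succ', mul_apply]
      exact ⟨hP _ ih.1, EqvGen.trans _ _ _ ih.2 (EqvGen.rel _ _ rfl)⟩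
  have hinj : Set.InjOn (fun k : ℕ => (f ^ k) x) (range 6 : Finset ℕ) := by
    have key : ∀ i j : ℕ, i < j → j < 6 → (f ^ i) x ≠ (f ^ j) x := by
      intro i j hij hj he
      refine h x hx (j - i) (by omega) (by omega) ?_
      apply (f ^ i).injective
      rw [← mul_apply, ← pow_add, he]
      congr 2
      omega
    intro i hi j hj hij
    simp only [coe_range, Set.mem_Iio] at hi hj
    by_contra hne
    rcases Nat.lt_or_gt_of_ne hne with hlt | hlt
    · exact key i j hlt hj hij
    · exact key j i hlt hi hij.symm
  have hcard := card_image_of_injOn hinj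
  rw [card_range] at hcard
  rw [← hcard]
  refine card_le_card ?_
  intro y hy
  obtain ⟨k, -, rfl⟩ := mem_image.1 hy
  simp only [mem_filter, mem_univ, true_and]
  exact ⟨(hpow k).1, (Quot.eqvGen_sound (hpow k).2).symm⟩

/-- The transpositions are the edges whose darts form `s`; in this form a set of edges can be fed
into Euler's inequality. -/
theorem exists_swapProd_eq {D : Type*} [Fintype D] [DecidableEq D] (a : D → D)
    (ha : ∀ d, a (a d) = d) (s : Finset D) (hs : ∀ d ∈ s, a d ∈ s ∧ a d ≠ d) :
    ∃ l : List (D × D), 2 * l.length = #s ∧ (∀ p ∈ l, p.1 ∈ s ∧ p.2 = a p.1) ∧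
      (∀ d ∈ s, (d, a d) ∈ l ∨ (a d, d) ∈ l) ∧
      ∀ d, swapProd l d = if d ∈ s then a d else d := by
  induction hn : #s using Nat.strong_induction_on generalizing s with
  | _ n ih =>
    rcases s.eq_empty_or_nonempty with rfl | ⟨x, hx⟩
    · exact ⟨[], by simpa using hn, by simp, by simp, by simp [swapProd]⟩
    · have hax := hs x hx
      have hainj : Function.Injective a := fun u v h => by rw [← ha u, h, ha]
      have hmem : a x ∈ s.erase x := mem_erase.2 ⟨hax.2, hax.1⟩
      have hcard : #((s.erase x).erase (a x)) + 2 = #s := by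
        rw [card_erase_of_mem hmem, card_erase_of_mem hx]
        have := card_pos.2 ⟨_, hmem⟩
        rw [card_erase_of_mem hx] at this
        omega
      obtain ⟨l, h1, h2, h3, h4⟩ := ih _ (by omega) ((s.erase x).erase (a x)) (by
        intro d hd
        simp only [mem_erase] at hd ⊢
        have := hs d hd.2.2
        exact ⟨⟨fun h => hd.2.1 (hainj h), fun h => hd.1 (by rw [← h, ha]), this.1⟩, this.2⟩) rfl
      refine ⟨l ++ [(x, a x)], ?_, ?_, ?_, ?_⟩
      · rw [List.length_append, List.length_singleton]
        omega
      · intro p hp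
        rcases List.mem_append.1 hp with hp | hp
        · exact ⟨mem_of_mem_erase (mem_of_mem_erase (h2 p hp).1), (h2 p hp).2⟩
        · simp only [List.mem_singleton] at hp
          subst hp
          exact ⟨hx, rfl⟩
      · intro d hd
        by_cases hdx : d = x
        · subst hdx
          simp
        · by_cases hda : d = a x
          · subst hda
            simp [ha]
          · rcases h3 d (mem_erase.2 ⟨hda, mem_erase.2 ⟨hdx, hd⟩⟩) with h | h
            · exact Or.inl (List.mem_append_left _ h)
            · exact Or.inr (List.mem_append_left _ h)
      · intro d
        have hprod : swapProd (l ++ [(x, a x)]) d = swapProd l (swap x (a x) d) := by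
          simp [swapProd]
        rw [hprod]
        by_cases hdx : d = x
        · subst hdx
          rw [swap_apply_left, h4]
          simp [hx]
        · by_cases hda : d = a x
          · subst hda
            rw [swap_apply_right, h4]
            simp [ha, hax.1]
          · rw [swap_apply_of_ne_of_ne hdx hda, h4]
            simp [hdx, hda]

end Equiv.Perm

/-! ### Faces inside an atom -/

namespace CubicMap

open Finset Relation Equiv.Perm

variable {V : Type*} (M : CubicMap V)

theorem crn_face (d : V × Fin 3) : crn (M.face d) false = crn (M.inv d) true := by
  simp only [crn, face_apply, cond_true, cond_false, add_assoc]
  rfl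

theorem crn_false_surjective : Function.Surjective fun d : V × Fin 3 => crn d false := by
  rintro ⟨v, i⟩
  refine ⟨(v, i + 2), ?_⟩
  simp only [crn, cond_false, Prod.mk.injEq, true_and, add_assoc]
  fin_cases i <;> rfl

variable [Fintype V] [DecidableEq V]

variable {M}

/-- The labels are constant along faces and every corner is `crn d false` for some dart, so there
are at least as many faces as labels. -/
theorem Planar.card_le (h : M.Planar) :
    Fintype.card V + 4 ≤ 2 * numClasses (Step M.face) := by
  obtain ⟨L, hL, hcard⟩ := h
  refine hcard.trans (Nat.mul_le_mul_left 2 ?_)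
  have h1 : univ.image L = univ.image fun d => L (crn d false) := by
    ext x
    simp only [mem_image, mem_univ, true_and]
    constructor
    · rintro ⟨d, rfl⟩
      obtain ⟨e, he⟩ := crn_false_surjective d
      exact ⟨e, congrArg L he⟩
    · rintro ⟨d, rfl⟩
      exact ⟨_, rfl⟩
  rw [h1]
  refine card_image_le_numClasses _ ?_
  rintro x y rfl
  rw [crn_face, hL x false]
  rfl

variable (M) in
/-- The darts on faces all of whose vertices lie in `A`. -/
def InnerDart (A : Finset V) (d : V × Fin 3) : Prop :=
  ∀ x, EqvGen (Step M.face) d x → x.1 ∈ A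

theorem InnerDart.congr {A : Finset V} {d e : V × Fin 3} (h : EqvGen (Step M.face) d e) :
    M.InnerDart A d ↔ M.InnerDart A e :=
  ⟨fun hd x hx => hd x (EqvGen.trans _ _ _ h hx),
    fun hd x hx => hd x (EqvGen.trans _ _ _ (EqvGen.symm _ _ h) hx)⟩

theorem InnerDart.mem {A : Finset V} {d : V × Fin 3} (h : M.InnerDart A d) : d.1 ∈ A :=
  h d (EqvGen.refl _)

theorem innerDart_face {A : Finset V} {d : V × Fin 3} :
    M.InnerDart A (M.face d) ↔ M.InnerDart A d :=
  (InnerDart.congr (EqvGen.rel _ _ rfl)).symm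

theorem InnerDart.inv_mem {A : Finset V} {d : V × Fin 3} (h : M.InnerDart A d) :
    (M.inv d).1 ∈ A :=
  (innerDart_face.2 h).mem

theorem face_inv (d : V × Fin 3) : M.face (M.inv d) = (d.1, d.2 + 1) := by
  rw [face_apply, M.inv_inv]

theorem not_innerDart_rot {A : Finset V} {d : V × Fin 3} (h : (M.inv d).1 ∉ A) :
    ¬ M.InnerDart A (d.1, d.2 + 1) := by
  rw [← face_inv (M := M), innerDart_face]
  exact fun h' => h h'.mem

theorem card_dart_eq (A : Finset V) : #{d : V × Fin 3 | d.1 ∈ A} = 3 * #A := by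
  have : (univ.filter fun d : V × Fin 3 => d.1 ∈ A) = A ×ˢ univ := by
    ext d
    simp
  rw [this, card_product]
  simp [mul_comm]

/-- The outside of `A` is connected: two parts without edges between them would each send two edges
to `A`, making its cut at least 4. -/
theorem eqvGen_of_connected {A : Finset V} (hM : M.TwoConn) (hcut : M.cut A ≤ 3)
    {r : V → V → Prop} (hr : Equivalence r)
    (hadj : ∀ d, d.1 ∉ A → (M.inv d).1 ∉ A → r d.1 (M.inv d).1) {u v : V} (hu : u ∉ A)
    (hv : v ∉ A) : r u v := by
  classical
  by_contra huv
  let Y : Finset V := {w | w ∉ A ∧ r u w}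
  let Z : Finset V := {w | w ∉ A ∧ ¬ r u w}
  have hYZ0 : M.between Y Z = 0 := by
    rw [between, card_eq_zero, filter_eq_empty_iff]
    rintro d - ⟨h1, h2⟩
    simp only [Y, Z, mem_filter, mem_univ, true_and] at h1 h2
    exact h2.2 (hr.trans h1.2 (hadj d h1.1 h2.1))
  have dYZ : Disjoint Y Z := by
    rw [disjoint_left]
    intro w h1 h2
    simp only [Y, Z, mem_filter, mem_univ, true_and] at h1 h2
    exact h2.2 h1.2
  have hA := M.cut_eq_between A Y Z ∅ (by intro w; simp [Y, Z]; tauto) dYZ (by simp) (by simp)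
  have hY := M.cut_eq_between Y A Z ∅ (by intro w; simp [Y, Z]; tauto)
    (by rw [disjoint_left]; simp [Z]; tauto) (by simp) (by simp)
  have hZ := M.cut_eq_between Z A Y ∅ (by intro w; simp [Y, Z]; tauto)
    (by rw [disjoint_left]; simp [Y]; tauto) (by simp) (by simp)
  have e1 : M.between Y ∅ = 0 := by simp [between]
  have e2 : M.between Z ∅ = 0 := by simp [between]
  have hYu : u ∈ Y := by simp [Y, hu, hr.refl u]
  have hZv : v ∈ Z := by simp [Z, hv, huv]
  have hY2 := hM Y ⟨u, hYu⟩ (fun h => disjoint_left.1 dYZ (h ▸ mem_univ v) hZv)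
  have hZ2 := hM Z ⟨v, hZv⟩ (fun h => disjoint_left.1 dYZ hYu (h ▸ mem_univ u))
  have c1 := M.between_comm A Y
  have c2 := M.between_comm A Z
  have c3 := M.between_comm Y Z
  omega

/-- Twice the number of faces inside a set that is left by at most three edges. -/
theorem card_add_two_le_innerFaces {A : Finset V} [DecidablePred (M.InnerDart A)]
    [DecidableEq (Quot (Step M.face))] (hM : M.TwoConn) (hP : M.Planar)
    (hcut : M.cut A ≤ 3) (hpos : 0 < M.cut A) :
    #A + 2 ≤ M.cut A + 2 * #((univ.filter (M.InnerDart A)).image (Quot.mk (Step M.face))) := by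
  set FA := (univ.filter (M.InnerDart A)).image (Quot.mk (Step M.face)) with hFA
  -- `s` holds the darts of the edges not inside `A`. Since the face permutation is reversal
  -- followed by rotation, multiplying by these transpositions leaves the bare rotation on `s` and
  -- the face permutation elsewhere.
  let s : Finset (V × Fin 3) := {d | ¬ (d.1 ∈ A ∧ (M.inv d).1 ∈ A)}
  obtain ⟨l, hl1, hl2, hl3, hl4⟩ := exists_swapProd_eq M.inv M.inv_inv s (by
    intro d hd
    simp only [s, mem_filter, mem_univ, true_and, M.inv_inv] at hd ⊢
    exact ⟨fun h => hd h.symm, M.inv_ne d⟩)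
  have hs : #s = 3 * #Aᶜ + M.cut A := by
    rw [← card_dart_eq, cut, ← card_union_of_disjoint]
    · congr 1
      ext d
      simp only [s, mem_filter, mem_univ, true_and, mem_union, mem_compl]
      tauto
    · rw [disjoint_left]
      intro d h1 h2
      simp only [mem_filter, mem_univ, true_and, mem_compl] at h1 h2
      exact h1 h2.1
  have hEuler := numClasses_add_numClasses_le M.face l
  have hF := hP.card_le
  obtain ⟨d₀, hd₀⟩ := card_pos.1 hpos
  simp only [mem_filter, mem_univ, true_and] at hd₀
  have hd₀' : ¬ M.InnerDart A d₀ := fun h => hd₀.2 h.inv_mem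
  -- The invariant `g` separates the outer vertices, the inner faces and the remaining darts at `A`;
  -- the last kind exists because the cut is not empty.
  have hvert : #Aᶜ + (#FA + 1) ≤ numClasses (Step (M.face * swapProd l)) := by
    let g : V × Fin 3 → V ⊕ Option (Quot (Step M.face)) := fun d =>
      if d.1 ∈ A then Sum.inr (if M.InnerDart A d then some (Quot.mk _ d) else none)
      else Sum.inl d.1
    have hg : ∀ x y, Step (M.face * swapProd l) x y → g x = g y := by
      rintro x y rfl
      change g x = g (M.face (swapProd l x))
      rw [hl4]
      split_ifs with hx
      · simp only [s, mem_filter, mem_univ, true_and] at hx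
        rw [face_inv]
        by_cases hxA : x.1 ∈ A
        · have hx' : (M.inv x).1 ∉ A := fun h => hx ⟨hxA, h⟩
          have h1 : ¬ M.InnerDart A x := fun h => hx' h.inv_mem
          have h2 := not_innerDart_rot (M := M) hx'
          simp only [g, hxA, if_true, h1, h2, if_false]
        · simp only [g, hxA, if_false]
      · simp only [s, mem_filter, mem_univ, true_and, not_not] at hx
        have h1 : (M.face x).1 ∈ A := hx.2
        have h2 : Quot.mk (Step M.face) (M.face x) = Quot.mk _ x :=
          (Quot.sound (r := Step M.face) (rfl : M.face x = M.face x)).symm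
        simp only [g, h1, hx.1, if_true, innerDart_face, h2]
    refine le_trans ?_ (card_image_le_numClasses g hg)
    rw [← card_insertNone, ← card_disjSum]
    refine card_le_card ?_
    intro z hz
    rw [mem_disjSum] at hz
    simp only [mem_image, mem_univ, true_and]
    rcases hz with ⟨v, hv, rfl⟩ | ⟨o, ho, rfl⟩
    · refine ⟨(v, 0), ?_⟩
      rw [mem_compl] at hv
      simp [g, hv]
    · cases o with
      | none => exact ⟨d₀, by simp [g, hd₀.1, hd₀']⟩
      | some q =>
        rw [some_mem_insertNone] at ho
        obtain ⟨d, hd, rfl⟩ := mem_image.1 ho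
        simp only [mem_filter, mem_univ, true_and] at hd
        exact ⟨d, by simp [g, hd, hd.mem]⟩
  -- Outside `A` both rotation and reversal are available, so the connected outside is one joint
  -- orbit, and every face that is not inner reaches it.
  have horb : numClasses (StepOr M.face l) ≤ #FA + 1 := by
    rw [← card_insertNone]
    have hface : ∀ x y, EqvGen (Step M.face) x y → EqvGen (StepOr M.face l) x y := fun x y h =>
      eqvGen_of_forall (fun _ _ h => EqvGen.rel _ _ (Or.inl h)) h
    have hinv : ∀ d, (d.1 ∈ A → (M.inv d).1 ∉ A) → EqvGen (StepOr M.face l) d (M.inv d) := by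
      intro d hd
      rcases hl3 d (by simpa [s] using hd) with h | h
      · exact EqvGen.rel _ _ (Or.inr h)
      · exact EqvGen.symm _ _ (EqvGen.rel _ _ (Or.inr h))
    have hrot : ∀ d : V × Fin 3, d.1 ∉ A → EqvGen (StepOr M.face l) d (d.1, d.2 + 1) := by
      intro d hd
      refine EqvGen.trans _ _ _ (hinv d fun h => (hd h).elim) (EqvGen.rel _ _ (Or.inl ?_))
      exact face_inv d
    have hvtx : ∀ v i j, v ∉ A → EqvGen (StepOr M.face l) (v, i) (v, j) := by
      intro v i j hv
      have h1 := hrot (v, 0) hv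
      have h2 := hrot (v, 1) hv
      have h0 : ∀ i, EqvGen (StepOr M.face l) (v, 0) (v, i) := by
        intro i
        fin_cases i
        · exact EqvGen.refl _
        · exact h1
        · exact EqvGen.trans _ _ _ h1 h2
      exact EqvGen.trans _ _ _ (EqvGen.symm _ _ (h0 i)) (h0 j)
    have hall : ∀ u v : V, u ∉ A → v ∉ A → EqvGen (StepOr M.face l) (u, 0) (v, 0) := by
      intro u v hu hv
      refine eqvGen_of_connected (r := fun u v => EqvGen (StepOr M.face l) (u, 0) (v, 0)) hM hcut
        ⟨fun _ => EqvGen.refl _, fun h => EqvGen.symm _ _ h,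
          fun h h' => EqvGen.trans _ _ _ h h'⟩ ?_ hu hv
      intro d h1 h2
      refine EqvGen.trans _ _ _ (hvtx d.1 0 d.2 h1) (EqvGen.trans _ _ _
        (hinv d fun h => (h1 h).elim) (hvtx _ _ 0 h2))
    have hout : ∀ d, ¬ M.InnerDart A d →
        ∃ v, v ∉ A ∧ EqvGen (StepOr M.face l) d (v, 0) := by
      intro d hd
      simp only [InnerDart, not_forall] at hd
      obtain ⟨x, hx, hxA⟩ := hd
      exact ⟨x.1, hxA, EqvGen.trans _ _ _ (hface _ _ hx) (hvtx x.1 x.2 0 hxA)⟩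
    refine numClasses_le_card
      (fun d => if M.InnerDart A d then some (Quot.mk (Step M.face) d) else none) _ ?_ ?_
    · intro d
      by_cases hd : M.InnerDart A d
      · rw [if_pos hd, some_mem_insertNone]
        exact mem_image.2 ⟨d, by simpa using hd, rfl⟩
      · rw [if_neg hd]
        exact none_mem_insertNone
    · intro x y hxy
      by_cases hx : M.InnerDart A x <;> by_cases hy : M.InnerDart A y
      · simp only [hx, hy, if_true] at hxy
        exact hface _ _ (Quot.eqvGen_exact (Option.some.inj hxy))
      · simp [hx, hy] at hxy
      · simp [hx, hy] at hxy
      · obtain ⟨u, hu, hu'⟩ := hout x hx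
        obtain ⟨v, hv, hv'⟩ := hout y hy
        exact EqvGen.trans _ _ _ hu' (EqvGen.trans _ _ _ (hall u v hu hv) (EqvGen.symm _ _ hv'))
  have hAc : #A + #Aᶜ = Fintype.card V := card_add_card_compl A
  omega

/-- If all inner faces had length at least 6, counting their darts against Euler's inequality would
leave at most 3 · cut − 6 darts of `A` on other faces. There are at least as many as the cut has
edges, so the cut is 3 and these are exactly the leaving darts. That set is closed under rotation,
hence consists of all darts at one vertex, and the rest of `A` would be cut off. -/
theorem IsAtom.exists_short_face {A : Finset V} (hA : M.IsAtom A) (hM : M.TwoConn)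
    (hP : M.Planar) :
    ∃ d, M.InnerDart A d ∧ ∃ k, 1 ≤ k ∧ k ≤ 5 ∧ (M.face ^ k) d = d := by
  classical
  by_contra! hcon
  have h6 := six_mul_card_image_le M.face (M.InnerDart A) (fun x hx => innerDart_face.2 hx)
    (fun x hx k h1 h5 => hcon x hx k h1 h5)
  have hAne : A.Nonempty := card_pos.1 (by have := hA.two_le_card; omega)
  have hcut := hA.cut_le
  have hsplit : #(univ.filter (M.InnerDart A)) +
      #{d : V × Fin 3 | d.1 ∈ A ∧ ¬ M.InnerDart A d} = 3 * #A := by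
    rw [← card_dart_eq, ← card_union_of_disjoint]
    · congr 1
      ext d
      simp only [mem_filter, mem_univ, true_and, mem_union]
      have : M.InnerDart A d → d.1 ∈ A := fun h => h.mem
      tauto
    · rw [disjoint_left]
      intro d h1 h2
      simp only [mem_filter, mem_univ, true_and] at h1 h2
      exact h2.2 h1
  rcases Nat.eq_zero_or_pos (M.cut A) with h0 | hpos
  -- An atom with empty cut is the whole map, where the ordinary Euler count already gives the
  -- contradiction.
  · have hAu : A = univ := by
      by_contra hne
      have := hM A hAne hne
      omega
    subst hAu
    have hF := hP.card_le
    have : numClasses (Step M.face) ≤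
        #((univ.filter (M.InnerDart univ)).image (Quot.mk (Step M.face))) :=
      numClasses_le_card (Quot.mk (Step M.face)) _
        (fun x => mem_image_of_mem _ (by simp [InnerDart])) (fun x y h => Quot.eqvGen_exact h)
    rw [card_univ] at hsplit
    omega
  · have hmain := card_add_two_le_innerFaces hM hP hcut hpos
    have h2 : 2 ≤ M.cut A := by
      refine hM A hAne ?_
      rintro rfl
      simp [cut_univ] at hpos
    set C : Finset (V × Fin 3) := {d | d.1 ∈ A ∧ (M.inv d).1 ∉ A} with hC
    have hCc : #C = M.cut A := rfl
    set N : Finset (V × Fin 3) := {d | d.1 ∈ A ∧ ¬ M.InnerDart A d} with hN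
    have hCN : C ⊆ N := by
      intro d hd
      simp only [hC, hN, mem_filter, mem_univ, true_and] at hd ⊢
      exact ⟨hd.1, fun h => hd.2 h.inv_mem⟩
    have hrotN : ∀ d ∈ C, (d.1, d.2 + 1) ∈ N := by
      intro d hd
      simp only [hC, hN, mem_filter, mem_univ, true_and] at hd ⊢
      exact ⟨hd.1, not_innerDart_rot hd.2⟩
    have hN1 := card_le_card hCN
    have h3 : M.cut A = 3 ∧ #N ≤ 3 := by omega
    have hNC : C = N := eq_of_subset_of_card_le hCN (by omega)
    obtain ⟨⟨v, i⟩, hv⟩ := card_pos.1 (by omega : 0 < #C)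
    have hv1 : (v, i + 1) ∈ C := hNC ▸ hrotN _ hv
    have hv2 : (v, i + 1 + 1) ∈ C := hNC ▸ hrotN _ hv1
    have hvall : ∀ j, (v, j) ∈ C := by
      intro j
      have : j = i ∨ j = i + 1 ∨ j = i + 1 + 1 := by
        clear * -
        revert i j
        decide
      rcases this with rfl | rfl | rfl
      · exact hv
      · exact hv1
      · exact hv2
    have hCeq : univ.image (fun j => (v, j)) = C := by
      refine eq_of_subset_of_card_le ?_ ?_
      · intro d hd
        obtain ⟨j, -, rfl⟩ := mem_image.1 hd
        exact hvall j
      · rw [card_image_of_injective _ (Prod.mk_right_injective v)]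
        simp
        omega
    have hvA : v ∈ A := by
      simp only [hC, mem_filter, mem_univ, true_and] at hv
      exact hv.1
    have hzero : M.cut (A.erase v) = 0 := by
      rw [cut, card_eq_zero, filter_eq_empty_iff]
      rintro d - ⟨h4, h5⟩
      rw [mem_erase] at h4
      have h6 : (M.inv d).1 ∈ A := by
        by_contra h7
        have : d ∈ C := by simp [hC, h4.2, h7]
        rw [← hCeq] at this
        obtain ⟨j, -, rfl⟩ := mem_image.1 this
        exact h4.1 rfl
      have h7 : (M.inv d).1 = v := by
        by_contra h8
        exact h5 (mem_erase.2 ⟨h8, h6⟩)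
      have h8 : M.inv d ∈ C := by
        have := hvall (M.inv d).2
        rwa [← h7] at this
      simp only [hC, mem_filter, mem_univ, true_and, M.inv_inv] at h8
      exact h8.2 h4.2
    have := hM (A.erase v) (card_pos.1 (by
      rw [card_erase_of_mem hvA]; have := hA.two_le_card; omega)) (fun h => by
        have := h ▸ mem_univ v
        simp at this)
    omega

end CubicMap

end

section

/-! ### Pairs of involutions -/

section involutions

open Relation Function

variable {F : Type*} [Finite F]

/-- The relation whose classes are the orbits of the group generated by two involutions. -/
def DihedralStep (c m : F → F) (x y : F) : Prop := c x = y ∨ m x = y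

/-- An orbit of two involutions, the first without fixed points, that contains a fixed point of the
second contains exactly two of them. -/
theorem exists_other_fixed_point {c m : F → F} (hc : Involutive c) (hm : Involutive m)
    (hcf : ∀ x, c x ≠ x) {f : F} (hf : m f = f) :
    ∃ f', f' ≠ f ∧ m f' = f' ∧ EqvGen (DihedralStep c m) f f' ∧
      ∀ g, m g = g → EqvGen (DihedralStep c m) f g → g = f ∨ g = f' := by
  -- The orbit of `f` is its cycle under `π`, on which `m` acts on exponents by k ↦ −k and `c` by k
  -- ↦ −1 − k. So the fixed points of `m` are the solutions of 2k ≡ 0 modulo the period.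
  let C : Equiv.Perm F := hc.toPerm
  let N : Equiv.Perm F := hm.toPerm
  let π : Equiv.Perm F := N * C
  have hNN : N * N = 1 := by ext x; exact hm x
  have hCC : C * C = 1 := by ext x; exact hc x
  have hπi : π⁻¹ = C * N := by
    rw [inv_eq_iff_mul_eq_one]
    calc N * C * (C * N) = N * (C * C) * N := by group
      _ = 1 := by rw [hCC, mul_one, hNN]
  have hNinv : N⁻¹ = N := inv_eq_of_mul_eq_one_left hNN
  have hconj : N * π * N⁻¹ = π⁻¹ := by
    rw [hNinv, hπi]
    calc N * (N * C) * N = (N * N) * C * N := by group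
      _ = C * N := by rw [hNN, one_mul]
  have hNpow : ∀ k : ℤ, m ((π ^ k) f) = (π ^ (-k)) f := by
    intro k
    have h : N * π ^ k = π ^ (-k) * N := by
      have := conj_zpow (i := k) (a := N) (b := π)
      rw [hconj, inv_zpow'] at this
      rw [this]
      group
    have h2 : (N * π ^ k) f = (π ^ (-k) * N) f := by rw [h]
    have h3 : N f = f := hf
    rw [Equiv.Perm.mul_apply, Equiv.Perm.mul_apply, h3] at h2
    exact h2
  have hCpow : ∀ k : ℤ, c ((π ^ k) f) = (π ^ (-1 - k)) f := by
    intro k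
    have h : C = π⁻¹ * N := by
      rw [hπi, mul_assoc, hNN, mul_one]
    have h2 : C ((π ^ k) f) = π⁻¹ (N ((π ^ k) f)) := by
      conv_lhs => rw [h]
      rfl
    have h3 : N ((π ^ k) f) = (π ^ (-k)) f := hNpow k
    have h4 : c ((π ^ k) f) = C ((π ^ k) f) := rfl
    rw [h4, h2, h3, ← Equiv.Perm.mul_apply, ← zpow_neg_one, ← zpow_add]
    rfl
  have hstep : ∀ x, EqvGen (DihedralStep c m) x (π x) := fun x =>
    EqvGen.trans _ (c x) _ (EqvGen.rel _ _ (Or.inl rfl)) (EqvGen.rel _ _ (Or.inr rfl))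
  have hpowrel : ∀ n : ℕ, EqvGen (DihedralStep c m) f ((π ^ n) f) := by
    intro n
    induction n with
    | zero => exact EqvGen.refl _
    | succ n ih =>
      rw [pow_succ', Equiv.Perm.mul_apply]
      exact EqvGen.trans _ _ _ ih (hstep _)
  have hmem : ∀ g, EqvGen (DihedralStep c m) f g → ∃ k : ℤ, g = (π ^ k) f := by
    intro g hg
    have := EqvGen.apply_eq (f := fun x => ∃ k : ℤ, x = (π ^ k) f) ?_ hg
    · rw [← this]
      exact ⟨0, rfl⟩
    · rintro x y (rfl | rfl)
      · refine propext ⟨?_, ?_⟩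
        · rintro ⟨k, rfl⟩
          exact ⟨_, hCpow k⟩
        · rintro ⟨k, hk⟩
          exact ⟨_, by rw [← hc x, hk, hCpow]⟩
      · refine propext ⟨?_, ?_⟩
        · rintro ⟨k, rfl⟩
          exact ⟨_, hNpow k⟩
        · rintro ⟨k, hk⟩
          exact ⟨_, by rw [← hm x, hk, hNpow]⟩
  set n := minimalPeriod (π • ·) f with hn
  have hdvd : ∀ k : ℤ, (π ^ k) f = f ↔ (n : ℤ) ∣ k := fun k =>
    MulAction.zpow_smul_eq_iff_minimalPeriod_dvd (a := π) (b := f)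
  have heq : ∀ j k : ℤ, (π ^ j) f = (π ^ k) f ↔ (n : ℤ) ∣ j - k := by
    intro j k
    rw [← hdvd]
    constructor
    · intro h
      rw [sub_eq_neg_add, zpow_add, Equiv.Perm.mul_apply, h, ← Equiv.Perm.mul_apply, ← zpow_add]
      simp
    · intro h
      conv_rhs => rw [← h, ← Equiv.Perm.mul_apply, ← zpow_add]
      congr 2
      ring
  have hnpos : 0 < n := by
    refine minimalPeriod_pos_of_mem_periodicPts ?_
    exact (MulAction.injective π).mem_periodicPts f
  -- For n = 2l + 1 the point `π ^ l` applied to `f` would be fixed by `c`. With n even, the second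
  -- fixed point of `m` is at half the period.
  have heven : ¬ Odd n := by
    rintro ⟨l, hl⟩
    refine hcf ((π ^ (l : ℤ)) f) ?_
    rw [hCpow, heq]
    exact ⟨-1, by rw [hl]; push_cast; ring⟩
  obtain ⟨l, hl⟩ := Nat.not_odd_iff_even.1 heven
  refine ⟨(π ^ (l : ℤ)) f, ?_, ?_, ?_, ?_⟩
  · intro h
    rw [hdvd] at h
    have := Nat.le_of_dvd (by omega) (Int.natCast_dvd_natCast.1 h)
    omega
  · rw [hNpow, heq]
    exact ⟨-1, by rw [hl]; push_cast; ring⟩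
  · rw [zpow_natCast]
    exact hpowrel l
  · intro g hg hfg
    obtain ⟨k, rfl⟩ := hmem g hfg
    rw [hNpow, heq, hl] at hg
    obtain ⟨t, ht⟩ := hg
    push_cast at ht
    have hk : k = -(l * t) := by linarith
    rcases Int.even_or_odd t with ⟨u, hu⟩ | ⟨u, hu⟩
    · left
      rw [hdvd, hk, hl, hu]
      exact ⟨-u, by push_cast; ring⟩
    · right
      rw [heq, hk, hl, hu]
      exact ⟨-u - 1, by push_cast; ring⟩

/-- Two involutions without fixed points have a common proper `2`-colouring. -/
theorem exists_coloring_of_involutive {F : Type*} {a b : F → F} (ha : Involutive a) (hb : Involutive b)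
    (haf : ∀ x, a x ≠ x) (hbf : ∀ x, b x ≠ x) :
    ∃ col : F → Bool, (∀ x, col (a x) = !col x) ∧ ∀ x, col (b x) = !col x := by
  classical
  let A : Equiv.Perm F := ha.toPerm
  let B : Equiv.Perm F := hb.toPerm
  let π : Equiv.Perm F := A * B
  have hAA : A * A = 1 := by ext x; exact ha x
  have hBB : B * B = 1 := by ext x; exact hb x
  have hAinv : A⁻¹ = A := inv_eq_of_mul_eq_one_left hAA
  have hπi : π⁻¹ = B * A := by
    rw [inv_eq_iff_mul_eq_one]
    calc A * B * (B * A) = A * (B * B) * A := by group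
      _ = 1 := by rw [hBB, mul_one, hAA]
  have hconj : A * π * A⁻¹ = π⁻¹ := by
    rw [hAinv, hπi]
    calc A * (A * B) * A = (A * A) * B * A := by group
      _ = B * A := by rw [hAA, one_mul]
  have hA : ∀ (k : ℤ) (x : F), a ((π ^ k) x) = (π ^ (-k)) (a x) := by
    intro k x
    have h : A * π ^ k = π ^ (-k) * A := by
      have := conj_zpow (i := k) (a := A) (b := π)
      rw [hconj, inv_zpow'] at this
      rw [this]
      group
    exact congrArg (fun g : Equiv.Perm F => g x) h
  have hB : ∀ (k : ℤ) (x : F), b ((π ^ k) x) = (π ^ (-k - 1)) (a x) := by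
    intro k x
    have h : B * π ^ k = π ^ (-k - 1) * A := by
      have h1 := conj_zpow (i := k + 1) (a := A) (b := π)
      rw [hconj, inv_zpow'] at h1
      have h2 : A * π ^ (k + 1) = B * π ^ k := by
        rw [add_comm, zpow_add, zpow_one, ← mul_assoc, ← mul_assoc, hAA, one_mul]
      rw [← h2, show -k - 1 = -(k + 1) by ring, h1]
      group
    exact congrArg (fun g : Equiv.Perm F => g x) h
  -- In each orbit, with representative y, the two colour classes are the cycles under `π` of y and
  -- of `a y`.
  let r : F → F := fun x => (Quot.mk (DihedralStep a b) x).out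
  have hra : ∀ x, r (a x) = r x := fun x =>
    congrArg Quot.out (Quot.sound (r := DihedralStep a b) (Or.inl rfl)).symm
  have hrb : ∀ x, r (b x) = r x := fun x =>
    congrArg Quot.out (Quot.sound (r := DihedralStep a b) (Or.inr rfl)).symm
  have hmem : ∀ x, (∃ k : ℤ, x = (π ^ k) (r x)) ∨ ∃ k : ℤ, x = (π ^ k) (a (r x)) := by
    intro x
    have hx : EqvGen (DihedralStep a b) (r x) x := Quot.eqvGen_exact (Quot.out_eq _)
    generalize r x = y at hx
    have := EqvGen.apply_eq
      (f := fun x => (∃ k : ℤ, x = (π ^ k) y) ∨ ∃ k : ℤ, x = (π ^ k) (a y)) ?_ hx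
    · rw [← this]
      exact Or.inl ⟨0, rfl⟩
    · have key1 : ∀ x, ((∃ k : ℤ, x = (π ^ k) y) ∨ ∃ k : ℤ, x = (π ^ k) (a y)) →
          ((∃ k : ℤ, a x = (π ^ k) y) ∨ ∃ k : ℤ, a x = (π ^ k) (a y)) := by
        rintro x (⟨k, rfl⟩ | ⟨k, rfl⟩)
        · exact Or.inr ⟨_, hA k y⟩
        · exact Or.inl ⟨-k, by rw [hA, ha]⟩
      have key2 : ∀ x, ((∃ k : ℤ, x = (π ^ k) y) ∨ ∃ k : ℤ, x = (π ^ k) (a y)) →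
          ((∃ k : ℤ, b x = (π ^ k) y) ∨ ∃ k : ℤ, b x = (π ^ k) (a y)) := by
        rintro x (⟨k, rfl⟩ | ⟨k, rfl⟩)
        · exact Or.inr ⟨_, hB k y⟩
        · exact Or.inl ⟨-k - 1, by rw [hB, ha]⟩
      rintro u v (rfl | rfl)
      · refine propext ⟨key1 u, fun h => ?_⟩
        have := key1 _ h
        rwa [ha] at this
      · refine propext ⟨key2 u, fun h => ?_⟩
        have := key2 _ h
        rwa [hb] at this
  -- If `a y` were an even power of `π` applied to y, half that power would give a fixed point of
  -- `a`; an odd power would similarly give one of `b`.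
  have hdisj : ∀ (y : F) (j k : ℤ), (π ^ j) y ≠ (π ^ k) (a y) := by
    intro y j k h
    have h1 : (π ^ (j - k)) y = a y := by
      rw [sub_eq_neg_add, zpow_add, Equiv.Perm.mul_apply, h, ← Equiv.Perm.mul_apply, ← zpow_add]
      simp
    rcases Int.even_or_odd (j - k) with ⟨l, hl⟩ | ⟨l, hl⟩
    · refine haf ((π ^ l) y) ?_
      rw [hA, ← h1, ← Equiv.Perm.mul_apply, ← zpow_add, hl]
      congr 2
      ring
    · refine hbf ((π ^ l) y) ?_
      rw [hB, ← h1, ← Equiv.Perm.mul_apply, ← zpow_add, hl]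
      congr 2
      ring
  refine ⟨fun x => decide (∃ k : ℤ, x = (π ^ k) (r x)), ?_, ?_⟩
  · intro x
    rcases hmem x with ⟨k, hk⟩ | ⟨k, hk⟩
    · have h1 : ∃ k : ℤ, x = (π ^ k) (r x) := ⟨k, hk⟩
      have h2 : ¬ ∃ k : ℤ, a x = (π ^ k) (r (a x)) := by
        rintro ⟨j, hj⟩
        rw [hra, hk, hA, ← hk] at hj
        exact hdisj (r x) j (-k) hj.symm
      simp only [h1, h2, decide_true, decide_false, Bool.not_true]
    · have h1 : ¬ ∃ k : ℤ, x = (π ^ k) (r x) := by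
        rintro ⟨j, hj⟩
        exact hdisj (r x) j k (hj ▸ hk)
      have h2 : ∃ k : ℤ, a x = (π ^ k) (r (a x)) := by
        refine ⟨-k, ?_⟩
        rw [hra]
        conv_lhs => rw [hk, hA, ha]
      simp only [h1, h2, decide_true, decide_false, Bool.not_false]
  · intro x
    rcases hmem x with ⟨k, hk⟩ | ⟨k, hk⟩
    · have h1 : ∃ k : ℤ, x = (π ^ k) (r x) := ⟨k, hk⟩
      have h2 : ¬ ∃ k : ℤ, b x = (π ^ k) (r (b x)) := by
        rintro ⟨j, hj⟩
        rw [hrb, hk, hB, ← hk] at hj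
        exact hdisj (r x) j (-k - 1) hj.symm
      simp only [h1, h2, decide_true, decide_false, Bool.not_true]
    · have h1 : ¬ ∃ k : ℤ, x = (π ^ k) (r x) := by
        rintro ⟨j, hj⟩
        exact hdisj (r x) j k (hj ▸ hk)
      have h2 : ∃ k : ℤ, b x = (π ^ k) (r (b x)) := by
        refine ⟨-k - 1, ?_⟩
        rw [hrb]
        conv_lhs => rw [hk, hB, ha]
      simp only [h1, h2, decide_true, decide_false, Bool.not_false]

end involutions

end

section

/-! ### Strands of a partial cubic map -/

open Relation Function

/-- The corners on the two sides of an edge, linked along the edge with twist `T`. Fixed points of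
`β` are loose ends. -/
def Link {V : Type*} (β : V × Fin 3 → V × Fin 3) (T : V × Fin 3 → Bool) (p q : V × Fin 3) : Prop :=
  ∃ d b, β d ≠ d ∧ p = crn d b ∧ q = crn (β d) (xor (!b) (T d))

/-- No strand passes twice through a vertex. -/
def StrandsValid {V : Type*} (β : V × Fin 3 → V × Fin 3) (T : V × Fin 3 → Bool) : Prop :=
  ∀ v i j, i ≠ j → ¬ EqvGen (Link β T) (v, i) (v, j)

/-- The other end of the corner at which a side of a dart lies. -/
def otherFlag {V : Type*} (x : (V × Fin 3) × Bool) : (V × Fin 3) × Bool :=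
  bif x.2 then ((x.1.1, x.1.2 + 1), false) else ((x.1.1, x.1.2 + 2), true)

theorem otherFlag_involutive {V : Type*} : Involutive (otherFlag (V := V)) := by
  rintro ⟨⟨v, i⟩, b⟩
  have h1 : i + 2 + 1 = i := by revert i; decide
  have h2 : i + 1 + 2 = i := by revert i; decide
  cases b <;> simp [otherFlag, h1, h2]

theorem otherFlag_ne {V : Type*} (x : (V × Fin 3) × Bool) : otherFlag x ≠ x := by
  obtain ⟨⟨v, i⟩, b⟩ := x
  cases b <;> simp [otherFlag]

theorem crn_otherFlag {V : Type*} (x : (V × Fin 3) × Bool) :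
    crn (otherFlag x).1 (otherFlag x).2 = crn x.1 x.2 := by
  obtain ⟨⟨v, i⟩, b⟩ := x
  have h1 : i + 2 + 2 = i + 1 := by revert i; decide
  have h2 : i + 1 + 1 = i + 2 := by revert i; decide
  cases b <;> simp [otherFlag, crn, h1, h2]

theorem eq_or_eq_otherFlag {V : Type*} {x y : (V × Fin 3) × Bool}
    (h : crn x.1 x.2 = crn y.1 y.2) : y = x ∨ y = otherFlag x := by
  obtain ⟨⟨v, i⟩, b⟩ := x
  obtain ⟨⟨w, j⟩, c⟩ := y
  simp only [crn, Prod.mk.injEq] at h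
  obtain ⟨rfl, h⟩ := h
  have key : ∀ (i j : Fin 3) (b c : Bool),
      (bif b then i + 2 else i + 1) = (bif c then j + 2 else j + 1) →
      (j = i ∧ c = b) ∨ (c = !b ∧ j = bif b then i + 1 else i + 2) := by decide
  rcases key i j b c h with ⟨rfl, rfl⟩ | ⟨rfl, rfl⟩
  · exact Or.inl rfl
  · cases b
    · exact Or.inr rfl
    · exact Or.inr rfl

section flags

variable {V : Type*} [DecidableEq V] (β : V × Fin 3 → V × Fin 3) (T : V × Fin 3 → Bool)

/-- Crossing an edge along a strand. -/
def crossFlag (x : (V × Fin 3) × Bool) : (V × Fin 3) × Bool :=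
  if β x.1 = x.1 then x else (β x.1, xor (!x.2) (T x.1))

variable {β T}

theorem crossFlag_involutive (hβ : Involutive β) (hT : ∀ d, T (β d) = T d) :
    Involutive (crossFlag β T) := by
  rintro ⟨d, b⟩
  by_cases hd : β d = d
  · simp [crossFlag, hd]
  · have h1 : crossFlag β T (d, b) = (β d, xor (!b) (T d)) := by simp [crossFlag, hd]
    have h2 : β (β d) ≠ β d := fun h => hd (hβ.injective h)
    rw [h1]
    simp only [crossFlag, hβ d, hT]
    rw [if_neg (Ne.symm hd)]
    cases b <;> cases T d <;> rfl

theorem crossFlag_eq_self {x : (V × Fin 3) × Bool} : crossFlag β T x = x ↔ β x.1 = x.1 := by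
  constructor
  · intro h
    by_contra hd
    rw [crossFlag, if_neg hd] at h
    exact hd (congrArg Prod.fst h)
  · intro h
    rw [crossFlag, if_pos h]

/-- A corner is a pair of flags exchanged by `otherFlag`, so strands become orbits of two
involutions, with loose ends as the fixed points of `crossFlag`. -/
theorem eqvGen_flags_iff {x y : (V × Fin 3) × Bool} :
    EqvGen (DihedralStep otherFlag (crossFlag β T)) x y ↔
      EqvGen (Link β T) (crn x.1 x.2) (crn y.1 y.2) := by
  constructor
  · refine EqvGen.map_rel (f := fun x : (V × Fin 3) × Bool => crn x.1 x.2) ?_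
    rintro x y (rfl | rfl)
    · rw [crn_otherFlag]
      exact EqvGen.refl _
    · by_cases hd : β x.1 = x.1
      · rw [crossFlag_eq_self.2 hd]
        exact EqvGen.refl _
      · rw [crossFlag, if_neg hd]
        exact EqvGen.rel _ _ ⟨x.1, x.2, hd, rfl, rfl⟩
  · have hsame : ∀ x y : (V × Fin 3) × Bool, crn x.1 x.2 = crn y.1 y.2 →
        EqvGen (DihedralStep otherFlag (crossFlag β T)) x y := by
      intro x y h
      rcases eq_or_eq_otherFlag h with rfl | rfl
      · exact EqvGen.refl _
      · exact EqvGen.rel _ _ (Or.inl rfl)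
    have hsec : ∀ p : V × Fin 3, ∃ x : (V × Fin 3) × Bool, crn x.1 x.2 = p := by
      intro p
      obtain ⟨d, hd⟩ := CubicMap.crn_false_surjective p
      exact ⟨(d, false), hd⟩
    choose sec hsec using hsec
    intro h
    have h' := EqvGen.map_rel (f := sec)
      (s := DihedralStep otherFlag (crossFlag β T)) ?_ h
    · exact EqvGen.trans _ _ _ (hsame _ _ (hsec _).symm)
        (EqvGen.trans _ _ _ h' (hsame _ _ (hsec _)))
    · rintro p q ⟨d, b, hd, rfl, rfl⟩
      refine EqvGen.trans _ (d, b) _ (hsame _ _ (hsec _)) (EqvGen.trans _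
        (β d, xor (!b) (T d)) _ (EqvGen.rel _ _ (Or.inr ?_)) (hsame _ _ (hsec _).symm))
      simp [crossFlag, hd]

end flags

/-- A cubic map with `k` loose ends. -/
structure OpenMap (V : Type*) (k : ℕ) where
  /-- Reversing a dart; loose ends are fixed. -/
  β : V × Fin 3 → V × Fin 3
  invol : Involutive β
  /-- The loose ends. -/
  leg : Fin k → V × Fin 3
  leg_injective : Injective leg
  fixed_iff : ∀ d, β d = d ↔ ∃ i, leg i = d

namespace OpenMap

variable {V : Type*} {k : ℕ} (O : OpenMap V k)

/-- The two corners at a loose end. -/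
def legEnd (x : Fin k × Bool) : V × Fin 3 := crn (O.leg x.1) x.2

variable {O}

/-- A strand that reaches a loose end is a path: by `exists_other_fixed_point` its orbit of flags
has exactly two fixed points. -/
theorem exists_pairing [Finite V] {T : V × Fin 3 → Bool} (hT : ∀ d, T (O.β d) = T d) :
    ∃ ρ : Fin k × Bool → Fin k × Bool, Involutive ρ ∧ (∀ x, ρ x ≠ x) ∧
      ∀ x y, EqvGen (Link O.β T) (O.legEnd x) (O.legEnd y) ↔ y = x ∨ y = ρ x := by
  classical
  have hm := crossFlag_involutive O.invol hT
  let fl : Fin k × Bool → (V × Fin 3) × Bool := fun x => (O.leg x.1, x.2)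
  have hflinj : Injective fl := by
    rintro ⟨i, b⟩ ⟨j, c⟩ h
    simp only [fl, Prod.mk.injEq] at h
    rw [O.leg_injective h.1, h.2]
  have hfix : ∀ x, crossFlag O.β T (fl x) = fl x := fun x =>
    crossFlag_eq_self.2 ((O.fixed_iff _).2 ⟨x.1, rfl⟩)
  have hlift : ∀ f, crossFlag O.β T f = f → ∃ x, fl x = f := by
    rintro ⟨d, b⟩ hf
    obtain ⟨i, rfl⟩ := (O.fixed_iff d).1 (crossFlag_eq_self.1 hf)
    exact ⟨(i, b), rfl⟩
  have hex : ∀ x, ∃ y, y ≠ x ∧ EqvGen (DihedralStep otherFlag (crossFlag O.β T)) (fl x) (fl y) ∧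
      ∀ z, EqvGen (DihedralStep otherFlag (crossFlag O.β T)) (fl x) (fl z) → z = x ∨ z = y := by
    intro x
    obtain ⟨f', h1, h2, h3, h4⟩ := exists_other_fixed_point otherFlag_involutive hm
      otherFlag_ne (hfix x)
    obtain ⟨y, rfl⟩ := hlift f' h2
    exact ⟨y, fun h => h1 (by rw [h]), h3, fun z hz =>
      (h4 _ (hfix z) hz).imp (fun h => hflinj h) (fun h => hflinj h)⟩
  choose ρ hρ1 hρ2 hρ3 using hex
  refine ⟨ρ, ?_, hρ1, ?_⟩
  · intro x
    rcases hρ3 (ρ x) x (EqvGen.symm _ _ (hρ2 x)) with h | h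
    · exact absurd h.symm (hρ1 x)
    · exact h.symm
  · intro x y
    have : EqvGen (Link O.β T) (O.legEnd x) (O.legEnd y) ↔
        EqvGen (DihedralStep otherFlag (crossFlag O.β T)) (fl x) (fl y) :=
      (eqvGen_flags_iff (x := fl x) (y := fl y)).symm
    rw [this]
    constructor
    · exact hρ3 x y
    · rintro (rfl | rfl)
      · exact EqvGen.refl _
      · exact hρ2 x

/-- The label of an end: the strands are numbered by their ends of one colour. -/
def pathLabel (p : Fin k → Fin k) (ε : Fin k → Bool) (x : Fin k × Bool) : Fin k :=
  if x.2 = ε x.1 then x.1 else p x.1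

/-- Colour the ends so that the two sides of each loose end differ and the two ends of each strand
differ. Each strand is named by the loose end carrying its end of colour `true`; `ε i` is the side
of that colour at `i`, and `p i` is the strand on the other side. -/
theorem exists_pathLabel [Finite V] {T : V × Fin 3 → Bool} (hT : ∀ d, T (O.β d) = T d) :
    ∃ (p : Fin k → Fin k) (ε : Fin k → Bool), Injective p ∧
      ∀ x y, EqvGen (Link O.β T) (O.legEnd x) (O.legEnd y) ↔
        pathLabel p ε x = pathLabel p ε y := by
  obtain ⟨ρ, hρ, hρf, hiff⟩ := exists_pairing hT
  obtain ⟨col, hc1, hc2⟩ := exists_coloring_of_involutive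
    (a := fun x : Fin k × Bool => (x.1, !x.2)) (b := ρ) (fun x => by simp) hρ
    (fun x h => by simpa using congrArg Prod.snd h) hρf
  have hcol : ∀ i b, col (i, b) = true ↔ b = col (i, true) := by
    intro i b
    have := hc1 (i, true)
    simp only [Bool.not_true] at this
    cases b
    · rw [this]
      cases col (i, true) <;> simp
    · cases col (i, true) <;> simp
  have hpos : ∀ x y, col x = true → col y = true → x.1 = y.1 → x = y := by
    rintro ⟨i, b⟩ ⟨j, c⟩ hx hy h
    simp only at h
    subst h
    rw [hcol] at hx hy
    rw [hx, hy]
  have hlabel : ∀ x, pathLabel (fun i => (ρ (i, !col (i, true))).1) (fun i => col (i, true)) x =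
      if col x then x.1 else (ρ x).1 := by
    rintro ⟨i, b⟩
    simp only [pathLabel]
    by_cases hb : b = col (i, true)
    · rw [if_pos hb, if_pos ((hcol i b).2 hb)]
    · rw [if_neg hb, if_neg (fun h => hb ((hcol i b).1 h))]
      have : (!col (i, true)) = b := by
        revert hb
        cases b <;> cases col (i, true) <;> simp
      rw [this]
  refine ⟨fun i => (ρ (i, !col (i, true))).1, fun i => col (i, true), ?_, ?_⟩
  · intro i j hij
    have hneg : ∀ i, col (ρ (i, !col (i, true))) = true := by
      intro i
      rw [hc2, Bool.not_eq_true', Bool.eq_false_iff]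
      intro h
      rw [hcol] at h
      revert h
      cases col (i, true) <;> simp
    have := hρ.injective (hpos _ _ (hneg i) (hneg j) hij)
    exact congrArg Prod.fst this
  · intro x y
    rw [hiff, hlabel, hlabel]
    constructor
    · rintro (rfl | rfl)
      · rfl
      · rw [hc2, hρ x]
        cases col x <;> simp
    · intro h
      by_cases hx : col x = true <;> by_cases hy : col y = true
      · rw [if_pos hx, if_pos hy] at h
        exact Or.inl (hpos _ _ hy hx h.symm)
      · rw [if_pos hx, if_neg hy] at h
        right
        rw [hpos x (ρ y) hx (by rw [hc2]; simpa using hy) h, hρ]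
      · rw [if_neg hx, if_pos hy] at h
        right
        exact hpos y (ρ x) hy (by rw [hc2]; simpa using hx) h.symm
      · rw [if_neg hx, if_neg hy] at h
        left
        exact hρ.injective (hpos _ _ (by rw [hc2]; simpa using hy) (by rw [hc2]; simpa using hx)
          h.symm)

end OpenMap

end

section

/-! ### Gluing gadgets to the loose ends of a map -/

open Relation Function OpenMap

/-- The darts of a gadget with `m` vertices and the loose ends to which it is glued. -/
abbrev Port (k m : ℕ) : Type := (Fin m × Fin 3) ⊕ Fin k

/-- A gadget with `m` vertices that can be glued to `k` loose ends: a list of edges that uses every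
port exactly once. -/
structure Gadget (k : ℕ) where
  /-- The number of vertices. -/
  m : ℕ
  /-- The edges. -/
  es : List (Port k m × Port k m)
  bij : Bijective fun x : Fin es.length × Bool => bif x.2 then (es.get x.1).2 else (es.get x.1).1

namespace Gadget

variable {k : ℕ} (g : Gadget k)

/-- The two ends of an edge. -/
def port (x : Fin g.es.length × Bool) : Port k g.m :=
  bif x.2 then (g.es.get x.1).2 else (g.es.get x.1).1

/-- The numbers of the strands at a port: the outer strands have numbers below `k`, the corner
`(w, i)` of the gadget has number `k + 3 * w + i`. -/
def node {k m : ℕ} (p : Fin k → Fin k) (ε : Fin k → Bool) : Port k m → Bool → ℕ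
  | Sum.inl d, c => k + 3 * d.1 + (crn d c).2
  | Sum.inr i, c => pathLabel p ε (i, c)

/-- The links between strands inside a gadget with twists `b`. -/
def GLink (p : Fin k → Fin k) (ε : Fin k → Bool) (b : Fin g.es.length → Bool) (x y : ℕ) : Prop :=
  ∃ e c, x = node p ε (g.es.get e).1 c ∧ y = node p ε (g.es.get e).2 (xor (!c) (b e))

/-- The twists `b` of a gadget are admissible if no vertex of the gadget is passed twice and no
two conflicting outer strands are joined. -/
def Admissible (p : Fin k → Fin k) (ε : Fin k → Bool) (κ : Fin k → Fin k → Prop)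
    (b : Fin g.es.length → Bool) : Prop :=
  (∀ (w : Fin g.m) (i j : Fin 3), i ≠ j →
    ¬ EqvGen (g.GLink p ε b) (k + 3 * w + i) (k + 3 * w + j)) ∧
  ∀ x y : Fin k, κ x y → ¬ EqvGen (g.GLink p ε b) x y

/-- The number of admissible twists. -/
noncomputable def count (p : Fin k → Fin k) (ε : Fin k → Bool) (κ : Fin k → Fin k → Prop) : ℕ :=
  Nat.card {b : Fin g.es.length → Bool // g.Admissible p ε κ b}

end Gadget

namespace CubicMap

/-- The number of twists for which no strand passes twice through a vertex. These correspond to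
the circuit double covers. -/
noncomputable def numCovers {V : Type*} (M : CubicMap V) : ℕ :=
  Nat.card {T : V × Fin 3 → Bool // (∀ d, T (M.inv d) = T d) ∧ StrandsValid M.inv T}

end CubicMap

/-- The vertices of an open map and of a gadget as the vertices of a map. -/
structure Placement (V : Type*) {W : Type*} {k : ℕ} (O : OpenMap W k) (g : Gadget k) where
  /-- The identification of the vertices. -/
  j : W ⊕ Fin g.m ≃ V
  /-- The rotation of the gadget vertices. -/
  s : Fin g.m → Fin 3

namespace Placement

variable {V W : Type*} {k : ℕ} {O : OpenMap W k} {g : Gadget k} (P : Placement V O g)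

/-- The darts of the open map as darts of the glued map. -/
def lift (d : W × Fin 3) : V × Fin 3 := (P.j (Sum.inl d.1), d.2)

/-- The ports of the gadget as darts of the glued map. -/
def emb : Port k g.m → V × Fin 3 :=
  Sum.elim (fun d => (P.j (Sum.inr d.1), d.2 + P.s d.1)) (fun i => P.lift (O.leg i))

theorem lift_injective : Injective P.lift := by
  rintro ⟨u, i⟩ ⟨v, j⟩ h
  simp only [lift, Prod.mk.injEq, EmbeddingLike.apply_eq_iff_eq, Sum.inl.injEq] at h
  rw [h.1, h.2]

theorem emb_injective : Injective P.emb := by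
  rintro (⟨u, i⟩ | i) (⟨v, j⟩ | j) h
  · simp only [emb, Sum.elim_inl, Prod.mk.injEq, EmbeddingLike.apply_eq_iff_eq,
      Sum.inr.injEq] at h
    obtain ⟨rfl, h⟩ := h
    rw [add_right_cancel h]
  · simp [emb, lift] at h
  · simp [emb, lift] at h
  · rw [O.leg_injective (P.lift_injective h)]

/-- The darts of the glued map. -/
theorem dart_bijective : Bijective (Sum.elim (fun d : {d // O.β d ≠ d} => P.lift d)
    (fun x : Fin g.es.length × Bool => P.emb (g.port x))) := by
  constructor
  · rintro (⟨d, hd⟩ | x) (⟨d', hd'⟩ | y) h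
    · simp only [Sum.elim_inl] at h
      rw [Subtype.mk.injEq _ _ _ _ |>.mpr (P.lift_injective h)]
    · exfalso
      simp only [Sum.elim_inl, Sum.elim_inr] at h
      rcases hy : g.port y with w | i
      · rw [hy] at h
        simp [lift, emb] at h
      · rw [hy] at h
        exact hd ((O.fixed_iff d).2 ⟨i, (P.lift_injective h).symm⟩)
    · exfalso
      simp only [Sum.elim_inl, Sum.elim_inr] at h
      rcases hx : g.port x with w | i
      · rw [hx] at h
        simp [lift, emb] at h
      · rw [hx] at h
        exact hd' ((O.fixed_iff d').2 ⟨i, P.lift_injective h⟩)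
    · simp only [Sum.elim_inr] at h
      rw [g.bij.1 (P.emb_injective h)]
  · rintro ⟨v, i⟩
    have hport : ∀ z, ∃ x, P.emb (g.port x) = P.emb z := fun z => by
      obtain ⟨x, hx⟩ := g.bij.2 z
      exact ⟨x, congrArg P.emb hx⟩
    rcases hv : P.j.symm v with u | w
    · have hv' : v = P.j (Sum.inl u) := by rw [← hv, Equiv.apply_symm_apply]
      subst hv'
      by_cases hd : O.β (u, i) = (u, i)
      · obtain ⟨l, hl⟩ := (O.fixed_iff _).1 hd
        obtain ⟨x, hx⟩ := hport (Sum.inr l)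
        refine ⟨Sum.inr x, ?_⟩
        rw [Sum.elim_inr, hx]
        simp only [emb, Sum.elim_inr, hl, lift]
      · exact ⟨Sum.inl ⟨_, hd⟩, rfl⟩
    · have hv' : v = P.j (Sum.inr w) := by rw [← hv, Equiv.apply_symm_apply]
      subst hv'
      obtain ⟨x, hx⟩ := hport (Sum.inl (w, i - P.s w))
      refine ⟨Sum.inr x, ?_⟩
      rw [Sum.elim_inr, hx]
      simp [emb]

/-- The darts of the glued map. -/
noncomputable def dartEquiv : {d // O.β d ≠ d} ⊕ (Fin g.es.length × Bool) ≃ V × Fin 3 :=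
  Equiv.ofBijective _ P.dart_bijective

theorem dartEquiv_inl (d : {d // O.β d ≠ d}) : P.dartEquiv (Sum.inl d) = P.lift d := rfl

theorem dartEquiv_inr (x : Fin g.es.length × Bool) :
    P.dartEquiv (Sum.inr x) = P.emb (g.port x) := rfl

theorem dart_cases {S : V × Fin 3 → Prop} (h1 : ∀ d, O.β d ≠ d → S (P.lift d))
    (h2 : ∀ x, S (P.emb (g.port x))) (d : V × Fin 3) : S d := by
  obtain ⟨y, rfl⟩ := P.dartEquiv.surjective d
  rcases y with ⟨d, hd⟩ | x
  · exact h1 d hd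
  · exact h2 x

theorem crn_lift (d : W × Fin 3) (c : Bool) : crn (P.lift d) c = P.lift (crn d c) := rfl

/-- The corner of a strand at a port. -/
theorem crn_emb_inl (d : Fin g.m × Fin 3) (c : Bool) :
    crn (P.emb (Sum.inl d)) c = (P.j (Sum.inr d.1), (crn d c).2 + P.s d.1) := by
  cases c <;> simp [emb, crn, add_right_comm]

theorem crn_emb_inr (i : Fin k) (c : Bool) :
    crn (P.emb (Sum.inr i)) c = P.lift (O.legEnd (i, c)) := rfl

end Placement

/-- The cubic map `M` arises by gluing the gadget `g` to the loose ends of `O`. -/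
structure Gluing {V W : Type*} {k : ℕ} (M : CubicMap V) (O : OpenMap W k) (g : Gadget k) extends
    Placement V O g where
  inv_lift : ∀ {d}, O.β d ≠ d → M.inv (toPlacement.lift d) = toPlacement.lift (O.β d)
  inv_emb : ∀ e ∈ g.es, M.inv (toPlacement.emb e.1) = toPlacement.emb e.2

/-! ### Strands of a glued map -/

namespace Gluing

open Placement

variable {V W : Type*} {k : ℕ} {M : CubicMap V} {O : OpenMap W k} {g : Gadget k}
  (G : Gluing M O g)

theorem inv_emb_port (x : Fin g.es.length × Bool) :
    M.inv (G.emb (g.port x)) = G.emb (g.port (x.1, !x.2)) := by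
  obtain ⟨e, b⟩ := x
  have h : M.inv (G.emb (g.es.get e).1) = G.emb (g.es.get e).2 :=
    G.inv_emb _ (List.get_mem _ _)
  cases b
  · exact h
  · change M.inv (G.emb (g.es.get e).2) = G.emb (g.es.get e).1
    rw [← h, M.inv_inv]

/-- The twist of the glued map that is composed of twists of its parts. -/
noncomputable def twist (T : W × Fin 3 → Bool) (b : Fin g.es.length → Bool) (d : V × Fin 3) : Bool :=
  Sum.elim (fun d : {d // O.β d ≠ d} => T d) (fun x => b x.1) (G.dartEquiv.symm d)

theorem twist_lift (T : W × Fin 3 → Bool) (b : Fin g.es.length → Bool) {d : W × Fin 3}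
    (hd : O.β d ≠ d) : G.twist T b (G.lift d) = T d := by
  have : G.dartEquiv.symm (G.lift d) = Sum.inl ⟨d, hd⟩ := by
    rw [Equiv.symm_apply_eq]
    rfl
  simp [twist, this]

theorem twist_emb (T : W × Fin 3 → Bool) (b : Fin g.es.length → Bool)
    (x : Fin g.es.length × Bool) : G.twist T b (G.emb (g.port x)) = b x.1 := by
  have : G.dartEquiv.symm (G.emb (g.port x)) = Sum.inr x := by
    rw [Equiv.symm_apply_eq]
    rfl
  simp [twist, this]

theorem twist_inv {T : W × Fin 3 → Bool} (hT : ∀ d, T (O.β d) = T d)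
    (b : Fin g.es.length → Bool) (d : V × Fin 3) : G.twist T b (M.inv d) = G.twist T b d := by
  revert d
  refine G.dart_cases ?_ ?_
  · intro d hd
    rw [G.inv_lift hd, G.twist_lift T b hd, G.twist_lift T b, hT]
    exact fun h => hd (O.invol.injective h)
  · intro x
    rw [G.inv_emb_port, twist_emb, twist_emb]

theorem eqvGen_lift {T : W × Fin 3 → Bool} (b : Fin g.es.length → Bool) {p q : W × Fin 3}
    (h : EqvGen (Link O.β T) p q) : EqvGen (Link M.inv (G.twist T b)) (G.lift p) (G.lift q) := by
  refine EqvGen.map_rel ?_ h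
  rintro p q ⟨d, c, hd, rfl, rfl⟩
  refine EqvGen.rel _ _ ⟨G.lift d, c, M.inv_ne _, rfl, ?_⟩
  rw [G.inv_lift hd, G.twist_lift T b hd]
  rfl

theorem strandsValid_outer {T : W × Fin 3 → Bool} {b : Fin g.es.length → Bool}
    (h : StrandsValid M.inv (G.twist T b)) : StrandsValid O.β T := fun _ i j hij he =>
  h _ i j hij (G.eqvGen_lift b he)

section

variable {T : W × Fin 3 → Bool} {p : Fin k → Fin k} {ε : Fin k → Bool}
  (hlab : ∀ x y, EqvGen (Link O.β T) (O.legEnd x) (O.legEnd y) ↔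
    pathLabel p ε x = pathLabel p ε y) (b : Fin g.es.length → Bool)

include hlab in
theorem eqvGen_of_node_eq {z z' : Port k g.m} {c c' : Bool}
    (h : Gadget.node p ε z c = Gadget.node p ε z' c') :
    EqvGen (Link M.inv (G.twist T b)) (crn (G.emb z) c) (crn (G.emb z') c') := by
  rcases z with d | i <;> rcases z' with d' | i' <;> simp only [Gadget.node] at h
  · have h1 := (crn d c).2.isLt
    have h2 := (crn d' c').2.isLt
    have h3 : d.1 = d'.1 := Fin.ext (by omega)
    have h4 : (crn d c).2 = (crn d' c').2 := Fin.ext (by rw [h3] at h; omega)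
    rw [crn_emb_inl, crn_emb_inl, h3, h4]
    exact EqvGen.refl _
  · have := (pathLabel p ε (i', c')).isLt
    omega
  · have := (pathLabel p ε (i, c)).isLt
    omega
  · rw [crn_emb_inr, crn_emb_inr]
    exact G.eqvGen_lift b ((hlab _ _).2 (Fin.ext h))

include hlab in
theorem eqvGen_of_eqvGen_gLink {z z' : Port k g.m} {c c' : Bool}
    (h : EqvGen (g.GLink p ε b) (Gadget.node p ε z c) (Gadget.node p ε z' c')) :
    EqvGen (Link M.inv (G.twist T b)) (crn (G.emb z) c) (crn (G.emb z') c') := by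
  -- A number does not single out one corner. The union of the strands of all corners with that
  -- number is well defined and is invariant under the gadget links.
  let f : ℕ → Set (V × Fin 3) := fun n =>
    {q | ∃ z c, Gadget.node p ε z c = n ∧ EqvGen (Link M.inv (G.twist T b)) (crn (G.emb z) c) q}
  have hf : ∀ z c, f (Gadget.node p ε z c) =
      {q | EqvGen (Link M.inv (G.twist T b)) (crn (G.emb z) c) q} := by
    intro z c
    ext q
    constructor
    · rintro ⟨z', c', h1, h2⟩
      exact EqvGen.trans _ _ _ (G.eqvGen_of_node_eq hlab b h1.symm) h2
    · intro h
      exact ⟨z, c, rfl, h⟩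
  have hff := EqvGen.apply_eq (f := f) ?_ h
  · have : crn (G.emb z') c' ∈ f (Gadget.node p ε z' c') := by
      rw [hf]
      exact EqvGen.refl _
    rw [← hff, hf] at this
    exact this
  · rintro _ _ ⟨e, c, rfl, rfl⟩
    have hlink : EqvGen (Link M.inv (G.twist T b)) (crn (G.emb (g.es.get e).1) c)
        (crn (G.emb (g.es.get e).2) (xor (!c) (b e))) := by
      refine EqvGen.rel _ _ ⟨G.emb (g.es.get e).1, c, M.inv_ne _, rfl, ?_⟩
      have h1 := G.inv_emb_port (e, false)
      have h2 := G.twist_emb T b (e, false)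
      simp only [Gadget.port, cond_false, cond_true, Bool.not_false] at h1 h2
      rw [h1, h2]
    rw [hf, hf]
    ext q
    exact ⟨fun h => EqvGen.trans _ _ _ (EqvGen.symm _ _ hlink) h,
      fun h => EqvGen.trans _ _ _ hlink h⟩

open Classical in
/-- The class of a corner of the open map. -/
noncomputable def outerClass (O : OpenMap W k) (T : W × Fin 3 → Bool) (p : Fin k → Fin k)
    (ε : Fin k → Bool) (b : Fin g.es.length → Bool) (u : W × Fin 3) :
    Quot (g.GLink p ε b) ⊕ Quot (Link O.β T) :=
  if h : ∃ x, EqvGen (Link O.β T) u (O.legEnd x) then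
    Sum.inl (Quot.mk _ (pathLabel p ε h.choose : ℕ))
  else Sum.inr (Quot.mk _ u)

/-- The class of a corner of the glued map, computed in the gadget and in the open map. -/
noncomputable def cornerClass (q : V × Fin 3) : Quot (g.GLink p ε b) ⊕ Quot (Link O.β T) :=
  Sum.elim (fun u => outerClass O T p ε b (u, q.2))
    (fun w => Sum.inl (Quot.mk _ (k + 3 * w + (q.2 - G.s w : Fin 3)))) (G.j.symm q.1)

theorem cornerClass_lift_eq (u : W × Fin 3) :
    G.cornerClass (T := T) (p := p) (ε := ε) b (G.lift u) = outerClass O T p ε b u := by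
  simp [cornerClass, lift]

include hlab in
theorem cornerClass_lift {u : W × Fin 3} {x : Fin k × Bool}
    (h : EqvGen (Link O.β T) u (O.legEnd x)) :
    G.cornerClass (T := T) (p := p) (ε := ε) b (G.lift u) =
      Sum.inl (Quot.mk _ (pathLabel p ε x : ℕ)) := by
  have hex : ∃ x, EqvGen (Link O.β T) u (O.legEnd x) := ⟨x, h⟩
  have : pathLabel p ε hex.choose = pathLabel p ε x :=
    (hlab _ _).1 (EqvGen.trans _ _ _ (EqvGen.symm _ _ hex.choose_spec) h)
  rw [cornerClass_lift_eq, outerClass, dif_pos hex, this]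

theorem cornerClass_lift_of_not {u : W × Fin 3}
    (h : ¬ ∃ x, EqvGen (Link O.β T) u (O.legEnd x)) :
    G.cornerClass (T := T) (p := p) (ε := ε) b (G.lift u) = Sum.inr (Quot.mk _ u) := by
  rw [cornerClass_lift_eq, outerClass, dif_neg h]

theorem cornerClass_inner (w : Fin g.m) (i : Fin 3) :
    G.cornerClass (T := T) (p := p) (ε := ε) b (G.j (Sum.inr w), i + G.s w) =
      Sum.inl (Quot.mk _ (k + 3 * w + i)) := by
  simp [cornerClass]

include hlab in
theorem cornerClass_emb (z : Port k g.m) (c : Bool) :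
    G.cornerClass (T := T) (p := p) (ε := ε) b (crn (G.emb z) c) =
      Sum.inl (Quot.mk _ (Gadget.node p ε z c)) := by
  rcases z with d | i
  · rw [crn_emb_inl, cornerClass_inner]
    rfl
  · rw [crn_emb_inr, G.cornerClass_lift hlab b (EqvGen.refl _)]
    rfl

-- This is the converse direction: `cornerClass` is constant along the glued strands, so gluing
-- joins nothing beyond what the outer labels and the gadget links predict.
include hlab in
theorem cornerClass_eq_of_eqvGen {q q' : V × Fin 3}
    (h : EqvGen (Link M.inv (G.twist T b)) q q') :
    G.cornerClass (T := T) (p := p) (ε := ε) b q = G.cornerClass b q' := by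
  refine EqvGen.apply_eq ?_ h
  rintro _ _ ⟨d, c, -, rfl, rfl⟩
  revert d
  refine G.dart_cases ?_ ?_
  · intro d hd
    rw [G.inv_lift hd, G.twist_lift T b hd, crn_lift, crn_lift]
    have hl : EqvGen (Link O.β T) (crn d c) (crn (O.β d) (xor (!c) (T d))) :=
      EqvGen.rel _ _ ⟨d, c, hd, rfl, rfl⟩
    by_cases hx : ∃ x, EqvGen (Link O.β T) (crn d c) (O.legEnd x)
    · obtain ⟨x, hx⟩ := hx
      rw [G.cornerClass_lift hlab b hx,
        G.cornerClass_lift hlab b (EqvGen.trans _ _ _ (EqvGen.symm _ _ hl) hx)]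
    · rw [G.cornerClass_lift_of_not b hx, G.cornerClass_lift_of_not b
        (fun ⟨x, h⟩ => hx ⟨x, EqvGen.trans _ _ _ hl h⟩), Quot.eqvGen_sound hl]
  · rintro ⟨e, b'⟩
    rw [G.inv_emb_port, G.twist_emb, G.cornerClass_emb hlab, G.cornerClass_emb hlab]
    congr 1
    cases b'
    · exact Quot.sound ⟨e, c, rfl, rfl⟩
    · refine (Quot.sound ⟨e, xor (!c) (b e), rfl, ?_⟩).symm
      simp only [Gadget.port, cond_true]
      congr 1
      cases c <;> cases b e <;> rfl

/-- Two outer strands conflict if they pass through different corners of a vertex. -/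
def Conflict (O : OpenMap W k) (T : W × Fin 3 → Bool) (p : Fin k → Fin k) (ε : Fin k → Bool)
    (x y : Fin k) : Prop :=
  ∃ v i j, i ≠ j ∧ ∃ s t, EqvGen (Link O.β T) (v, i) (O.legEnd s) ∧
    EqvGen (Link O.β T) (v, j) (O.legEnd t) ∧ pathLabel p ε s = x ∧ pathLabel p ε t = y

-- Two corners of an outer vertex, on different strands before gluing, can be joined only when both
-- strands reach loose ends, which is a conflict. Corners of gadget vertices are compared directly
-- in the gadget.
include hlab in
theorem strandsValid_iff (hT : StrandsValid O.β T) :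
    StrandsValid M.inv (G.twist T b) ↔ g.Admissible p ε (Conflict O T p ε) b := by
  constructor
  · intro h
    have hcorner : ∀ (w : Fin g.m) (i : Fin 3), ∃ d : Fin g.m × Fin 3,
        Gadget.node (k := k) p ε (Sum.inl d) false = k + 3 * w + i ∧
        crn (G.emb (Sum.inl d)) false = (G.j (Sum.inr w), i + G.s w) := by
      intro w i
      obtain ⟨d, hd⟩ := CubicMap.crn_false_surjective (w, i)
      have h1 : d.1 = w := congrArg Prod.fst hd
      have h2 : (crn d false).2 = i := congrArg Prod.snd hd
      exact ⟨d, by simp only [Gadget.node, h1, h2], by rw [crn_emb_inl, h1, h2]⟩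
    constructor
    · intro w i j hij he
      obtain ⟨d, hd1, hd2⟩ := hcorner w i
      obtain ⟨d', hd1', hd2'⟩ := hcorner w j
      rw [← hd1, ← hd1'] at he
      have := G.eqvGen_of_eqvGen_gLink hlab b he
      rw [hd2, hd2'] at this
      exact h _ _ _ (fun h => hij (add_right_cancel h)) this
    · rintro x y ⟨v, i, j, hij, s, t, h1, h2, rfl, rfl⟩ he
      have he' := G.eqvGen_of_eqvGen_gLink hlab b (z := Sum.inr s.1) (z' := Sum.inr t.1)
        (c := s.2) (c' := t.2) he
      rw [crn_emb_inr, crn_emb_inr] at he'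
      exact h _ i j hij (EqvGen.trans _ _ _ (G.eqvGen_lift b h1) (EqvGen.trans _ _ _ he'
        (EqvGen.symm _ _ (G.eqvGen_lift b h2))))
  · rintro ⟨h1, h2⟩ v i j hij he
    have hcl := G.cornerClass_eq_of_eqvGen hlab b he
    rcases hv : G.j.symm v with u | w
    · have hv' : v = G.j (Sum.inl u) := by rw [← hv, Equiv.apply_symm_apply]
      subst hv'
      change G.cornerClass b (G.lift (u, i)) = G.cornerClass b (G.lift (u, j)) at hcl
      by_cases hi : ∃ x, EqvGen (Link O.β T) (u, i) (O.legEnd x) <;>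
        by_cases hj : ∃ x, EqvGen (Link O.β T) (u, j) (O.legEnd x)
      · obtain ⟨x, hx⟩ := hi
        obtain ⟨y, hy⟩ := hj
        rw [G.cornerClass_lift hlab b hx, G.cornerClass_lift hlab b hy] at hcl
        exact h2 _ _ ⟨u, i, j, hij, x, y, hx, hy, rfl, rfl⟩
          (Quot.eqvGen_exact (Sum.inl.inj hcl))
      · obtain ⟨x, hx⟩ := hi
        rw [G.cornerClass_lift hlab b hx, G.cornerClass_lift_of_not b hj] at hcl
        exact Sum.inl_ne_inr hcl
      · obtain ⟨y, hy⟩ := hj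
        rw [G.cornerClass_lift_of_not b hi, G.cornerClass_lift hlab b hy] at hcl
        exact Sum.inr_ne_inl hcl
      · rw [G.cornerClass_lift_of_not b hi, G.cornerClass_lift_of_not b hj] at hcl
        exact hT u i j hij (Quot.eqvGen_exact (Sum.inr.inj hcl))
    · have hv' : v = G.j (Sum.inr w) := by rw [← hv, Equiv.apply_symm_apply]
      subst hv'
      have e1 := G.cornerClass_inner (T := T) (p := p) (ε := ε) b w (i - G.s w)
      have e2 := G.cornerClass_inner (T := T) (p := p) (ε := ε) b w (j - G.s w)
      rw [sub_add_cancel] at e1 e2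
      rw [e1, e2] at hcl
      exact h1 w _ _ (fun h => hij (sub_left_injective h)) (Quot.eqvGen_exact (Sum.inl.inj hcl))

end

/-- The twists of an open map that vanish at the loose ends. -/
abbrev _root_.OpenMap.Twists (O : OpenMap W k) : Type _ :=
  {T : W × Fin 3 → Bool // (∀ d, T (O.β d) = T d) ∧ ∀ d, O.β d = d → T d = false}

theorem twist_injective {T T' : O.Twists} {b b' : Fin g.es.length → Bool}
    (h : G.twist T.1 b = G.twist T'.1 b') : T = T' ∧ b = b' := by
  constructor
  · refine Subtype.ext (funext fun d => ?_)
    by_cases hd : O.β d = d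
    · rw [T.2.2 d hd, T'.2.2 d hd]
    · rw [← G.twist_lift T.1 b hd, h, G.twist_lift T'.1 b' hd]
  · funext e
    rw [← G.twist_emb T.1 b (e, false), h, G.twist_emb T'.1 b' (e, false)]

theorem exists_twist {T : V × Fin 3 → Bool} (hT : ∀ d, T (M.inv d) = T d) :
    ∃ (T₀ : O.Twists) (b : Fin g.es.length → Bool), G.twist T₀.1 b = T := by
  classical
  refine ⟨⟨fun d => if O.β d = d then false else T (G.lift d), ?_, ?_⟩,
    fun e => T (G.emb (g.port (e, false))), ?_⟩
  · intro d
    by_cases hd : O.β d = d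
    · rw [hd]
    · have hd' : O.β (O.β d) ≠ O.β d := fun h => hd (O.invol.injective h)
      simp only [hd, hd', if_false, ← G.inv_lift hd, hT]
  · intro d hd
    simp only [hd, if_true]
  · funext d
    revert d
    refine G.dart_cases ?_ ?_
    · intro d hd
      rw [G.twist_lift _ _ hd]
      simp only [hd, if_false]
    · rintro ⟨e, b'⟩
      rw [G.twist_emb]
      cases b'
      · rfl
      · rw [← hT, G.inv_emb_port]
        rfl

-- A twist splits uniquely into an outer and a gadget part; uniqueness needs the normalisation
-- `false` at the loose ends, whose edges belong to the gadget. The outer sum is thus the same for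
-- every gadget glued to `O`.
open Classical in
theorem numCovers_eq_sum [Finite V] [Fintype O.Twists] :
    M.numCovers = ∑ T : O.Twists,
      Nat.card {b : Fin g.es.length → Bool // StrandsValid M.inv (G.twist T.1 b)} := by
  rw [← Nat.card_sigma, CubicMap.numCovers]
  symm
  refine Nat.card_eq_of_bijective (fun x : (T : O.Twists) ×
      {b : Fin g.es.length → Bool // StrandsValid M.inv (G.twist T.1 b)} =>
    (⟨G.twist x.1.1 x.2.1, G.twist_inv x.1.2.1 _, x.2.2⟩ :
      {T : V × Fin 3 → Bool // (∀ d, T (M.inv d) = T d) ∧ StrandsValid M.inv T})) ⟨?_, ?_⟩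
  · rintro ⟨T, b, hb⟩ ⟨T', b', hb'⟩ h
    obtain ⟨rfl, rfl⟩ := G.twist_injective (congrArg Subtype.val h)
    rfl
  · rintro ⟨T, hT, hv⟩
    obtain ⟨T₀, b, rfl⟩ := G.exists_twist hT
    exact ⟨⟨T₀, b, hv⟩, rfl⟩

end Gluing

/-- An inequality between the numbers of admissible twists of gadgets, for all possible outer
strands, gives an inequality between the numbers of covers of glued maps. -/
theorem sum_numCovers_le {k : ℕ} {W V : Type*} [Finite W] [Finite V] {O : OpenMap W k}
    {ι : Type*} [Fintype ι] {V' : ι → Type*} [∀ i, Finite (V' i)] {M : CubicMap V} {g : Gadget k}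
    (G : Gluing M O g) {M' : ∀ i, CubicMap (V' i)} {g' : ι → Gadget k}
    (G' : ∀ i, Gluing (M' i) O (g' i)) (m n : ℕ)
    (h : ∀ (p : Fin k → Fin k) (ε : Fin k → Bool) (κ : Fin k → Fin k → Prop), Injective p →
      (∀ i, p i ≠ i) → (∀ i, κ i (p i)) → (∀ x y, κ x y → κ y x) → (∀ x, ¬ κ x x) →
      m * ∑ i, (g' i).count p ε κ ≤ n * g.count p ε κ) :
    m * ∑ i, (M' i).numCovers ≤ n * M.numCovers := by
  classical
  have : Fintype O.Twists := Fintype.ofFinite _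
  rw [G.numCovers_eq_sum, Finset.sum_congr rfl fun i _ => (G' i).numCovers_eq_sum,
    Finset.sum_comm, Finset.mul_sum, Finset.mul_sum]
  refine Finset.sum_le_sum fun T _ => ?_
  by_cases hT : StrandsValid O.β T.1
  · obtain ⟨p, ε, hp, hlab⟩ := exists_pathLabel T.2.1
    have hfree : ∀ x y, Gluing.Conflict O T.1 p ε x y → x ≠ y := by
      rintro x y ⟨v, i, j, hij, s, t, h1, h2, rfl, rfl⟩ hxy
      exact hT v i j hij (EqvGen.trans _ _ _ h1 (EqvGen.trans _ _ _ ((hlab s t).2 hxy)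
        (EqvGen.symm _ _ h2)))
    have hsymm : ∀ x y, Gluing.Conflict O T.1 p ε x y → Gluing.Conflict O T.1 p ε y x := by
      rintro x y ⟨v, i, j, hij, s, t, h1, h2, h3, h4⟩
      exact ⟨v, j, i, hij.symm, t, s, h2, h1, h4, h3⟩
    -- The strands on the two sides of a loose end pass through different corners of its vertex.
    -- This also forbids fixed points of `p`.
    have hcon : ∀ i, Gluing.Conflict O T.1 p ε i (p i) := by
      intro i
      refine ⟨(O.leg i).1, _, _, ?_, (i, ε i), (i, !ε i), EqvGen.refl _, EqvGen.refl _,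
        by simp [pathLabel], by simp [pathLabel]⟩
      have : ∀ j : Fin 3, j + 2 ≠ j + 1 := by decide
      simp only
      cases ε i
      · exact (this _).symm
      · exact this _
    have := h p ε (Gluing.Conflict O T.1 p ε) hp (fun i => (hfree _ _ (hcon i)).symm) hcon hsymm
      (fun x hx => hfree x x hx rfl)
    have e1 : ∀ i, Nat.card {b : Fin (g' i).es.length → Bool //
        StrandsValid (M' i).inv ((G' i).twist T.1 b)} =
        (g' i).count p ε (Gluing.Conflict O T.1 p ε) := fun i =>
      Nat.card_congr (Equiv.subtypeEquivRight fun b => (G' i).strandsValid_iff hlab b hT)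
    have e2 : Nat.card {b : Fin g.es.length → Bool // StrandsValid M.inv (G.twist T.1 b)} =
        g.count p ε (Gluing.Conflict O T.1 p ε) :=
      Nat.card_congr (Equiv.subtypeEquivRight fun b => G.strandsValid_iff hlab b hT)
    rw [e2, Finset.sum_congr rfl fun i _ => e1 i]
    exact this
  -- An outer twist that already repeats a vertex contributes nothing to the left side.
  · have e1 : ∀ i, Nat.card {b : Fin (g' i).es.length → Bool //
        StrandsValid (M' i).inv ((G' i).twist T.1 b)} = 0 := fun i => by
      have : IsEmpty {b : Fin (g' i).es.length → Bool //
          StrandsValid (M' i).inv ((G' i).twist T.1 b)} :=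
        ⟨fun b => hT ((G' i).strandsValid_outer b.2)⟩
      exact Nat.card_of_isEmpty
    rw [Finset.sum_congr rfl fun i _ => e1 i]
    simp

end

section

/-! ### Counting admissible twists by search

Equivalence relations on `{0, …, N - 1}` are stored as bit matrices: the pair `(x, y)` is the bit
`N * x + y` of a natural number. -/

open Relation Function OpenMap

namespace Gadget

/-- The number with the given bits. -/
def setBits (l : List ℕ) : ℕ := l.foldr (fun i s => Nat.lor (2 ^ i) s) 0

/-- The bits in the first column of a matrix. -/
def columnMask (N : ℕ) : ℕ := setBits ((List.range N).map (N * ·))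

/-- The diagonal matrix. -/
def diagonal (N : ℕ) : ℕ := setBits ((List.range N).map fun x => N * x + x)

/-- The matrix of the pairs `(x, y)` with `x` related to `a` and `b` related to `y`. -/
def block (N M a b : ℕ) : ℕ :=
  Nat.mul (Nat.land (Nat.shiftRight M a) (columnMask N)) (Nat.mod (Nat.shiftRight M (N * b)) (2 ^ N))

/-- Join the classes of `a` and `b`. -/
def join (N M a b : ℕ) : ℕ := Nat.lor M (Nat.lor (block N M a b) (block N M b a))

/-- Add the links along one edge; `nd` gives the strands at the two sides of a port. -/
def link {Q : Type*} (N : ℕ) (nd : Q → Bool → ℕ) (M : ℕ) (e : Q × Q) (t : Bool) : ℕ :=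
  join N (join N M (nd e.1 false) (nd e.2 (!t))) (nd e.1 true) (nd e.2 t)

/-- All matrices that arise from twists of the given edges and avoid the bits of `F`. -/
def leaves {Q : Type*} (N : ℕ) (nd : Q → Bool → ℕ) (F : ℕ) : List (Q × Q) → ℕ → List ℕ
  | [], M => [M]
  | e :: es, M =>
    (bif Nat.beq (Nat.land (link N nd M e false) F) 0 then
      leaves N nd F es (link N nd M e false) else []) ++
    (bif Nat.beq (Nat.land (link N nd M e true) F) 0 then
      leaves N nd F es (link N nd M e true) else [])

/-- The matrix that arises from given twists. -/
def final {Q : Type*} (N : ℕ) (nd : Q → Bool → ℕ) :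
    (es : List (Q × Q)) → ℕ → (Fin es.length → Bool) → ℕ
  | [], M, _ => M
  | e :: es, M, b => final N nd es (link N nd M e (b 0)) fun i => b i.succ

/-- The strands in a pair are not joined. -/
def apart (N : ℕ) (q : ℕ × ℕ) (M : ℕ) : Bool := !Nat.testBit M (N * q.1 + q.2)

/-- The inequality `a * R ≤ b * S` for the numbers of matrices that separate the pairs in any
subset of a list of pairs. -/
def compare (N a b : ℕ) : List (ℕ × ℕ) → List ℕ → List ℕ → Bool
  | [], R, S => Nat.ble (a * R.length) (b * S.length)
  | q :: qs, R, S => compare N a b qs R S &&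
      compare N a b qs (R.filter (apart N q)) (S.filter (apart N q))

/-! ### Correctness of the bit matrices and of the search -/

theorem testBit_setBits (l : List ℕ) (j : ℕ) : (setBits l).testBit j = true ↔ j ∈ l := by
  induction l with
  | nil => simp [setBits]
  | cons i l ih =>
    change (2 ^ i ||| setBits l).testBit j = true ↔ _
    rw [Nat.testBit_or, Bool.or_eq_true, ih, Nat.testBit_two_pow, decide_eq_true_iff,
      List.mem_cons, eq_comm]

/-- The bits of `c` sit at multiples of `N` and `r` has at most `N` bits, so the product writes
copies of `r` into disjoint blocks without carries. One multiplication therefore forms the outer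
product of a column and a row. -/
theorem testBit_mul {N : ℕ} (hN : 0 < N) {r : ℕ} (hr : r < 2 ^ N) {y : ℕ} (hy : y < N) :
    ∀ (x c : ℕ), (∀ j, c.testBit j = true → N ∣ j) →
      (c * r).testBit (N * x + y) = (c.testBit (N * x) && r.testBit y) := by
  have key : ∀ c : ℕ, (∀ j, c.testBit j = true → N ∣ j) →
      ∃ c', c = 2 ^ N * c' + (c.testBit 0).toNat ∧ ∀ j, c'.testBit j = c.testBit (N + j) := by
    intro c hc
    refine ⟨c >>> N, ?_, fun j => Nat.testBit_shiftRight _⟩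
    refine Nat.eq_of_testBit_eq fun j => ?_
    have hlt : (c.testBit 0).toNat < 2 ^ N :=
      lt_of_le_of_lt (Bool.toNat_le _) (Nat.one_lt_two_pow hN.ne')
    rw [Nat.testBit_two_pow_mul_add _ hlt]
    split_ifs with hj
    · rcases Nat.eq_zero_or_pos j with rfl | hj0
      · cases c.testBit 0 <;> rfl
      · have h1 : c.testBit j = false := by
          rw [Bool.eq_false_iff]
          exact fun h => absurd (Nat.le_of_dvd hj0 (hc j h)) (not_le.2 hj)
        have h2 : (c.testBit 0).toNat.testBit j = false :=
          Nat.testBit_lt_two_pow (lt_of_le_of_lt (Bool.toNat_le _)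
            (Nat.one_lt_two_pow hj0.ne'))
        rw [h1, h2]
    · rw [Nat.testBit_shiftRight, Nat.add_sub_cancel' (not_lt.1 hj)]
  have hmul : ∀ c c' : ℕ, c = 2 ^ N * c' + (c.testBit 0).toNat → ∀ j, (c * r).testBit j =
      if j < N then (c.testBit 0 && r.testBit j) else (c' * r).testBit (j - N) := by
    intro c c' h j
    have e : c * r = 2 ^ N * (c' * r) + (c.testBit 0).toNat * r := by
      conv_lhs => rw [h]
      ring
    have hlt : (c.testBit 0).toNat * r < 2 ^ N := by
      cases c.testBit 0
      · simp
      · simpa using hr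
    rw [e, Nat.testBit_two_pow_mul_add _ hlt]
    cases c.testBit 0 <;> simp
  intro x
  induction x with
  | zero =>
    intro c hc
    obtain ⟨c', h1, -⟩ := key c hc
    rw [hmul c c' h1, Nat.mul_zero, Nat.zero_add, if_pos hy]
  | succ x ih =>
    intro c hc
    obtain ⟨c', h1, h2⟩ := key c hc
    have e : N * (x + 1) + y = N + (N * x + y) := by ring
    rw [hmul c c' h1, e, if_neg (by omega), Nat.add_sub_cancel_left, ih, h2]
    · rw [Nat.mul_succ, Nat.add_comm]
    · intro j hj
      rw [h2] at hj
      exact (Nat.dvd_add_right (dvd_refl N)).1 (hc _ hj)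

theorem testBit_block {N : ℕ} (M : ℕ) {a b x y : ℕ} (hx : x < N) (hy : y < N) :
    (block N M a b).testBit (N * x + y) = (M.testBit (N * x + a) && M.testBit (N * b + y)) := by
  have hN : 0 < N := by omega
  change (((M >>> a) &&& columnMask N) * ((M >>> (N * b)) % 2 ^ N)).testBit _ = _
  have hcol : ∀ j, (columnMask N).testBit j = true ↔ ∃ z, z < N ∧ N * z = j := by
    intro j
    rw [columnMask, testBit_setBits]
    simp
  rw [testBit_mul hN (Nat.mod_lt _ (by positivity)) hy, Nat.testBit_and,
    (hcol (N * x)).2 ⟨x, hx, rfl⟩, Bool.and_true, Nat.testBit_shiftRight,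
    Nat.testBit_mod_two_pow, Nat.testBit_shiftRight, Nat.add_comm a]
  · simp [hy]
  · intro j hj
    rw [Nat.testBit_and, Bool.and_eq_true, hcol] at hj
    obtain ⟨-, z, -, rfl⟩ := hj
    exact dvd_mul_right N z

theorem testBit_join {N : ℕ} (M : ℕ) {a b x y : ℕ} (hx : x < N) (hy : y < N) :
    (join N M a b).testBit (N * x + y) = (M.testBit (N * x + y) ||
      (M.testBit (N * x + a) && M.testBit (N * b + y) ||
        M.testBit (N * x + b) && M.testBit (N * a + y))) := by
  change (M ||| (block N M a b ||| block N M b a)).testBit _ = _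
  rw [Nat.testBit_or, Nat.testBit_or, testBit_block M hx hy, testBit_block M hx hy]

/-- The matrix `M` represents the equivalence relation generated by `r`. -/
def Represents (N M : ℕ) (r : ℕ → ℕ → Prop) : Prop :=
  ∀ x y, x < N → y < N → (M.testBit (N * x + y) = true ↔ EqvGen r x y)

theorem index_injective {N x y x' y' : ℕ} (hy : y < N) (hy' : y' < N)
    (h : N * x + y = N * x' + y') : x = x' ∧ y = y' := by
  have hN : 0 < N := by omega
  have h1 := congrArg (· / N) h
  have h2 := congrArg (· % N) h
  simp only [Nat.mul_add_div hN, Nat.mul_add_mod, Nat.div_eq_of_lt hy, Nat.div_eq_of_lt hy',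
    Nat.mod_eq_of_lt hy, Nat.mod_eq_of_lt hy', Nat.add_zero] at h1 h2
  exact ⟨h1, h2⟩

theorem represents_diagonal (N : ℕ) : Represents N (diagonal N) fun _ _ => False := by
  intro x y hx hy
  have hrel : EqvGen (fun _ _ : ℕ => False) x y ↔ x = y :=
    ⟨fun h => EqvGen.apply_eq (f := id) (fun _ _ h => h.elim) h, fun h => h ▸ EqvGen.refl _⟩
  rw [hrel, diagonal, testBit_setBits]
  simp only [List.mem_map, List.mem_range]
  constructor
  · rintro ⟨z, hz, h⟩
    obtain ⟨rfl, rfl⟩ := index_injective hz hy h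
    rfl
  · rintro rfl
    exact ⟨x, hx, rfl⟩

/-- By `eqvGen_addPair` the two blocks added are all the new related pairs, so the matrix remains
transitively closed without iteration. -/
theorem Represents.join {N M : ℕ} {r : ℕ → ℕ → Prop} (h : Represents N M r) {a b : ℕ}
    (ha : a < N) (hb : b < N) : Represents N (join N M a b) (addPair r a b) := by
  intro x y hx hy
  rw [testBit_join M hx hy]
  simp only [Bool.or_eq_true, Bool.and_eq_true, h x y hx hy, h x a hx ha, h x b hx hb,
    h a y ha hy, h b y hb hy]
  have hle : ∀ {u v}, EqvGen r u v → EqvGen (addPair r a b) u v := fun huv =>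
    eqvGen_of_forall (fun _ _ h => EqvGen.rel _ _ (Or.inl h)) huv
  have hab : EqvGen (addPair r a b) a b := EqvGen.rel _ _ (Or.inr ⟨rfl, rfl⟩)
  constructor
  · rintro (h | ⟨h1, h2⟩ | ⟨h1, h2⟩)
    · exact hle h
    · exact EqvGen.trans _ _ _ (hle h1) (EqvGen.trans _ _ _ hab (hle h2))
    · exact EqvGen.trans _ _ _ (hle h1) (EqvGen.trans _ _ _ (EqvGen.symm _ _ hab) (hle h2))
  · intro h
    rcases eqvGen_addPair h with h | ⟨h1 | h1, h2 | h2⟩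
    · exact Or.inl h
    · exact Or.inl (EqvGen.trans _ _ _ h1 (EqvGen.symm _ _ h2))
    · exact Or.inr (Or.inl ⟨h1, EqvGen.symm _ _ h2⟩)
    · exact Or.inr (Or.inr ⟨h1, EqvGen.symm _ _ h2⟩)
    · exact Or.inl (EqvGen.trans _ _ _ h1 (EqvGen.symm _ _ h2))

section search

variable {Q : Type*} {N : ℕ} {nd : Q → Bool → ℕ}

theorem Represents.final (hnd : ∀ z c, nd z c < N) :
    ∀ (es : List (Q × Q)) {M : ℕ} {r : ℕ → ℕ → Prop} (_ : Represents N M r)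
      (b : Fin es.length → Bool),
      Represents N (final N nd es M b) fun x y => r x y ∨ ∃ (e : Fin es.length) (c : Bool),
        x = nd (es.get e).1 c ∧ y = nd (es.get e).2 (xor (!c) (b e)) := by
  intro es
  induction es with
  | nil =>
    intro M r h b
    have : (fun x y => r x y ∨ ∃ (e : Fin ([] : List (Q × Q)).length) (c : Bool),
        x = nd (([] : List (Q × Q)).get e).1 c ∧
          y = nd (([] : List (Q × Q)).get e).2 (xor (!c) (b e))) = r := by
      funext x y
      exact propext ⟨fun h => h.elim id fun ⟨e, _⟩ => e.elim0, Or.inl⟩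
    rw [this]
    exact h
  | cons e es ih =>
    intro M r h b
    have h1 := ih ((h.join (hnd e.1 false) (hnd e.2 (!b 0))).join (hnd e.1 true) (hnd e.2 (b 0)))
      (fun i => b i.succ)
    have : (fun x y => r x y ∨ ∃ (e' : Fin (e :: es).length) (c : Bool),
        x = nd ((e :: es).get e').1 c ∧ y = nd ((e :: es).get e').2 (xor (!c) (b e'))) =
        (fun x y => addPair (addPair r (nd e.1 false) (nd e.2 (!b 0))) (nd e.1 true)
          (nd e.2 (b 0)) x y ∨ ∃ (e' : Fin es.length) (c : Bool),
            x = nd (es.get e').1 c ∧ y = nd (es.get e').2 (xor (!c) (b e'.succ))) := by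
      funext x y
      refine propext ⟨?_, ?_⟩
      · rintro (h | ⟨e', c, h⟩)
        · exact Or.inl (Or.inl (Or.inl h))
        · induction e' using Fin.cases with
          | zero =>
            left
            cases c
            · exact Or.inl (Or.inr (by simpa using h))
            · exact Or.inr (by simpa using h)
          | succ e' => exact Or.inr ⟨e', c, h⟩
      · rintro (((h | h) | h) | ⟨e', c, h⟩)
        · exact Or.inl h
        · exact Or.inr ⟨0, false, by simpa using h⟩
        · exact Or.inr ⟨0, true, by simpa using h⟩
        · exact Or.inr ⟨e'.succ, c, h⟩
    rw [this]
    exact h1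

theorem testBit_link_of_testBit {M : ℕ} {e : Q × Q} {t : Bool} {j : ℕ}
    (h : M.testBit j = true) : (link N nd M e t).testBit j = true := by
  have hj : ∀ M a b, M.testBit j = true → (Gadget.join N M a b).testBit j = true := by
    intro M a b h
    change (M ||| (block N M a b ||| block N M b a)).testBit j = true
    rw [Nat.testBit_or, h, Bool.true_or]
  exact hj _ _ _ (hj _ _ _ h)

/-- Bits are never cleared; hence discarding a branch at its first forbidden bit loses no admissible
twist. -/
theorem testBit_final_of_testBit {j : ℕ} : ∀ (es : List (Q × Q)) {M : ℕ}
    (b : Fin es.length → Bool), M.testBit j = true → (Gadget.final N nd es M b).testBit j = true := by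
  intro es
  induction es with
  | nil => exact fun _ h => h
  | cons e es ih => exact fun b h => ih _ (testBit_link_of_testBit h)

theorem land_eq_zero_iff {M F : ℕ} :
    Nat.land M F = 0 ↔ ∀ j, F.testBit j = true → M.testBit j = false := by
  change M &&& F = 0 ↔ _
  constructor
  · intro h j hj
    have := congrArg (Nat.testBit · j) h
    simpa [hj] using this
  · intro h
    refine Nat.eq_of_testBit_eq fun j => ?_
    rw [Nat.testBit_and, Nat.zero_testBit]
    cases hj : F.testBit j
    · simp
    · simp [h j hj]

theorem natCard_subtype_fin_succ {n : ℕ} (P : (Fin (n + 1) → Bool) → Prop) :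
    Nat.card {b // P b} = Nat.card {b : Fin n → Bool // P (Fin.cons false b)} +
      Nat.card {b : Fin n → Bool // P (Fin.cons true b)} := by
  rw [← Nat.card_sum]
  symm
  refine Nat.card_eq_of_bijective (Sum.elim (fun b => ⟨Fin.cons false b.1, b.2⟩)
    (fun b => ⟨Fin.cons true b.1, b.2⟩)) ⟨?_, ?_⟩
  · rintro (⟨b, hb⟩ | ⟨b, hb⟩) (⟨b', hb'⟩ | ⟨b', hb'⟩) h <;>
      simp only [Sum.elim_inl, Sum.elim_inr, Subtype.mk.injEq, Fin.cons_inj, reduceCtorEq,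
        false_and, true_and] at h
    · subst h
      rfl
    · subst h
      rfl
  · rintro ⟨b, hb⟩
    have e : Fin.cons (b 0) (Fin.tail b) = b := Fin.cons_self_tail b
    cases h0 : b 0
    · rw [h0] at e
      exact ⟨Sum.inl ⟨Fin.tail b, by rwa [e]⟩, Subtype.ext e⟩
    · rw [h0] at e
      exact ⟨Sum.inr ⟨Fin.tail b, by rwa [e]⟩, Subtype.ext e⟩

theorem countP_leaves {F : ℕ} (P : ℕ → Bool) : ∀ (es : List (Q × Q)) (M : ℕ), Nat.land M F = 0 →
    (leaves N nd F es M).countP P = Nat.card {b : Fin es.length → Bool //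
      Nat.land (Gadget.final N nd es M b) F = 0 ∧ P (Gadget.final N nd es M b) = true} := by
  intro es
  induction es with
  | nil =>
    intro M hM
    cases hP : P M
    · have : IsEmpty {b : Fin ([] : List (Q × Q)).length → Bool //
          Nat.land (Gadget.final N nd [] M b) F = 0 ∧ P (Gadget.final N nd [] M b) = true} :=
        ⟨fun ⟨b, _, hb⟩ => by simp [Gadget.final, hP] at hb⟩
      rw [Nat.card_of_isEmpty]
      simp [leaves, hP]
    · have : Unique {b : Fin ([] : List (Q × Q)).length → Bool //
          Nat.land (Gadget.final N nd [] M b) F = 0 ∧ P (Gadget.final N nd [] M b) = true} :=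
        ⟨⟨⟨fun i => i.elim0, hM, hP⟩⟩, fun b => Subtype.ext (funext fun i => i.elim0)⟩
      rw [Nat.card_unique]
      simp [leaves, hP]
  | cons e es ih =>
    intro M hM
    have hbranch : ∀ t, (bif Nat.beq (Nat.land (link N nd M e t) F) 0 then
        leaves N nd F es (link N nd M e t) else []).countP P =
        Nat.card {b : Fin es.length → Bool //
          Nat.land (Gadget.final N nd es (link N nd M e t) b) F = 0 ∧
          P (Gadget.final N nd es (link N nd M e t) b) = true} := by
      intro t
      by_cases h : Nat.land (link N nd M e t) F = 0
      · rw [show Nat.beq (Nat.land (link N nd M e t) F) 0 = true by rw [h]; rfl]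
        exact ih _ h
      · have hf : Nat.beq (Nat.land (link N nd M e t) F) 0 = false := by
          rw [Bool.eq_false_iff]
          exact fun h' => h (Nat.eq_of_beq_eq_true h')
        rw [hf]
        have : IsEmpty {b : Fin es.length → Bool //
            Nat.land (Gadget.final N nd es (link N nd M e t) b) F = 0 ∧
            P (Gadget.final N nd es (link N nd M e t) b) = true} := by
          refine ⟨fun ⟨b, hb, _⟩ => h ?_⟩
          rw [land_eq_zero_iff] at hb ⊢
          intro j hj
          rw [Bool.eq_false_iff]
          intro hl
          have := testBit_final_of_testBit (N := N) (nd := nd) es b hl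
          rw [hb j hj] at this
          exact Bool.false_ne_true this
        rw [Nat.card_of_isEmpty]
        rfl
    rw [leaves, List.countP_append, hbranch, hbranch]
    exact (natCard_subtype_fin_succ (n := es.length) fun b =>
      Nat.land (Gadget.final N nd (e :: es) M b) F = 0 ∧
        P (Gadget.final N nd (e :: es) M b) = true).symm

/-- At each pair `compare` tests both dropping and imposing the separation; `K` selects one path
through this tree. -/
theorem le_of_compare {a b : ℕ} (K : ℕ × ℕ → Bool) : ∀ (qs : List (ℕ × ℕ)) (R S : List ℕ),
    compare N a b qs R S = true →
    a * R.countP (fun M => qs.all fun q => !K q || apart N q M) ≤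
      b * S.countP (fun M => qs.all fun q => !K q || apart N q M) := by
  intro qs
  induction qs with
  | nil =>
    intro R S h
    simpa using Nat.le_of_ble_eq_true h
  | cons q qs ih =>
    intro R S h
    rw [compare, Bool.and_eq_true] at h
    cases hq : K q
    · simpa [hq] using ih R S h.1
    · have e : ∀ R : List ℕ, R.countP (fun M => (q :: qs).all fun q => !K q || apart N q M) =
          (R.filter (apart N q)).countP (fun M => qs.all fun q => !K q || apart N q M) := by
        intro R
        rw [List.countP_filter]
        refine List.countP_congr fun M _ => ?_
        simp only [List.all_cons, hq, Bool.not_true, Bool.false_or, Bool.and_eq_true]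
        exact and_comm
      rw [e, e]
      exact ih _ _ h.2

end search

/-- The strands at a port, with the pairing given as a list. -/
def listNode {k m : ℕ} (pl : List ℕ) : Port k m → Bool → ℕ
  | Sum.inl d, c => k + 3 * d.1 + (crn d c).2
  | Sum.inr i, c => bif c then i else pl.getD i 0

/-- The pairs of strands that must not be joined, whatever the conflicts are. -/
def forbidden (k m : ℕ) (pl : List ℕ) : List (ℕ × ℕ) :=
  ((List.range k).map fun i => (i, pl.getD i 0)) ++
  (List.range m).flatMap fun w =>
    [(k + 3 * w, k + 3 * w + 1), (k + 3 * w, k + 3 * w + 2), (k + 3 * w + 1, k + 3 * w + 2)]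

/-- The pairs of strands that do not meet at a loose end. -/
def freePairs (k : ℕ) (pl : List ℕ) : List (ℕ × ℕ) :=
  ((List.range k).flatMap fun j => (List.range j).map fun i => (i, j)).filter fun q =>
    !(Nat.beq (pl.getD q.1 0) q.2 || Nat.beq (pl.getD q.2 0) q.1)

/-- The matrices of a gadget. -/
def allLeaves {k : ℕ} (N : ℕ) (g : Gadget k) (pl : List ℕ) : List ℕ :=
  leaves N (listNode pl) (setBits ((forbidden k g.m pl).map fun q => N * q.1 + q.2)) g.es
    (diagonal N)

/-- The comparison of a gadget with a family of gadgets. -/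
def check {k r : ℕ} (N a b : ℕ) (g' : Fin r → Gadget k) (g : Gadget k) (pl : List ℕ) : Bool :=
  compare N a b (freePairs k pl) ((List.finRange r).flatMap fun i => (g' i).allLeaves N pl)
    (g.allLeaves N pl)

/-- Exchanging the two sides at a loose end flips the twist of the gadget edge there, a bijection on
twists. So the search need not enumerate `ε`. -/
theorem count_eq_count_true {k : ℕ} (g : Gadget k) (p : Fin k → Fin k) (ε : Fin k → Bool)
    (κ : Fin k → Fin k → Prop) : g.count p ε κ = g.count p (fun _ => true) κ := by
  let f : Port k g.m → Bool := Sum.elim (fun _ => false) fun i => !ε i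
  have hnode : ∀ (z : Port k g.m) c, node p ε z c = node p (fun _ => true) z (xor c (f z)) := by
    rintro (d | i) c
    · simp [node, f]
    · simp only [node, pathLabel, f, Sum.elim_inr]
      rcases Bool.eq_false_or_eq_true (ε i) with h | h <;> cases c <;> simp [h]
  let σ : (Fin g.es.length → Bool) ≃ (Fin g.es.length → Bool) :=
    { toFun := fun b e => xor (b e) (xor (f (g.es.get e).1) (f (g.es.get e).2))
      invFun := fun b e => xor (b e) (xor (f (g.es.get e).1) (f (g.es.get e).2))
      left_inv := fun b => funext fun e => by simp
      right_inv := fun b => funext fun e => by simp }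
  have hlink : ∀ b, g.GLink p ε b = g.GLink p (fun _ => true) (σ b) := by
    intro b
    funext x y
    refine propext ⟨?_, ?_⟩
    · rintro ⟨e, c, rfl, rfl⟩
      refine ⟨e, xor c (f (g.es.get e).1), hnode _ _, ?_⟩
      rw [hnode]
      congr 1
      simp only [σ, Equiv.coe_fn_mk]
      cases c <;> cases b e <;> cases f (g.es.get e).1 <;> cases f (g.es.get e).2 <;> rfl
    · rintro ⟨e, c, rfl, rfl⟩
      refine ⟨e, xor c (f (g.es.get e).1), ?_, ?_⟩
      · rw [hnode]
        congr 1
        cases c <;> cases f (g.es.get e).1 <;> rfl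
      · rw [hnode]
        congr 1
        simp only [σ, Equiv.coe_fn_mk]
        cases c <;> cases b e <;> cases f (g.es.get e).1 <;> cases f (g.es.get e).2 <;> rfl
  refine Nat.card_congr (σ.subtypeEquiv fun b => ?_)
  rw [Admissible, Admissible, hlink]

theorem getD_ofFn {k : ℕ} (p : Fin k → Fin k) (i : Fin k) :
    (List.ofFn fun i => (p i : ℕ)).getD i 0 = p i := by
  simp [List.getD_eq_getElem?_getD]

theorem listNode_ofFn {k m : ℕ} (p : Fin k → Fin k) :
    (listNode (List.ofFn fun i => (p i : ℕ)) : Port k m → Bool → ℕ) = node p fun _ => true := by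
  funext z c
  rcases z with d | i
  · rfl
  · rw [listNode, node, pathLabel, getD_ofFn]
    cases c <;> simp

theorem node_lt {k m : ℕ} (p : Fin k → Fin k) (ε : Fin k → Bool) (z : Port k m) (c : Bool) :
    node p ε z c < k + 3 * m := by
  rcases z with d | i
  · have := d.1.2
    have := (crn d c).2.2
    simp only [node]
    omega
  · have := (pathLabel p ε (i, c)).2
    simp only [node]
    omega

/-- Admissibility is divided into the pairs that must be separated whatever `κ` is, used to prune
the search, and the free pairs, on which `κ` is arbitrary and which are filtered afterwards. -/
theorem count_eq_countP {k N : ℕ} (g : Gadget k) (hN : k + 3 * g.m ≤ N) {p : Fin k → Fin k}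
    {κ : Fin k → Fin k → Prop} (hp : ∀ i, κ i (p i)) (hsymm : ∀ x y, κ x y → κ y x)
    (hirr : ∀ x, ¬ κ x x) (K : ℕ × ℕ → Bool) (hK : ∀ x y : Fin k, K (x, y) = true ↔ κ x y) :
    g.count p (fun _ => true) κ = (g.allLeaves N (List.ofFn fun i => (p i : ℕ))).countP
      (fun M => (freePairs k (List.ofFn fun i => (p i : ℕ))).all fun q => !K q || apart N q M) := by
  set pl := List.ofFn fun i => (p i : ℕ) with hpl
  have hnd : ∀ (z : Port k g.m) c, listNode pl z c < N := fun z c => by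
    rw [hpl, listNode_ofFn]
    exact (node_lt _ _ _ _).trans_le hN
  have hforb : ∀ q ∈ forbidden k g.m pl, q.1 < N ∧ q.2 < N ∧ q.1 ≠ q.2 := by
    rintro ⟨x, y⟩ hq
    simp only [forbidden, List.mem_append, List.mem_map, List.mem_range, List.mem_flatMap,
      List.mem_cons, List.not_mem_nil, or_false, Prod.mk.injEq] at hq
    rcases hq with ⟨i, hi, rfl, rfl⟩ | ⟨w, hw, ⟨rfl, rfl⟩ | ⟨rfl, rfl⟩ | ⟨rfl, rfl⟩⟩
    · have h1 := getD_ofFn p ⟨i, hi⟩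
      rw [← hpl] at h1
      simp only [h1]
      have h2 := (p ⟨i, hi⟩).2
      refine ⟨by omega, by omega, fun h => hirr ⟨i, hi⟩ ?_⟩
      have := hp ⟨i, hi⟩
      rwa [show p ⟨i, hi⟩ = ⟨i, hi⟩ from Fin.ext h.symm] at this
    · dsimp only
      omega
    · dsimp only
      omega
    · dsimp only
      omega
  have hF : ∀ M, Nat.land M (setBits ((forbidden k g.m pl).map fun q => N * q.1 + q.2)) = 0 ↔
      ∀ q ∈ forbidden k g.m pl, M.testBit (N * q.1 + q.2) = false := by
    intro M
    rw [land_eq_zero_iff]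
    simp only [testBit_setBits, List.mem_map]
    exact ⟨fun h q hq => h _ ⟨q, hq, rfl⟩, fun h j ⟨q, hq, hj⟩ => hj ▸ h q hq⟩
  have hdiag := represents_diagonal N
  rw [allLeaves, countP_leaves, count]
  · refine Nat.card_congr (Equiv.subtypeEquivRight fun b => ?_)
    have hrep := Represents.final hnd g.es hdiag b
    have hrel : (fun x y => False ∨ ∃ (e : Fin g.es.length) (c : Bool),
        x = listNode pl (g.es.get e).1 c ∧ y = listNode pl (g.es.get e).2 (xor (!c) (b e))) =
        g.GLink p (fun _ => true) b := by
      funext x y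
      rw [false_or, hpl, listNode_ofFn]
      rfl
    rw [hrel] at hrep
    have hbit : ∀ x y, x < N → y < N →
        ((Gadget.final N (listNode pl) g.es (diagonal N) b).testBit (N * x + y) = false ↔
          ¬ EqvGen (g.GLink p (fun _ => true) b) x y) := by
      intro x y hx hy
      rw [← hrep x y hx hy, Bool.not_eq_true]
    rw [hF, List.all_eq_true]
    constructor
    · rintro ⟨h1, h2⟩
      constructor
      · rintro ⟨x, y⟩ hq
        obtain ⟨hx, hy, -⟩ := hforb _ hq
        rw [hbit _ _ hx hy]
        simp only [forbidden, List.mem_append, List.mem_map, List.mem_range, List.mem_flatMap,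
          List.mem_cons, List.not_mem_nil, or_false, Prod.mk.injEq] at hq
        rcases hq with ⟨i, hi, rfl, rfl⟩ | ⟨w, hw, ⟨rfl, rfl⟩ | ⟨rfl, rfl⟩ | ⟨rfl, rfl⟩⟩
        · have := h2 _ _ (hp ⟨i, hi⟩)
          rwa [← getD_ofFn] at this
        · exact h1 ⟨w, hw⟩ 0 1 (by decide)
        · exact h1 ⟨w, hw⟩ 0 2 (by decide)
        · exact h1 ⟨w, hw⟩ 1 2 (by decide)
      · rintro ⟨x, y⟩ hq
        simp only [freePairs, List.mem_filter, List.mem_flatMap, List.mem_map, List.mem_range,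
          Prod.mk.injEq] at hq
        obtain ⟨⟨j, hj, i, hi, rfl, rfl⟩, -⟩ := hq
        rw [Bool.or_eq_true, Bool.not_eq_true', apart, Bool.not_eq_true',
          hbit _ _ (by dsimp only; omega) (by dsimp only; omega)]
        cases hq : K (i, j)
        · exact Or.inl rfl
        · exact Or.inr (h2 ⟨i, by omega⟩ ⟨j, hj⟩ ((hK _ _).1 hq))
    · rintro ⟨h1, h2⟩
      have hpair : ∀ q ∈ forbidden k g.m pl,
          ¬ EqvGen (g.GLink p (fun _ => true) b) q.1 q.2 := by
        intro q hq
        obtain ⟨hx, hy, -⟩ := hforb _ hq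
        exact (hbit _ _ hx hy).1 (h1 q hq)
      constructor
      · intro w i j hij
        have hmem : ∀ q ∈ [(k + 3 * (w : ℕ), k + 3 * w + 1), (k + 3 * w, k + 3 * w + 2),
            (k + 3 * w + 1, k + 3 * w + 2)], q ∈ forbidden k g.m pl := fun q hq =>
          List.mem_append_right _ (List.mem_flatMap.2 ⟨w, List.mem_range.2 w.2, hq⟩)
        have h01 := hpair _ (hmem (k + 3 * w, k + 3 * w + 1) (by simp))
        have h02 := hpair _ (hmem (k + 3 * w, k + 3 * w + 2) (by simp))
        have h12 := hpair _ (hmem (k + 3 * w + 1, k + 3 * w + 2) (by simp))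
        have hlt : ∀ i j : Fin 3, i < j →
            ¬ EqvGen (g.GLink p (fun _ => true) b) (k + 3 * w + i) (k + 3 * w + j) := by
          intro i j hij
          fin_cases i <;> fin_cases j <;> first | exact absurd hij (by decide) | assumption
        rcases lt_or_gt_of_ne hij with h | h
        · exact hlt i j h
        · exact fun he => hlt j i h (EqvGen.symm _ _ he)
      · have hlt : ∀ x y : Fin k, x < y → κ x y →
            ¬ EqvGen (g.GLink p (fun _ => true) b) x y := by
          intro x y hxy hκ
          have hpm : ∀ i : Fin k, ((i : ℕ), (p i : ℕ)) ∈ forbidden k g.m pl := fun i =>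
            List.mem_append_left _ (List.mem_map.2 ⟨i, List.mem_range.2 i.2, by
              rw [hpl, getD_ofFn]⟩)
          by_cases hx : p x = y
          · rw [← hx]
            exact hpair _ (hpm x)
          by_cases hy : p y = x
          · rw [← hy]
            exact fun he => hpair _ (hpm y) (EqvGen.symm _ _ he)
          have hmem : ((x : ℕ), (y : ℕ)) ∈ freePairs k pl := by
            rw [freePairs, List.mem_filter]
            refine ⟨List.mem_flatMap.2 ⟨y, List.mem_range.2 y.2, List.mem_map.2
              ⟨x, List.mem_range.2 hxy, rfl⟩⟩, ?_⟩
            rw [Bool.not_eq_true', Bool.or_eq_false_iff]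
            dsimp only
            rw [hpl, getD_ofFn, getD_ofFn]
            constructor
            · rw [Bool.eq_false_iff]
              exact fun h => hx (Fin.ext (Nat.eq_of_beq_eq_true h))
            · rw [Bool.eq_false_iff]
              exact fun h => hy (Fin.ext (Nat.eq_of_beq_eq_true h))
          have := h2 _ hmem
          rw [(hK x y).2 hκ, Bool.not_true, Bool.false_or, apart, Bool.not_eq_true'] at this
          exact (hbit _ _ (by have := x.2; omega)
            (by have := y.2; omega)).1 this
        intro x y hκ
        rcases lt_trichotomy x y with h | rfl | h
        · exact hlt x y h hκ
        · exact absurd hκ (hirr x)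
        · exact fun he => hlt y x h (hsymm _ _ hκ) (EqvGen.symm _ _ he)
  -- The search needs a starting matrix without forbidden bits: the diagonal has none, because the
  -- two members of a forbidden pair differ.
  · rw [hF]
    rintro ⟨x, y⟩ hq
    obtain ⟨hx, hy, hne⟩ := hforb _ hq
    rw [Bool.eq_false_iff, Ne, hdiag x y hx hy]
    exact fun h => hne (EqvGen.apply_eq (f := id) (fun _ _ h => h.elim) h)

theorem sum_count_le_of_check {k r N a b : ℕ} {g' : Fin r → Gadget k} {g : Gadget k}
    (hN : k + 3 * g.m ≤ N) (hN' : ∀ i, k + 3 * (g' i).m ≤ N) (p : Fin k → Fin k)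
    (ε : Fin k → Bool) (κ : Fin k → Fin k → Prop) (hp : ∀ i, κ i (p i))
    (hsymm : ∀ x y, κ x y → κ y x) (hirr : ∀ x, ¬ κ x x)
    (h : check N a b g' g (List.ofFn fun i => (p i : ℕ)) = true) :
    a * ∑ i, (g' i).count p ε κ ≤ b * g.count p ε κ := by
  classical
  let K : ℕ × ℕ → Bool := fun q => decide (∃ x y : Fin k, q = (↑x, ↑y) ∧ κ x y)
  have hK : ∀ x y : Fin k, K (x, y) = true ↔ κ x y := by
    intro x y
    simp only [K, decide_eq_true_eq, Prod.mk.injEq]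
    constructor
    · rintro ⟨x', y', ⟨h1, h2⟩, h3⟩
      rwa [Fin.ext h1, Fin.ext h2]
    · exact fun h => ⟨x, y, ⟨rfl, rfl⟩, h⟩
  have hsum := le_of_compare K _ _ _ h
  rw [count_eq_count_true, count_eq_countP g hN hp hsymm hirr K hK,
    Finset.sum_congr rfl fun i _ => (by
      rw [count_eq_count_true, count_eq_countP (g' i) (hN' i) hp hsymm hirr K hK] :
      (g' i).count p ε κ = _)]
  rw [List.countP_flatMap, ← List.ofFn_eq_map, List.sum_ofFn] at hsum
  exact hsum

/-- A property holds for all derangements, given as lists of values, that start with `l`. -/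
def forallDerangements (P : List ℕ → Bool) (k : ℕ) : ℕ → List ℕ → Bool
  | 0, l => P l
  | n + 1, l => (List.range k).all fun x =>
      Nat.beq x l.length || l.contains x || forallDerangements P k n (l ++ [x])

theorem of_forallDerangements {P : List ℕ → Bool} {k : ℕ} : ∀ (n : ℕ) (l s : List ℕ),
    forallDerangements P k n l = true → s.length = n → (l ++ s).Nodup →
    (∀ x ∈ l ++ s, x < k) → (∀ i (h : i < (l ++ s).length), (l ++ s)[i] ≠ i) →
    P (l ++ s) = true := by
  intro n
  induction n with
  | zero =>
    intro l s h hs _ _ _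
    rw [List.length_eq_zero_iff.1 hs, List.append_nil]
    exact h
  | succ n ih =>
    rintro l (_ | ⟨x, s⟩) h hs hnd hlt hne
    · simp at hs
    · have e : l ++ x :: s = l ++ [x] ++ s := by simp
      have hx := List.all_eq_true.1 h x (List.mem_range.2 (hlt x (by simp)))
      rw [e]
      refine ih _ _ ?_ (by simpa using hs) (e ▸ hnd) (e ▸ hlt) (fun i hi => ?_)
      · rw [Bool.or_eq_true, Bool.or_eq_true] at hx
        rcases hx with (hx | hx) | hx
        · have := hne l.length (by simp)
          rw [List.getElem_append_right (le_refl _)] at this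
          simp only [Nat.sub_self, List.getElem_cons_zero] at this
          exact absurd (Nat.eq_of_beq_eq_true hx) this
        · rw [List.contains_iff_mem] at hx
          exact absurd rfl ((List.nodup_append.1 hnd).2.2 x hx x (by simp))
        · exact hx
      · have := hne i (by rw [e]; exact hi)
        simpa only [e] using this

theorem of_forallDerangements_nil {P : List ℕ → Bool} {k : ℕ}
    (h : forallDerangements P k k [] = true) (p : Fin k → Fin k) (hp : Injective p)
    (hp' : ∀ i, p i ≠ i) : P (List.ofFn fun i => (p i : ℕ)) = true := by
  refine of_forallDerangements k [] (List.ofFn fun i => (p i : ℕ)) h (by simp) ?_ ?_ ?_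
  · rw [List.nil_append, List.nodup_ofFn]
    exact Fin.val_injective.comp hp
  · intro x hx
    rw [List.nil_append, List.mem_ofFn] at hx
    obtain ⟨i, rfl⟩ := hx
    exact (p i).2
  · intro i hi
    simp only [List.nil_append, List.getElem_ofFn]
    exact fun h => hp' _ (Fin.ext h)

end Gadget

/-! ### The gadgets for short faces -/

/-- The edges of a cycle of length `k` with a loose end at each vertex. -/
def cycleEdges (k : ℕ) [NeZero k] : List (Port k k × Port k k) :=
  (List.finRange k).flatMap fun i =>
    [(Sum.inl (i, 1), Sum.inl (i + 1, 0)), (Sum.inl (i, 2), Sum.inr i)]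

/-- The ends of the edges of a cycle are distinct. -/
def CycleProper (k : ℕ) [NeZero k] : Prop :=
  Bijective fun x : Fin (cycleEdges k).length × Bool =>
    bif x.2 then ((cycleEdges k).get x.1).2 else ((cycleEdges k).get x.1).1

/-- A cycle of length `k` with a loose end at each vertex. -/
def cycleGadget (k : ℕ) [NeZero k] (h : CycleProper k) : Gadget k := ⟨k, cycleEdges k, h⟩

theorem cycleProper_two : CycleProper 2 := by unfold CycleProper; decide +kernel

theorem cycleProper_three : CycleProper 3 := by unfold CycleProper; decide +kernel

theorem cycleProper_four : CycleProper 4 := by unfold CycleProper; decide +kernel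

theorem cycleProper_five : CycleProper 5 := by unfold CycleProper; decide +kernel

/-- Two loose ends are joined. -/
def edgeGadget : Gadget 2 := ⟨0, [(Sum.inr 0, Sum.inr 1)], by decide +kernel⟩

/-- Three loose ends are joined to a new vertex. -/
def clawGadget : Gadget 3 :=
  ⟨1, [(Sum.inl (0, 0), Sum.inr 2), (Sum.inl (0, 1), Sum.inr 1), (Sum.inl (0, 2), Sum.inr 0)],
    by decide +kernel⟩

/-- Four loose ends are joined by two edges. -/
def edgesGadget (j : Fin 4) : Gadget 4 :=
  ⟨0, [(Sum.inr j, Sum.inr (j + 1)), (Sum.inr (j + 2), Sum.inr (j + 3))],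
    by revert j; decide +kernel⟩

/-- Two of five loose ends are joined, the others are joined to a new vertex. -/
def edgeClawGadget (j : Fin 5) : Gadget 5 :=
  ⟨1, [(Sum.inr j, Sum.inr (j + 1)), (Sum.inl (0, 0), Sum.inr (j + 4)),
    (Sum.inl (0, 1), Sum.inr (j + 3)), (Sum.inl (0, 2), Sum.inr (j + 2))],
    by revert j; decide +kernel⟩

namespace Gadget

theorem count_edgeGadget_le (p : Fin 2 → Fin 2) (ε : Fin 2 → Bool) (κ : Fin 2 → Fin 2 → Prop)
    (hp : Injective p) (hp' : ∀ i, p i ≠ i) (hκ : ∀ i, κ i (p i)) (hsymm : ∀ x y, κ x y → κ y x)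
    (hirr : ∀ x, ¬ κ x x) :
    2 * ∑ _i : Fin 1, edgeGadget.count p ε κ ≤ 1 * (cycleGadget 2 cycleProper_two).count p ε κ := by
  -- The width 20 = 5 + 3 · 5 accommodates the strands of the pentagon, and is used for every
  -- gadget.
  have h : forallDerangements (check 20 2 1 (fun _ : Fin 1 => edgeGadget) (cycleGadget 2 cycleProper_two)) 2 2 [] =
    true := by decide +kernel
  exact sum_count_le_of_check (by decide) (by decide) p ε κ hκ hsymm hirr
    (of_forallDerangements_nil h p hp hp')

theorem count_clawGadget_le (p : Fin 3 → Fin 3) (ε : Fin 3 → Bool) (κ : Fin 3 → Fin 3 → Prop)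
    (hp : Injective p) (hp' : ∀ i, p i ≠ i) (hκ : ∀ i, κ i (p i)) (hsymm : ∀ x y, κ x y → κ y x)
    (hirr : ∀ x, ¬ κ x x) :
    2 * ∑ _i : Fin 1, clawGadget.count p ε κ ≤ 1 * (cycleGadget 3 cycleProper_three).count p ε κ := by
  have h : forallDerangements (check 20 2 1 (fun _ : Fin 1 => clawGadget) (cycleGadget 3 cycleProper_three)) 3 3 [] =
    true := by decide +kernel
  exact sum_count_le_of_check (by decide) (by decide) p ε κ hκ hsymm hirr
    (of_forallDerangements_nil h p hp hp')

/-- Only the two pairings of neighbouring loose ends enter; the crossing one need not be planar.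
With two summands the gain is a factor 4. -/
theorem count_edgesGadget_le (p : Fin 4 → Fin 4) (ε : Fin 4 → Bool) (κ : Fin 4 → Fin 4 → Prop)
    (hp : Injective p) (hp' : ∀ i, p i ≠ i) (hκ : ∀ i, κ i (p i)) (hsymm : ∀ x y, κ x y → κ y x)
    (hirr : ∀ x, ¬ κ x x) :
    2 * ∑ i : Fin 2, (edgesGadget (Fin.castLE (by decide) i)).count p ε κ ≤
      1 * (cycleGadget 4 cycleProper_four).count p ε κ := by
  have h : forallDerangements (check 20 2 1
      (fun i : Fin 2 => edgesGadget (Fin.castLE (by decide) i)) (cycleGadget 4 cycleProper_four)) 4 4 [] =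
    true := by decide +kernel
  exact sum_count_le_of_check (by decide) (by decide) p ε κ hκ hsymm hirr
    (of_forallDerangements_nil h p hp hp')

/-- This inequality fixes the base of the bound: five reductions against a factor 2 give 5/2. The
sum over all five rotations is used because it is the averaged gain that enters the induction. -/
theorem count_edgeClawGadget_le (p : Fin 5 → Fin 5) (ε : Fin 5 → Bool)
    (κ : Fin 5 → Fin 5 → Prop) (hp : Injective p) (hp' : ∀ i, p i ≠ i) (hκ : ∀ i, κ i (p i))
    (hsymm : ∀ x y, κ x y → κ y x) (hirr : ∀ x, ¬ κ x x) :
    1 * ∑ i : Fin 5, (edgeClawGadget i).count p ε κ ≤ 2 * (cycleGadget 5 cycleProper_five).count p ε κ := by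
  have h : forallDerangements (check 20 1 2 edgeClawGadget (cycleGadget 5 cycleProper_five)) 5 5 [] =
    true := by decide +kernel
  exact sum_count_le_of_check (by decide) (by decide) p ε κ hκ hsymm hirr
    (of_forallDerangements_nil h p hp hp')

end Gadget

end

section

/-! ### Glued maps -/

open Relation Function OpenMap Finset

set_option linter.unusedSectionVars false

namespace Placement

variable {V W : Type*} {k : ℕ} {O : OpenMap W k} {g : Gadget k}

/-- The reversal of the darts of a glued map. -/
def swap (x : {d // O.β d ≠ d} ⊕ (Fin g.es.length × Bool)) :
    {d // O.β d ≠ d} ⊕ (Fin g.es.length × Bool) :=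
  Sum.map (fun d => ⟨O.β d.1, fun h => d.2 (O.invol.injective h)⟩) (fun x => (x.1, !x.2)) x

variable (P : Placement V O g)

/-- The map that arises by gluing a gadget to the loose ends of a map. -/
noncomputable def glue : CubicMap V where
  inv d := P.dartEquiv (swap (P.dartEquiv.symm d))
  inv_inv d := by
    obtain ⟨x, rfl⟩ := P.dartEquiv.surjective d
    rcases x with d | x
    · simp [swap, O.invol d.1]
    · simp [swap]
  inv_ne d := by
    obtain ⟨x, rfl⟩ := P.dartEquiv.surjective d
    rw [Equiv.symm_apply_apply, Ne, EmbeddingLike.apply_eq_iff_eq]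
    rcases x with d | x
    · simpa [swap, Subtype.ext_iff] using d.2
    · simp [swap, Prod.ext_iff]

/-- A glued map arises by gluing. -/
noncomputable def gluing : Gluing P.glue O g where
  toPlacement := P
  inv_lift {d} hd := by
    change P.dartEquiv (swap (P.dartEquiv.symm (P.dartEquiv (Sum.inl ⟨d, hd⟩)))) = _
    rw [Equiv.symm_apply_apply]
    rfl
  inv_emb e he := by
    obtain ⟨i, rfl⟩ := List.get_of_mem he
    change P.dartEquiv (swap (P.dartEquiv.symm (P.dartEquiv (Sum.inr (i, false))))) = _
    rw [Equiv.symm_apply_apply]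
    rfl

end Placement

namespace Gadget

variable {k : ℕ} (g : Gadget k)

/-- The membership of the vertex of a port, for given sets of vertices. -/
def side {k m : ℕ} (y : Fin m → Bool) (w : Fin k → Bool) : Port k m → Bool :=
  Sum.elim (fun d => y d.1) w

/-- The number of edges of the gadget that leave a set of vertices. -/
def cut (y : Fin g.m → Bool) (w : Fin k → Bool) : ℕ :=
  ∑ e : Fin g.es.length, if side y w (g.es.get e).1 = side y w (g.es.get e).2 then 0 else 1

/-- For every set of vertices of `g'` there is one of `g` that is left by at most as many edges,
or by at most two more if it contains two vertices and avoids two others. -/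
def CutDominates (g g' : Gadget k) : Prop :=
  ∀ (y' : Fin g'.m → Bool) (w : Fin k → Bool), ∃ y : Fin g.m → Bool,
    (g.cut y w ≤ g'.cut y' w ∧ ∀ c, (∀ i, y i = c) → (∀ i, w i = c) → ∀ i, y' i = c) ∨
    (g.cut y w ≤ g'.cut y' w + 2 ∧ 2 ≤ #{i | y i = true} ∧ 2 ≤ #{i | y i = false})

end Gadget

/-! ### Two-connectedness of glued maps -/

namespace Gluing

variable {V W : Type*} {k : ℕ} {M : CubicMap V} {O : OpenMap W k} {g : Gadget k}

section

variable [Fintype V] [DecidableEq V]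

open Classical in
/-- The number of edges of the open map that leave a set of vertices. -/
noncomputable def outerCut [Fintype W] (O : OpenMap W k) (S : W → Prop) : ℕ :=
  ∑ d : {d // O.β d ≠ d}, if S d.1.1 ∧ ¬ S (O.β d).1 then 1 else 0

-- The outer summand does not depend on the gadget, so cuts of two gluings with the same outer
-- vertices differ only by their gadget cuts.
open Classical in
theorem cut_eq [Fintype W] (G : Gluing M O g) (X : Finset V) :
    M.cut X = outerCut O (fun u => G.j (Sum.inl u) ∈ X) +
      g.cut (fun i => decide (G.j (Sum.inr i) ∈ X))
        (fun i => decide (G.j (Sum.inl (O.leg i).1) ∈ X)) := by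
  have hside : ∀ z, Gadget.side (fun i => decide (G.j (Sum.inr i) ∈ X))
      (fun i => decide (G.j (Sum.inl (O.leg i).1) ∈ X)) z = decide ((G.emb z).1 ∈ X) := by
    rintro (d | i)
    · rfl
    · rfl
  rw [CubicMap.cut, card_filter, ← Equiv.sum_comp G.dartEquiv, Fintype.sum_sum_type,
    Fintype.sum_prod_type]
  congr 1
  · refine sum_congr rfl fun d _ => ?_
    rw [Placement.dartEquiv_inl, G.inv_lift d.2]
    convert rfl <;> rfl
  · refine sum_congr rfl fun e _ => ?_
    rw [Fintype.sum_bool, hside, hside]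
    simp only [Placement.dartEquiv_inr, G.inv_emb_port]
    simp only [Gadget.port, Bool.not_true, Bool.not_false, cond_true, cond_false]
    by_cases h1 : (G.emb (g.es.get e).1).1 ∈ X <;> by_cases h2 : (G.emb (g.es.get e).2).1 ∈ X <;>
      simp only [h1, h2] <;> simp

variable {V' : Type*} [Fintype V'] [DecidableEq V'] {M' : CubicMap V'} {g' : Gadget k}

/-- A set of cut at most 1 in the reduced map is carried back by keeping its outer vertices and
choosing the gadget side by `CutDominates`. Either the cut does not grow, against two-connectedness,
or it becomes at most 3 with two gadget vertices on each side, against the atom by uncrossing. -/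
theorem twoConn (G : Gluing M O g) (G' : Gluing M' O g') (hM : M.TwoConn) {A : Finset V}
    (hA : M.IsAtom A) (hmem : ∀ i, G.j (Sum.inr i) ∈ A) (h : g.CutDominates g') :
    M'.TwoConn := by
  classical
  have : Fintype W := Fintype.ofInjective (fun u => G.j (Sum.inl u)) fun u v h => by simpa using h
  intro X' hne huniv
  by_contra hcut
  obtain ⟨y, hy⟩ := h (fun i => decide (G'.j (Sum.inr i) ∈ X'))
    (fun i => decide (G'.j (Sum.inl (O.leg i).1) ∈ X'))
  let S : W ⊕ Fin g.m → Prop := Sum.elim (fun u => G'.j (Sum.inl u) ∈ X') (fun i => y i = true)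
  let X : Finset V := {v | S (G.j.symm v)}
  have hX : ∀ z, G.j z ∈ X ↔ S z := fun z => by simp [X]
  have hcX' := G'.cut_eq X'
  have hcX : M.cut X = outerCut O (fun u => G'.j (Sum.inl u) ∈ X') + g.cut y
      (fun i => decide (G'.j (Sum.inl (O.leg i).1) ∈ X')) := by
    rw [G.cut_eq X]
    congr 1
    · congr 1
      funext u
      exact propext (hX _)
    · congr 1
      · funext i
        rw [Bool.eq_iff_iff, decide_eq_true_eq]
        exact hX _
      · funext i
        rw [Bool.eq_iff_iff, decide_eq_true_eq, decide_eq_true_eq]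
        exact hX _
  rcases hy with ⟨hle, hconst⟩ | ⟨hle, h1, h2⟩
  · have hX2 : ¬ 2 ≤ M.cut X := by omega
    by_cases hXne : X.Nonempty
    · have hXu : X = univ := by
        by_contra h
        exact hX2 (hM X hXne h)
      have hall : ∀ z, S z := fun z => (hX z).1 (hXu ▸ mem_univ _)
      -- The constancy clause of `CutDominates` ensures that a set that is carried back to
      -- everything (below: to nothing) was already so.
      have := hconst true (fun i => hall (Sum.inr i)) (fun i => decide_eq_true (hall (Sum.inl _)))
      refine huniv (eq_univ_iff_forall.2 fun v => ?_)
      obtain ⟨z, rfl⟩ := G'.j.surjective v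
      rcases z with u | i
      · exact hall (Sum.inl u)
      · exact of_decide_eq_true (this i)
    · have hall : ∀ z, ¬ S z := fun z hz => hXne ⟨_, (hX z).2 hz⟩
      have := hconst false (fun i => Bool.eq_false_iff.2 (hall (Sum.inr i)))
        (fun i => decide_eq_false (hall (Sum.inl _)))
      obtain ⟨v, hv⟩ := hne
      obtain ⟨z, rfl⟩ := G'.j.surjective v
      rcases z with u | i
      · exact hall (Sum.inl u) hv
      · exact of_decide_eq_false (this i) hv
  · refine hA.false_of_cut_le hM (X := X) (by omega) ?_ ?_
    · refine h1.trans (card_le_card_of_injOn (fun i => G.j (Sum.inr i)) ?_ ?_)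
      · intro i hi
        simp only [coe_filter, mem_univ, true_and, Set.mem_ofPred_eq] at hi
        simp only [coe_inter, Set.mem_inter_iff, mem_coe]
        exact ⟨hmem i, (hX _).2 hi⟩
      · intro i _ i' _ h
        simpa using h
    · refine h2.trans (card_le_card_of_injOn (fun i => G.j (Sum.inr i)) ?_ ?_)
      · intro i hi
        simp only [coe_filter, mem_univ, true_and, Set.mem_ofPred_eq] at hi
        simp only [coe_sdiff, Set.mem_sdiff, mem_coe]
        exact ⟨hmem i, fun h => by
          have : y i = true := (hX _).1 h
          rw [hi] at this
          exact Bool.false_ne_true this⟩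
      · intro i _ i' _ h
        simpa using h

end

end Gluing

/-! ### Planarity of glued maps -/

namespace Gadget

variable {k : ℕ} [NeZero k]

/-- The face on a side of a port; the faces at the loose ends `i` and `i + 1` have number `i`. -/
def faceIndex {k m : ℕ} [NeZero k] (a : Fin m × Fin 3 → Fin k) : Port k m → Bool → Fin k
  | Sum.inl d, c => a (crn d c)
  | Sum.inr i, c => bif c then i else i - 1

/-- The faces around a gadget that replaces a cycle are given by `a`, after identification of the
faces `s` and `t`. -/
def FaceCompatible (g : Gadget k) (a : Fin g.m × Fin 3 → Fin k) (s t : Fin k) : Prop :=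
  ∀ e ∈ g.es, ∀ c : Bool, (fun i => if i = s then t else i) (faceIndex a e.1 c) =
    (fun i => if i = s then t else i) (faceIndex a e.2 (!c))

end Gadget

/-- Keep the labels outside, identify those of the faces `s` and `t`, and label the new gadget by
`a`. At most the inner face is lost, and one more label if `s ≠ t`; `hcard` says that enough
vertices disappear to pay for this. -/
theorem planar_of_faceCompatible {V V' W : Type*} {k : ℕ} [NeZero k] {M : CubicMap V}
    {O : OpenMap W k} {hk : CycleProper k}
    [Fintype V] [DecidableEq V] [Fintype V'] [DecidableEq V'] {M' : CubicMap V'} {g' : Gadget k}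
    (G : Gluing M O (cycleGadget k hk)) (G' : Gluing M' O g') (hM : M.Planar)
    {a : Fin g'.m × Fin 3 → Fin k} {s t : Fin k} (h : g'.FaceCompatible a s t)
    (hcard : g'.m + 2 + (if s = t then 0 else 2) ≤ k) : M'.Planar := by
  classical
  have : Fintype W := Fintype.ofInjective (fun u => G.j (Sum.inl u)) fun u v h => by simpa using h
  obtain ⟨L, hL, hLcard⟩ := hM
  have hedge : ∀ e ∈ cycleEdges k, ∀ c, L (crn (G.emb e.1) c) = L (crn (G.emb e.2) (!c)) := by
    intro e he c
    rw [hL, G.inv_emb e he]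
  have hleg : ∀ (i : Fin k) c, L (crn (G.emb (Sum.inl (i, 2))) c) =
      L (crn (G.emb (Sum.inr i)) (!c)) := fun i c =>
    hedge (Sum.inl (i, 2), Sum.inr i) (List.mem_flatMap.2 ⟨i, List.mem_finRange i, by simp⟩) c
  have hnext : ∀ (i : Fin k) c, L (crn (G.emb (Sum.inl (i, 1))) c) =
      L (crn (G.emb (Sum.inl ((i + 1 : Fin k), 0))) (!c)) := fun i c =>
    hedge (Sum.inl (i, 1), Sum.inl (i + 1, 0))
      (List.mem_flatMap.2 ⟨i, List.mem_finRange i, by simp⟩) c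
  let Lin : Fin k → Fin 3 → ℕ := fun i x => L (G.j (Sum.inr i), x + G.s i)
  have hcrn : ∀ (i : Fin k) (x : Fin 3) c, L (crn (G.emb (Sum.inl (i, x))) c) =
      Lin i (crn (i, x) c).2 := fun i x c => by
    rw [Placement.crn_emb_inl]
    rfl
  -- `lab i` labels the face between the loose ends `i` and `i + 1`. In the cycle, corner 0 of
  -- vertex `i` lies on that face, corner 1 on the preceding one and corner 2 on the inner face.
  let lab : Fin k → ℕ := fun i => L (crn (G.emb (Sum.inr i)) true)
  have hlab0 : ∀ i, Lin i 0 = lab i := fun i => by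
    have := hleg i false
    rwa [hcrn] at this
  have hlab1 : ∀ i, L (crn (G.emb (Sum.inr i)) false) = Lin i 1 := fun i => by
    have := hleg i true
    rw [hcrn] at this
    exact this.symm
  have hstep : ∀ i, Lin (i + 1) 1 = Lin i 0 := fun i => by
    have := hnext i true
    rw [hcrn, hcrn] at this
    exact this.symm
  have hinner : ∀ i, Lin (i + 1) 2 = Lin i 2 := fun i => by
    have := hnext i false
    rw [hcrn, hcrn] at this
    exact this.symm
  have hlabf : ∀ i, L (crn (G.emb (Sum.inr i)) false) = lab (i - 1) := fun i => by
    rw [hlab1, ← hlab0, ← hstep, sub_add_cancel]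
  have hinner0 : ∀ i, Lin i 2 = Lin 0 2 := by
    have : ∀ (n : ℕ) (hn : n < k), Lin ⟨n, hn⟩ 2 = Lin 0 2 := by
      intro n
      induction n with
      | zero => exact fun _ => rfl
      | succ n ih =>
        intro hn
        rw [← ih (by omega), ← hinner ⟨n, by omega⟩]
        congr 1
        exact Fin.ext (by simp [Fin.val_add, Nat.mod_eq_of_lt hn])
    exact fun i => this i i.2
  -- Each face around the cycle also has a corner outside, so only the inner label can disappear
  -- with the cycle.
  have himage : univ.image L ⊆ insert (Lin 0 2) (univ.image fun u => L (G.lift u)) := by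
    intro x hx
    obtain ⟨⟨v, i⟩, -, rfl⟩ := mem_image.1 hx
    obtain ⟨z, rfl⟩ := G.j.surjective v
    rcases z with u | w
    · exact mem_insert_of_mem (mem_image.2 ⟨(u, i), mem_univ _, rfl⟩)
    · change Fin k at w
      have hi : L (G.j (Sum.inr w), i) = Lin w (i - G.s w) := by simp [Lin]
      rw [hi]
      generalize i - G.s w = i'
      have h0 : ∀ w, Lin w 0 ∈ univ.image fun u => L (G.lift u) := fun w => by
        rw [hlab0]
        exact mem_image.2 ⟨crn (O.leg w) true, mem_univ _, rfl⟩
      have h3 : ∀ x : Fin 3, x = 0 ∨ x = 1 ∨ x = 2 := by decide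
      rcases h3 i' with rfl | rfl | rfl
      · exact mem_insert_of_mem (h0 w)
      · have := hstep (w - 1)
        rw [sub_add_cancel] at this
        rw [this]
        exact mem_insert_of_mem (h0 _)
      · rw [hinner0 w]
        exact mem_insert_self _ _
  let ρ : ℕ → ℕ := fun x => if x = lab s then lab t else x
  have hρ : ∀ i i' : Fin k, (if i = s then t else i) = (if i' = s then t else i') →
      ρ (lab i) = ρ (lab i') := by
    have key : ∀ i, ρ (lab i) = ρ (lab (if i = s then t else i)) := by
      intro i
      split_ifs with hi
      · subst hi
        simp [ρ]
      · rfl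
    intro i i' hii
    rw [key, hii, ← key]
  let L' : V' × Fin 3 → ℕ := fun q => Sum.elim (fun u => ρ (L (G.lift (u, q.2))))
    (fun w => ρ (lab (a (w, q.2 - G'.s w)))) (G'.j.symm q.1)
  have hL'lift : ∀ u, L' (G'.lift u) = ρ (L (G.lift u)) := fun u => by simp [L', Placement.lift]
  have hL'emb : ∀ z c, L' (crn (G'.emb z) c) = ρ (lab (Gadget.faceIndex a z c)) := by
    rintro (d | i) c
    · rw [Placement.crn_emb_inl]
      simp only [L', Equiv.symm_apply_apply, Sum.elim_inr, add_sub_cancel_right]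
      rfl
    · rw [Placement.crn_emb_inr, hL'lift]
      congr 1
      cases c
      · exact hlabf i
      · rfl
  refine ⟨L', ?_, ?_⟩
  · have hport : ∀ (e : Fin g'.es.length) c, L' (crn (G'.emb (g'.es.get e).1) c) =
        L' (crn (G'.emb (g'.es.get e).2) (!c)) := by
      intro e c
      rw [hL'emb, hL'emb]
      exact hρ _ _ (h _ (List.get_mem _ _) c)
    refine G'.dart_cases ?_ ?_
    · intro d hd c
      rw [G'.inv_lift hd, Placement.crn_lift, Placement.crn_lift, hL'lift, hL'lift]
      have := hL (G.lift d) c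
      rw [G.inv_lift hd, Placement.crn_lift, Placement.crn_lift] at this
      rw [this]
    · rintro ⟨e, b⟩ c
      rw [G'.inv_emb_port]
      cases b
      · exact hport e c
      · have := hport e (!c)
        rw [Bool.not_not] at this
        exact this.symm
  · have hV : Fintype.card V = Fintype.card W + k := by
      rw [← Fintype.card_congr G.j, Fintype.card_sum, Fintype.card_fin]
      rfl
    have hV' : Fintype.card V' = Fintype.card W + g'.m := by
      rw [← Fintype.card_congr G'.j, Fintype.card_sum, Fintype.card_fin]
    have h1 : #(univ.image L) ≤ #(univ.image fun u => L (G.lift u)) + 1 :=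
      (card_le_card himage).trans (card_insert_le _ _)
    have h2 : (univ.image fun u => L (G.lift u)).image ρ ⊆ univ.image L' := by
      intro x hx
      simp only [mem_image, mem_univ, true_and] at hx
      obtain ⟨_, ⟨u, rfl⟩, rfl⟩ := hx
      exact mem_image.2 ⟨_, mem_univ _, hL'lift u⟩
    have h2' := card_le_card h2
    have h3 : #(univ.image fun u => L (G.lift u)) ≤
        #((univ.image fun u => L (G.lift u)).image ρ) + (if s = t then 0 else 1) := by
      split_ifs with hst
      · have : ρ = id := by
          funext x
          simp only [ρ, hst, id]
          split_ifs with hx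
          · exact hx.symm
          · rfl
        rw [this, image_id, Nat.add_zero]
      · have hsub : (univ.image fun u => L (G.lift u)) ⊆
            insert (lab s) ((univ.image fun u => L (G.lift u)).image ρ) := by
          intro x hx
          by_cases hxs : x = lab s
          · exact hxs ▸ mem_insert_self _ _
          · exact mem_insert_of_mem (mem_image.2 ⟨x, hx, if_neg hxs⟩)
        exact (card_le_card hsub).trans (card_insert_le _ _)
    split_ifs at hcard h3 <;> omega

end

section

/-! ### Short faces -/

open Relation Function OpenMap Finset

set_option linter.unusedSectionVars false

namespace CubicMap

/-- A face of length `k` without repeated vertices whose vertices have their third neighbours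
elsewhere. -/
structure FaceCycle {V : Type*} (M : CubicMap V) (k : ℕ) [NeZero k] where
  /-- The vertices. -/
  c : Fin k → V
  /-- The dart that leads to the preceding vertex. -/
  s : Fin k → Fin 3
  injective : Injective c
  inv_next : ∀ i, M.inv (c i, s i + 1) = (c (i + 1), s (i + 1))
  leg_notMem : ∀ i, (M.inv (c i, s i + 2)).1 ∉ Set.range c

namespace FaceCycle

variable {V : Type*} {M : CubicMap V} {k : ℕ} [NeZero k] (F : M.FaceCycle k)

/-- The vertices outside the face. -/
abbrev Outer : Type _ := {v // v ∉ Set.range F.c}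

theorem inv_prev (i : Fin k) : M.inv (F.c i, F.s i) = (F.c (i - 1), F.s (i - 1) + 1) := by
  have := F.inv_next (i - 1)
  rw [sub_add_cancel] at this
  rw [← this, M.inv_inv]

open Classical in
/-- The map without the face. -/
noncomputable def openMap : OpenMap F.Outer k where
  β d := if h : (M.inv (d.1.1, d.2)).1 ∉ Set.range F.c then
    (⟨_, h⟩, (M.inv (d.1.1, d.2)).2) else d
  invol d := by
    by_cases h : (M.inv (d.1.1, d.2)).1 ∉ Set.range F.c
    · have h1 : (M.inv ((M.inv (d.1.1, d.2)).1, (M.inv (d.1.1, d.2)).2)) = (d.1.1, d.2) :=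
        M.inv_inv _
      have h2 : (M.inv ((M.inv (d.1.1, d.2)).1, (M.inv (d.1.1, d.2)).2)).1 ∉ Set.range F.c := by
        rw [h1]
        exact d.1.2
      simp only [dif_pos h, dif_pos h2]
      refine Prod.ext (Subtype.ext ?_) ?_
      · exact congrArg Prod.fst h1
      · exact (Prod.ext_iff.1 h1).2
    · simp only [dif_neg h]
  leg i := (⟨_, F.leg_notMem i⟩, (M.inv (F.c i, F.s i + 2)).2)
  leg_injective i i' h := by
    have h1 : M.inv (F.c i, F.s i + 2) = M.inv (F.c i', F.s i' + 2) :=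
      Prod.ext (congrArg (fun x => x.1.1) h) (congrArg (fun x => x.2) h)
    exact F.injective (congrArg Prod.fst (M.inv_injective h1))
  fixed_iff d := by
    by_cases h : (M.inv (d.1.1, d.2)).1 ∉ Set.range F.c
    · rw [dif_pos h]
      constructor
      · intro hd
        exact absurd (Prod.ext (congrArg (fun x => x.1.1) hd) (congrArg (fun x => x.2) hd))
          (M.inv_ne (d.1.1, d.2))
      · rintro ⟨i, rfl⟩
        refine absurd ?_ h
        change (M.inv (M.inv (F.c i, F.s i + 2))).1 ∈ _
        rw [M.inv_inv]
        exact ⟨i, rfl⟩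
    · rw [dif_neg h]
      refine ⟨fun _ => ?_, fun _ => rfl⟩
      rw [not_not] at h
      obtain ⟨i, hi⟩ := h
      -- An outer dart that leads into the face is a loose end, since the other two darts at a face
      -- vertex lead back to the face.
      have hcases : ∀ x y : Fin 3, x = y ∨ x = y + 1 ∨ x = y + 2 := by decide
      have hd : M.inv (F.c i, (M.inv (d.1.1, d.2)).2) = (d.1.1, d.2) := by
        rw [hi, Prod.mk.eta, M.inv_inv]
      have hout := d.1.2
      rcases hcases (M.inv (d.1.1, d.2)).2 (F.s i) with hx | hx | hx
      · rw [hx, F.inv_prev] at hd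
        exact absurd ⟨_, congrArg Prod.fst hd⟩ hout
      · rw [hx, F.inv_next] at hd
        exact absurd ⟨_, congrArg Prod.fst hd⟩ hout
      · rw [hx] at hd
        refine ⟨i, Prod.ext (Subtype.ext ?_) ?_⟩
        · exact congrArg Prod.fst hd
        · exact (Prod.ext_iff.1 hd).2

theorem vertex_bijective : Bijective (Sum.elim Subtype.val F.c : F.Outer ⊕ Fin k → V) := by
  constructor
  · rintro (u | i) (v | i') h
    · exact congrArg Sum.inl (Subtype.ext h)
    · exact absurd ⟨i', h.symm⟩ u.2
    · exact absurd ⟨i, h⟩ v.2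
    · exact congrArg Sum.inr (F.injective h)
  · intro v
    by_cases h : v ∈ Set.range F.c
    · obtain ⟨i, rfl⟩ := h
      exact ⟨Sum.inr i, rfl⟩
    · exact ⟨Sum.inl ⟨v, h⟩, rfl⟩

/-- A map arises from the outside of a face by gluing a cycle. -/
noncomputable def gluing (hk : CycleProper k) : Gluing M F.openMap (cycleGadget k hk) where
  j := Equiv.ofBijective _ F.vertex_bijective
  s := F.s
  inv_lift {d} hd := by
    have h : (M.inv (d.1.1, d.2)).1 ∉ Set.range F.c := by
      by_contra h
      exact hd (dif_neg (not_not.2 h))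
    have hβ : F.openMap.β d = (⟨_, h⟩, (M.inv (d.1.1, d.2)).2) := dif_pos h
    rw [hβ]
    rfl
  inv_emb e he := by
    obtain ⟨i, -, he⟩ := List.mem_flatMap.1 he
    rcases List.mem_cons.1 he with rfl | he
    · change M.inv (F.c i, 1 + F.s i) = (F.c (i + 1), 0 + F.s (i + 1))
      rw [add_comm, zero_add, F.inv_next]
    · obtain rfl := List.mem_singleton.1 he
      change M.inv (F.c i, 2 + F.s i) = M.inv (F.c i, F.s i + 2)
      rw [add_comm]

end FaceCycle

/-! ### Existence of a short face without chords -/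

section existence

variable {V : Type*} [Fintype V] [DecidableEq V] {M : CubicMap V}

/-- A loop uses two of the three darts at its vertex, leaving at most one edge out. -/
theorem TwoConn.inv_fst_ne (hM : M.TwoConn) (hV : 2 ≤ Fintype.card V) (d : V × Fin 3) :
    (M.inv d).1 ≠ d.1 := by
  intro h
  have hcut := hM {d.1} (singleton_nonempty _) (fun h => by
    have := congrArg card h
    rw [card_singleton, card_univ] at this
    omega)
  have hsub : (univ.filter fun e : V × Fin 3 => e.1 ∈ ({d.1} : Finset V) ∧
      (M.inv e).1 ∉ ({d.1} : Finset V)) ⊆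
      ((univ.erase d.2).erase (M.inv d).2).image (fun i => (d.1, i)) := by
    rintro ⟨v, i⟩ he
    simp only [mem_singleton, mem_filter, mem_univ, true_and] at he
    obtain ⟨rfl, he⟩ := he
    refine mem_image.2 ⟨i, mem_erase.2 ⟨?_, mem_erase.2 ⟨?_, mem_univ _⟩⟩, rfl⟩
    · rintro rfl
      rw [← h, Prod.mk.eta, M.inv_inv] at he
      exact he h.symm
    · rintro rfl
      exact he h
  have hne : (M.inv d).2 ∈ univ.erase d.2 :=
    mem_erase.2 ⟨fun h' => M.inv_ne d (Prod.ext h h'), mem_univ _⟩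
  have := (card_le_card hsub).trans card_image_le
  rw [card_erase_of_mem hne, card_erase_of_mem (mem_univ _), card_univ, Fintype.card_fin] at this
  exact absurd (hcut.trans this) (by norm_num)

/-- A face of length `k`. -/
structure IsFaceOrbit (M : CubicMap V) {k : ℕ} [NeZero k] (D : Fin k → V × Fin 3) : Prop where
  injective : Injective D
  next : ∀ i, M.face (D i) = D (i + 1)

theorem exists_isFaceOrbit {A : Finset V} (hA : M.IsAtom A) (hM : M.TwoConn) (hP : M.Planar) :
    ∃ (k : ℕ) (_ : NeZero k) (D : Fin k → V × Fin 3), k ≤ 5 ∧ M.IsFaceOrbit D ∧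
      ∀ i, (D i).1 ∈ A := by
  classical
  obtain ⟨d, hd, hex⟩ := hA.exists_short_face hM hP
  have hex' : ∃ k, 1 ≤ k ∧ (M.face ^ k) d = d := by
    obtain ⟨k, h1, -, h2⟩ := hex
    exact ⟨k, h1, h2⟩
  obtain ⟨h1, h2⟩ := Nat.find_spec hex'
  have hmin : ∀ n, 1 ≤ n → n < Nat.find hex' → (M.face ^ n) d ≠ d := fun n hn hlt h =>
    Nat.find_min hex' hlt ⟨hn, h⟩
  have h5 : Nat.find hex' ≤ 5 := by
    obtain ⟨k, h1, h5, h2⟩ := hex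
    exact (Nat.find_min' hex' ⟨h1, h2⟩).trans h5
  generalize Nat.find hex' = k at h1 h2 hmin h5
  have hk : NeZero k := ⟨by omega⟩
  have hlt : ∀ i j : Fin k, i < j → (M.face ^ (i : ℕ)) d ≠ (M.face ^ (j : ℕ)) d := by
    intro i j hij h
    have hj : (j : ℕ) = i + (j - i) := by
      have : (i : ℕ) < j := hij
      omega
    rw [hj, pow_add, Equiv.Perm.mul_apply, EmbeddingLike.apply_eq_iff_eq] at h
    have h1 : (i : ℕ) < j := hij
    exact hmin _ (by omega) (by omega) h.symm
  refine ⟨k, hk, fun i => (M.face ^ (i : ℕ)) d, h5, ⟨?_, ?_⟩, ?_⟩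
  · intro i j h
    rcases lt_trichotomy i j with hij | hij | hij
    · exact absurd h (hlt i j hij)
    · exact hij
    · exact absurd h.symm (hlt j i hij)
  · intro i
    rw [← Equiv.Perm.mul_apply, ← pow_succ']
    by_cases hi : (i : ℕ) + 1 < k
    · congr 2
      simp [Fin.val_add, Nat.mod_eq_of_lt hi]
    · have hi' : (i : ℕ) + 1 = k := by omega
      have : ((i + 1 : Fin k) : ℕ) = 0 := by
        simp [Fin.val_add, hi']
      rw [this, hi', h2, pow_zero]
      rfl
  · intro i
    refine hd _ ?_
    dsimp only
    generalize (i : ℕ) = n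
    induction n with
    | zero => exact EqvGen.refl _
    | succ n ih =>
      refine EqvGen.trans _ _ _ ih (EqvGen.rel _ _ ?_)
      rw [pow_succ']
      rfl

theorem IsFaceOrbit.inv_eq {k : ℕ} [NeZero k] {D : Fin k → V × Fin 3} (hD : M.IsFaceOrbit D)
    (i : Fin k) : M.inv (D i) = ((D (i + 1)).1, (D (i + 1)).2 + 2) := by
  rw [← hD.next, face_apply]
  refine Prod.ext rfl ?_
  change _ = _ + 1 + 2
  generalize (M.inv (D i)).2 = x
  revert x
  decide

theorem IsFaceOrbit.fst_injective {k : ℕ} [NeZero k] {D : Fin k → V × Fin 3}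
    (hD : M.IsFaceOrbit D) (hloop : ∀ d, (M.inv d).1 ≠ d.1)
    (hk : ∀ i j : Fin k, i ≠ j → i + 1 = j ∨ j + 1 = i ∨ i + 1 = j - 1 ∨ i + 1 + 1 = j - 1) :
    Injective fun i => (D i).1 := by
  have hne : ∀ i, (D (i + 1)).1 ≠ (D i).1 := fun i h => hloop (D i) (by rw [hD.inv_eq, h])
  -- Two visits with consecutive darts force the face to traverse an edge in both directions. The
  -- distances allowed by `hk` then give a loop or an immediate reversal. As any two distinct darts
  -- at a vertex are consecutive in one order, this excludes every repeated vertex.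
  have key : ∀ i j : Fin k, i ≠ j → (D i).1 = (D j).1 → (D j).2 ≠ (D i).2 + 1 := by
    intro i j hij h h2
    have h3 : D (j - 1) = M.inv (D i) := by
      apply M.face.injective
      rw [hD.next, sub_add_cancel, face_inv]
      exact Prod.ext h.symm h2
    rcases hk i j hij with rfl | rfl | h' | h'
    · exact hne i h.symm
    · exact hne j h
    · rw [← h', hD.inv_eq] at h3
      have := congrArg Prod.snd h3
      dsimp only at this
      generalize (D (i + 1)).2 = x at this
      revert this
      revert x
      decide
    · rw [← h', hD.inv_eq] at h3
      exact hne (i + 1) (Prod.ext_iff.1 h3).1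
  intro i j h
  by_contra hij
  have h1 := key i j hij h
  have h2 := key j i (Ne.symm hij) h.symm
  have h3 : (D i).2 ≠ (D j).2 := fun h' => hij (hD.injective (Prod.ext h h'))
  generalize (D i).2 = x at h1 h2 h3
  generalize (D j).2 = y at h1 h2 h3
  revert x y
  decide

/-- The number of darts at the vertices `I` of a face that may lead elsewhere if the face has a
chord between `a` and `b`. -/
def chordCut {k : ℕ} [NeZero k] (I : Finset (Fin k)) (a b : Fin k) : ℕ :=
  #{q : Fin k × Fin 3 | q.1 ∈ I ∧ ¬ (q.2 = 1 ∧ q.1 + 1 ∈ I) ∧ ¬ (q.2 = 0 ∧ q.1 - 1 ∈ I) ∧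
    ¬ (q.2 = 2 ∧ (q.1 = a ∨ q.1 = b))}

theorem cut_image_le {k : ℕ} [NeZero k] {c : Fin k → V} {s : Fin k → Fin 3}
    (hnext : ∀ i, M.inv (c i, s i + 1) = (c (i + 1), s (i + 1))) {a b : Fin k}
    (hab : M.inv (c a, s a + 2) = (c b, s b + 2)) {I : Finset (Fin k)} (ha : a ∈ I)
    (hb : b ∈ I) : M.cut (I.image c) ≤ chordCut I a b := by
  refine (card_le_card ?_).trans
    (card_image_le (f := fun q : Fin k × Fin 3 => (c q.1, q.2 + s q.1)))
  rintro ⟨v, x⟩ hd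
  simp only [mem_filter, mem_univ, true_and] at hd
  obtain ⟨hv, hout⟩ := hd
  obtain ⟨i, hi, rfl⟩ := mem_image.1 hv
  refine mem_image.2 ⟨(i, x - s i), ?_, by simp⟩
  simp only [mem_filter, mem_univ, true_and]
  refine ⟨hi, ?_, ?_, ?_⟩
  · rintro ⟨hx, hI⟩
    rw [sub_eq_iff_eq_add'] at hx
    rw [hx, hnext] at hout
    exact hout (mem_image_of_mem c hI)
  · rintro ⟨hx, hI⟩
    rw [sub_eq_iff_eq_add', add_zero] at hx
    have := hnext (i - 1)
    rw [sub_add_cancel] at this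
    rw [hx, ← this, M.inv_inv] at hout
    exact hout (mem_image_of_mem c hI)
  · rintro ⟨hx, rfl | rfl⟩
    · rw [sub_eq_iff_eq_add'] at hx
      rw [hx, hab] at hout
      exact hout (mem_image_of_mem c hb)
    · rw [sub_eq_iff_eq_add'] at hx
      rw [hx, ← hab, M.inv_inv] at hout
      exact hout (mem_image_of_mem c ha)

/-- The two cycle darts at each face vertex are already matched along the face, so a third edge that
returns to the face is a chord. The set `I` is a witness that such a chord would make a cut too
small. -/
theorem IsFaceOrbit.exists_faceCycle {k : ℕ} [NeZero k] {D : Fin k → V × Fin 3}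
    (hD : M.IsFaceOrbit D) (hinj : Injective fun i => (D i).1)
    (hchord : ∀ a b : Fin k, a ≠ b → ∃ I : Finset (Fin k), a ∈ I ∧ b ∈ I ∧
      chordCut I a b < M.cut (I.image fun i => (D i).1)) :
    ∃ F : M.FaceCycle k, ∀ i, F.c i = (D i).1 := by
  have h3 : ∀ x : Fin 3, x + 2 + 1 = x := by decide
  have h4 : ∀ x : Fin 3, x + 2 ≠ x := by decide
  have h5 : ∀ x : Fin 3, x + 2 ≠ x + 1 := by decide
  have hnext : ∀ i, M.inv ((D i).1, (D i).2 + 2 + 1) = ((D (i + 1)).1, (D (i + 1)).2 + 2) := by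
    intro i
    rw [h3, Prod.mk.eta, hD.inv_eq]
  have hprev : ∀ i, M.inv ((D i).1, (D i).2 + 2) = ((D (i - 1)).1, (D (i - 1)).2 + 2 + 1) := by
    intro i
    have := hnext (i - 1)
    rw [sub_add_cancel] at this
    rw [← this, M.inv_inv]
  refine ⟨⟨fun i => (D i).1, fun i => (D i).2 + 2, hinj, hnext, ?_⟩, fun i => rfl⟩
  rintro a ⟨b, hb⟩
  dsimp only at hb
  have hcases : ∀ x y : Fin 3, x = y ∨ x = y + 1 ∨ x = y + 2 := by decide
  have hinv : M.inv ((D b).1, (M.inv ((D a).1, (D a).2 + 2 + 2)).2) =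
      ((D a).1, (D a).2 + 2 + 2) := by
    rw [hb, Prod.mk.eta, M.inv_inv]
  rcases hcases (M.inv ((D a).1, (D a).2 + 2 + 2)).2 ((D b).2 + 2) with hx | hx | hx
  · rw [hx, hprev] at hinv
    have h1 : b - 1 = a := hinj (Prod.ext_iff.1 hinv).1
    rw [h1] at hinv
    exact h5 _ (Prod.ext_iff.1 hinv).2.symm
  · rw [hx, hnext] at hinv
    have h1 : b + 1 = a := hinj (Prod.ext_iff.1 hinv).1
    rw [h1] at hinv
    exact h4 _ (Prod.ext_iff.1 hinv).2.symm
  · have hab : M.inv ((D a).1, (D a).2 + 2 + 2) = ((D b).1, (D b).2 + 2 + 2) :=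
      Prod.ext hb.symm hx
    have hne : a ≠ b := by
      rintro rfl
      exact M.inv_ne _ hab
    obtain ⟨I, ha, hb, hlt⟩ := hchord a b hne
    exact absurd (cut_image_le (c := fun i => (D i).1) (s := fun i => (D i).2 + 2) hnext hab ha hb)
      (not_le.2 hlt)

/-- A chord shortcuts an arc of the face; the vertices of a suitable arc form a proper subset of the
atom left by at most three edges, against its minimality. -/
theorem IsFaceOrbit.exists_faceCycle_of_isAtom {k : ℕ} [NeZero k] {D : Fin k → V × Fin 3}
    (hD : M.IsFaceOrbit D) (hinj : Injective fun i => (D i).1) {A : Finset V} (hA : M.IsAtom A)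
    (hmem : ∀ i, (D i).1 ∈ A)
    (hk : ∀ a b : Fin k, a ≠ b → ∃ I : Finset (Fin k), a ∈ I ∧ b ∈ I ∧ 2 ≤ #I ∧ #I < k ∧
      chordCut I a b ≤ 3) :
    ∃ F : M.FaceCycle k, ∀ i, F.c i = (D i).1 := by
  refine hD.exists_faceCycle hinj fun a b hab => ?_
  obtain ⟨I, ha, hb, h2, hlt, h3⟩ := hk a b hab
  refine ⟨I, ha, hb, lt_of_le_of_lt h3 (hA.four_le_cut _ ⟨?_, fun h => ?_⟩ ?_)⟩
  · intro v hv
    obtain ⟨i, -, rfl⟩ := mem_image.1 hv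
    exact hmem i
  · have h1 : univ.image (fun i => (D i).1) ⊆ I.image fun i => (D i).1 := by
      intro v hv
      obtain ⟨i, -, rfl⟩ := mem_image.1 hv
      exact h (hmem i)
    have := card_le_card h1
    rw [card_image_of_injective _ hinj, card_image_of_injective _ hinj, card_univ,
      Fintype.card_fin] at this
    omega
  · rwa [card_image_of_injective _ hinj]

theorem exists_faceCycle (hM : M.TwoConn) (hP : M.Planar) (hV : 3 ≤ Fintype.card V) :
    ∃ A, M.IsAtom A ∧ ((∃ F : M.FaceCycle 2, ∀ i, F.c i ∈ A) ∨
      (∃ F : M.FaceCycle 3, ∀ i, F.c i ∈ A) ∨ (∃ F : M.FaceCycle 4, ∀ i, F.c i ∈ A) ∨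
      ∃ F : M.FaceCycle 5, ∀ i, F.c i ∈ A) := by
  have rep₂ : ∀ i j : Fin 2, i ≠ j → i + 1 = j ∨ j + 1 = i ∨ i + 1 = j - 1 ∨ i + 1 + 1 = j - 1 := by
    decide
  have rep₃ : ∀ i j : Fin 3, i ≠ j → i + 1 = j ∨ j + 1 = i ∨ i + 1 = j - 1 ∨ i + 1 + 1 = j - 1 := by
    decide
  have rep₄ : ∀ i j : Fin 4, i ≠ j → i + 1 = j ∨ j + 1 = i ∨ i + 1 = j - 1 ∨ i + 1 + 1 = j - 1 := by
    decide
  have rep₅ : ∀ i j : Fin 5, i ≠ j → i + 1 = j ∨ j + 1 = i ∨ i + 1 = j - 1 ∨ i + 1 + 1 = j - 1 := by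
    decide
  have chord₂ : ∀ a b : Fin 2, a ≠ b → chordCut univ a b = 0 := by decide
  have chord₃ : ∀ a b : Fin 3, a ≠ b → ∃ I : Finset (Fin 3), a ∈ I ∧ b ∈ I ∧ 2 ≤ #I ∧ #I < 3 ∧
    chordCut I a b ≤ 3 := by decide +kernel
  have chord₄ : ∀ a b : Fin 4, a ≠ b → ∃ I : Finset (Fin 4), a ∈ I ∧ b ∈ I ∧ 2 ≤ #I ∧ #I < 4 ∧
    chordCut I a b ≤ 3 := by decide +kernel
  have chord₅ : ∀ a b : Fin 5, a ≠ b → ∃ I : Finset (Fin 5), a ∈ I ∧ b ∈ I ∧ 2 ≤ #I ∧ #I < 5 ∧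
    chordCut I a b ≤ 3 := by decide +kernel
  obtain ⟨A, hA⟩ := M.exists_isAtom (by omega)
  refine ⟨A, hA, ?_⟩
  obtain ⟨k, hk, D, hk5, hD, hmem⟩ := exists_isFaceOrbit hA hM hP
  have hloop := hM.inv_fst_ne (by omega)
  have hk0 := hk.out
  have hk' : k = 1 ∨ k = 2 ∨ k = 3 ∨ k = 4 ∨ k = 5 := by omega
  rcases hk' with rfl | rfl | rfl | rfl | rfl
  · exfalso
    have := hD.inv_eq 0
    rw [Subsingleton.elim (0 + 1 : Fin 1) 0] at this
    exact hloop (D 0) (Prod.ext_iff.1 this).1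
  -- For a digon no proper subset serves: a third parallel edge would make its two vertices a
  -- component, excluded because there are at least three vertices.
  · obtain ⟨F, hF⟩ := hD.exists_faceCycle (hD.fst_injective hloop rep₂) (fun a b hab => by
      refine ⟨univ, mem_univ _, mem_univ _, ?_⟩
      rw [chord₂ a b hab]
      refine lt_of_lt_of_le Nat.two_pos (hM _ ⟨_, mem_image_of_mem _ (mem_univ 0)⟩ fun h => ?_)
      have := (congrArg card h).symm.le.trans card_image_le
      rw [card_univ, card_univ, Fintype.card_fin] at this
      omega)
    exact Or.inl ⟨F, fun i => hF i ▸ hmem i⟩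
  · obtain ⟨F, hF⟩ := hD.exists_faceCycle_of_isAtom (hD.fst_injective hloop rep₃) hA hmem
      chord₃
    exact Or.inr (Or.inl ⟨F, fun i => hF i ▸ hmem i⟩)
  · obtain ⟨F, hF⟩ := hD.exists_faceCycle_of_isAtom (hD.fst_injective hloop rep₄) hA hmem
      chord₄
    exact Or.inr (Or.inr (Or.inl ⟨F, fun i => hF i ▸ hmem i⟩))
  · obtain ⟨F, hF⟩ := hD.exists_faceCycle_of_isAtom (hD.fst_injective hloop rep₅) hA hmem
      chord₅
    exact Or.inr (Or.inr (Or.inr ⟨F, fun i => hF i ▸ hmem i⟩))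

end existence

end CubicMap

end

section

/-! ### The induction -/

open Relation Function OpenMap Finset

set_option linter.unusedSectionVars false

namespace Gadget

theorem cutDominates_edgeGadget : (cycleGadget 2 cycleProper_two).CutDominates edgeGadget := by
  unfold CutDominates
  decide +kernel

theorem cutDominates_clawGadget : (cycleGadget 3 cycleProper_three).CutDominates clawGadget := by
  unfold CutDominates
  decide +kernel

theorem cutDominates_edgesGadget (j : Fin 4) :
    (cycleGadget 4 cycleProper_four).CutDominates (edgesGadget j) := by
  unfold CutDominates
  revert j
  decide +kernel

theorem cutDominates_edgeClawGadget (j : Fin 5) :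
    (cycleGadget 5 cycleProper_five).CutDominates (edgeClawGadget j) := by
  unfold CutDominates
  revert j
  decide +kernel

theorem faceCompatible_edgeGadget : edgeGadget.FaceCompatible (fun _ => 0) 0 0 := by
  unfold FaceCompatible
  decide +kernel

theorem faceCompatible_clawGadget :
    clawGadget.FaceCompatible (fun d => if d.2 = 0 then 0 else if d.2 = 1 then 2 else 1) 0 0 := by
  unfold FaceCompatible
  decide +kernel

/-- The two faces outside the joined pairs run together between the two new edges, hence the
identification of `j + 3` with `j + 1`. -/
theorem faceCompatible_edgesGadget (j : Fin 4) :
    (edgesGadget j).FaceCompatible (fun _ => 0) (j + 3) (j + 1) := by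
  unfold FaceCompatible
  revert j
  decide +kernel

/-- The faces on either side of the joined pair merge. The corner of the new vertex opposite to a
loose end lies on the face between the other two. -/
theorem faceCompatible_edgeClawGadget (j : Fin 5) : (edgeClawGadget j).FaceCompatible
    (fun d => if d.2 = 0 then j + 2 else if d.2 = 1 then j + 1 else j + 3) (j + 4) (j + 1) := by
  unfold FaceCompatible
  revert j
  decide +kernel

end Gadget

/-! ### The base case and the numerical bound -/

namespace CubicMap

/-- A 3-edge-colouring gives the cover by its two-coloured circuits. Each corner carries the colour
of the dart opposite to it, and the twists are chosen so that this colour is constant along strands.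
-/
theorem numCovers_pos_of_coloring {V : Type*} [Finite V] {M : CubicMap V} (f : V × Fin 3 → Fin 3)
    (hf : ∀ d, f (M.inv d) = f d) (hinj : ∀ v, Injective fun i => f (v, i)) :
    0 < M.numCovers := by
  let T : V × Fin 3 → Bool := fun d => decide (f (crn d false) = f (crn (M.inv d) false))
  have hcrn : ∀ d b, f (crn d b) ≠ f d := by
    intro d b h
    have h1 := hinj d.1 (a₁ := (crn d b).2) (a₂ := d.2) h
    have h2 : ∀ x : Fin 3, x + 1 ≠ x ∧ x + 2 ≠ x := by decide
    cases b
    · exact (h2 d.2).1 h1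
    · exact (h2 d.2).2 h1
  have hcrn2 : ∀ d, f (crn d false) ≠ f (crn d true) := by
    intro d h
    have h1 := hinj d.1 (a₁ := (crn d false).2) (a₂ := (crn d true).2) h
    have h2 : ∀ x : Fin 3, x + 1 ≠ x + 2 := by decide
    exact h2 d.2 h1
  have hlink : ∀ d b, f (crn d b) = f (crn (M.inv d) (xor (!b) (T d))) := by
    intro d b
    have key : ∀ x p q p' q' : Fin 3,
        (p ≠ x ∧ q ≠ x ∧ p ≠ q) ∧ p' ≠ x ∧ q' ≠ x ∧ p' ≠ q' →
        (p = p' ∧ q = q') ∨ (p ≠ p' ∧ p = q' ∧ q = p') := by decide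
    have h := key _ _ _ _ _ ⟨⟨hcrn d false, hcrn d true, hcrn2 d⟩,
      hf d ▸ hcrn (M.inv d) false, hf d ▸ hcrn (M.inv d) true, hcrn2 (M.inv d)⟩
    by_cases hT : f (crn d false) = f (crn (M.inv d) false)
    · have hT' : T d = true := decide_eq_true hT
      replace h := (h.resolve_right fun h' => h'.1 hT).2
      rw [hT']
      cases b
      · exact hT
      · exact h
    · have hT' : T d = false := decide_eq_false hT
      replace h := (h.resolve_left fun h' => hT h'.1).2
      rw [hT']
      cases b
      · exact h.1
      · exact h.2
  have : Nonempty {T : V × Fin 3 → Bool // (∀ d, T (M.inv d) = T d) ∧ StrandsValid M.inv T} := by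
    refine ⟨T, ?_, ?_⟩
    · intro d
      simp only [T, M.inv_inv]
      exact decide_eq_decide.2 eq_comm
    · intro v i j hij h
      refine hij (hinj v (EqvGen.apply_eq (f := f) ?_ h))
      rintro _ _ ⟨d, b, -, rfl, rfl⟩
      exact hlink d b
  exact Nat.card_pos

theorem one_le_numCovers_of_card_eq_two {V : Type*} [Fintype V] [DecidableEq V] {M : CubicMap V}
    (hM : M.TwoConn) (hV : Fintype.card V = 2) : 1 ≤ M.numCovers := by
  have hloop := hM.inv_fst_ne hV.ge
  rw [← card_univ, Finset.card_eq_two] at hV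
  obtain ⟨u, v, huv, huniv⟩ := hV
  have hor : ∀ w, w = u ∨ w = v := fun w => by
    have : w ∈ ({u, v} : Finset V) := huniv ▸ mem_univ w
    simpa using this
  have hu : ∀ d : V × Fin 3, d.1 = v → (M.inv d).1 = u := fun d hd =>
    (hor _).resolve_right fun h => hloop d (h.trans hd.symm)
  refine numCovers_pos_of_coloring (fun d => if d.1 = u then d.2 else (M.inv d).2) ?_ ?_
  · intro d
    rcases hor d.1 with hd | hd
    · have h : (M.inv d).1 ≠ u := fun h => hloop d (h.trans hd.symm)
      simp only [hd, h, if_true, if_false, M.inv_inv]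
    · have h : d.1 ≠ u := fun h => huv (h.symm.trans hd)
      simp only [hu d hd, h, if_true, if_false]
  · intro w i j hij
    dsimp only at hij
    rcases hor w with rfl | rfl
    · simpa using hij
    · rw [if_neg huv.symm, if_neg huv.symm] at hij
      have h1 : M.inv (w, i) = M.inv (w, j) :=
        Prod.ext ((hu (w, i) rfl).trans (hu (w, j) rfl).symm) hij
      exact (Prod.ext_iff.1 (M.inv_injective h1)).2

theorem card_ne_one {V : Type*} [Fintype V] (M : CubicMap V) : Fintype.card V ≠ 1 := by
  intro h
  obtain ⟨v, hv⟩ := Fintype.card_eq_one_iff.1 h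
  have key : ∀ f : Fin 3 → Fin 3, (∀ i, f (f i) = i) → ∃ i, f i = i := by decide
  obtain ⟨i, hi⟩ := key (fun i => (M.inv (v, i)).2) fun i => by
    have : (v, (M.inv (v, i)).2) = M.inv (v, i) := Prod.ext (hv _).symm rfl
    simp only [this, M.inv_inv]
  exact M.inv_ne (v, i) (Prod.ext (hv _) hi)

namespace FaceCycle

variable {V : Type*} {M : CubicMap V} {k : ℕ} [NeZero k] (F : M.FaceCycle k)

/-- The map with the face replaced by a gadget. -/
noncomputable def reduce (g : Gadget k) : CubicMap (F.Outer ⊕ Fin g.m) :=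
  Placement.glue (O := F.openMap) (g := g) ⟨Equiv.refl _, fun _ => 0⟩

/-- The map with the face replaced by a gadget arises by gluing. -/
noncomputable def reduceGluing (g : Gadget k) : Gluing (F.reduce g) F.openMap g :=
  Placement.gluing (O := F.openMap) (g := g) ⟨Equiv.refl _, fun _ => 0⟩

end FaceCycle

/-- The lower bound for the number of covers. -/
noncomputable def coverBound (n : ℕ) : ℝ := (5 / 2 : ℝ) ^ ((n : ℝ) / 4 - 1 / 2)

theorem coverBound_pos (n : ℕ) : 0 < coverBound n := by
  unfold coverBound
  positivity

theorem coverBound_add_four (n : ℕ) : coverBound (n + 4) = 5 / 2 * coverBound n := by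
  unfold coverBound
  rw [show ((n + 4 : ℕ) : ℝ) / 4 - 1 / 2 = ((n : ℝ) / 4 - 1 / 2) + 1 by push_cast; ring,
    Real.rpow_add_one (by norm_num), mul_comm]

/-- The true factor is the square root of 5/2. Squaring avoids the root: the bound at n + 2 is the
geometric mean of those at n and n + 4. -/
theorem coverBound_add_two (n : ℕ) : coverBound (n + 2) ≤ 2 * coverBound n := by
  have h1 : coverBound (n + 2) ^ 2 ≤ (2 * coverBound n) ^ 2 := by
    have e : coverBound (n + 2) ^ 2 = coverBound (n + 4) * coverBound n := by
      unfold coverBound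
      rw [sq, ← Real.rpow_add (by norm_num), ← Real.rpow_add (by norm_num)]
      congr 1
      push_cast
      ring
    rw [e, coverBound_add_four]
    nlinarith [sq_nonneg (coverBound n)]
  exact le_of_sq_le_sq h1 (by have := coverBound_pos n; positivity)

theorem coverBound_two : coverBound 2 = 1 := by
  unfold coverBound
  norm_num

/-! ### The induction step -/

section induction

universe u

variable {V : Type u} [Fintype V] [DecidableEq V] {M : CubicMap V}

theorem FaceCycle.coverBound_le_reduce {k : ℕ} [NeZero k] (F : M.FaceCycle k)
    (hk : CycleProper k) (hM : M.TwoConn) (hP : M.Planar) {A : Finset V} (hA : M.IsAtom A)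
    (hF : ∀ i, F.c i ∈ A) {g : Gadget k} (hcut : (cycleGadget k hk).CutDominates g)
    {a : Fin g.m × Fin 3 → Fin k} {s t : Fin k} (hface : g.FaceCompatible a s t)
    (hm : g.m + 2 + (if s = t then 0 else 2) ≤ k)
    (ih : ∀ (V' : Type u) [Fintype V'] [DecidableEq V'] (M' : CubicMap V'),
      Fintype.card V' < Fintype.card V → M'.TwoConn → M'.Planar →
      coverBound (Fintype.card V') ≤ M'.numCovers) {n : ℕ} (hn : n + k = Fintype.card V + g.m) :
    coverBound n ≤ (F.reduce g).numCovers := by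
  classical
  have : Fintype F.Outer := Fintype.ofFinite _
  have h1 : Fintype.card V = Fintype.card F.Outer + k := by
    rw [← Fintype.card_congr (Equiv.ofBijective _ F.vertex_bijective), Fintype.card_sum,
      Fintype.card_fin]
  have h2 : Fintype.card (F.Outer ⊕ Fin g.m) = n := by
    rw [Fintype.card_sum, Fintype.card_fin]
    omega
  rw [← h2]
  refine ih _ (F.reduce g) (by omega) ?_ ?_
  · exact (F.gluing hk).twoConn (F.reduceGluing g) hM hA hF hcut
  · exact planar_of_faceCompatible (F.gluing hk) (F.reduceGluing g) hP hface hm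

theorem coverBound_le_numCovers_aux (n : ℕ) : ∀ (V : Type u) [Fintype V] [DecidableEq V]
    (M : CubicMap V), Fintype.card V = n → M.TwoConn → M.Planar →
    coverBound (Fintype.card V) ≤ M.numCovers := by
  induction n using Nat.strong_induction_on with
  | _ n IH =>
    intro V _ _ M hn hM hP
    have ih : ∀ (V' : Type u) [Fintype V'] [DecidableEq V'] (M' : CubicMap V'),
        Fintype.card V' < Fintype.card V → M'.TwoConn → M'.Planar →
        coverBound (Fintype.card V') ≤ M'.numCovers := fun V' _ _ M' hlt =>
      IH _ (hn ▸ hlt) V' M' rfl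
    -- A map without vertices has no corners, but planarity demands at least two labels.
    have h0 : Fintype.card V ≠ 0 := by
      intro h
      obtain ⟨L, -, hL⟩ := hP
      have := card_image_le (s := (univ : Finset (V × Fin 3))) (f := L)
      rw [card_univ, Fintype.card_prod, h] at this
      omega
    have h1 := M.card_ne_one
    by_cases h2 : Fintype.card V = 2
    · rw [h2, coverBound_two]
      exact_mod_cast one_le_numCovers_of_card_eq_two hM h2
    obtain ⟨A, hA, ⟨F, hF⟩ | ⟨F, hF⟩ | ⟨F, hF⟩ | ⟨F, hF⟩⟩ := exists_faceCycle hM hP (by omega)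
    · have hsum := sum_numCovers_le (F.gluing cycleProper_two)
        (fun _ : Fin 1 => F.reduceGluing edgeGadget) 2 1 Gadget.count_edgeGadget_le
      obtain ⟨m, hm⟩ : ∃ m, Fintype.card V = m + 2 := ⟨Fintype.card V - 2, by omega⟩
      have hle := F.coverBound_le_reduce cycleProper_two hM hP hA hF
        Gadget.cutDominates_edgeGadget Gadget.faceCompatible_edgeGadget (by decide) ih (n := m)
        (by rw [hm]; rfl)
      rw [Fin.sum_univ_one] at hsum
      rw [hm]
      have hsum' : (2 : ℝ) * (F.reduce edgeGadget).numCovers ≤ 1 * M.numCovers := by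
        exact_mod_cast hsum
      linarith [coverBound_add_two m]
    · have hsum := sum_numCovers_le (F.gluing cycleProper_three)
        (fun _ : Fin 1 => F.reduceGluing clawGadget) 2 1 Gadget.count_clawGadget_le
      obtain ⟨m, hm⟩ : ∃ m, Fintype.card V = m + 2 := ⟨Fintype.card V - 2, by omega⟩
      have hle := F.coverBound_le_reduce cycleProper_three hM hP hA hF
        Gadget.cutDominates_clawGadget Gadget.faceCompatible_clawGadget (by decide) ih (n := m)
        (by rw [hm]; rfl)
      rw [Fin.sum_univ_one] at hsum
      rw [hm]
      have hsum' : (2 : ℝ) * (F.reduce clawGadget).numCovers ≤ 1 * M.numCovers := by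
        exact_mod_cast hsum
      linarith [coverBound_add_two m]
    · have h4 : 4 ≤ Fintype.card V := by
        simpa using Fintype.card_le_of_injective F.c F.injective
      obtain ⟨m, hm⟩ : ∃ m, Fintype.card V = m + 4 := ⟨Fintype.card V - 4, by omega⟩
      have hsum := sum_numCovers_le (F.gluing cycleProper_four)
        (fun i : Fin 2 => F.reduceGluing (edgesGadget (Fin.castLE (by decide) i))) 2 1
        Gadget.count_edgesGadget_le
      have hle := fun j => F.coverBound_le_reduce cycleProper_four hM hP hA hF
        (Gadget.cutDominates_edgesGadget j) (Gadget.faceCompatible_edgesGadget j)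
        (by revert j; decide) ih (n := m) (by rw [hm]; rfl)
      have hsum' : (2 : ℝ) * ∑ i : Fin 2,
          ((F.reduce (edgesGadget (Fin.castLE (by decide) i))).numCovers : ℝ) ≤
          1 * M.numCovers := by
        exact_mod_cast hsum
      have hlow := Finset.sum_le_sum fun (i : Fin 2) (_ : i ∈ univ) =>
        hle (Fin.castLE (by decide) i)
      rw [sum_const, card_univ, Fintype.card_fin, nsmul_eq_mul] at hlow
      rw [hm, coverBound_add_four]
      push_cast at hlow
      linarith [coverBound_pos m]
    · have h5 : 5 ≤ Fintype.card V := by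
        simpa using Fintype.card_le_of_injective F.c F.injective
      obtain ⟨m, hm⟩ : ∃ m, Fintype.card V = m + 4 := ⟨Fintype.card V - 4, by omega⟩
      have hsum := sum_numCovers_le (F.gluing cycleProper_five)
        (fun i : Fin 5 => F.reduceGluing (edgeClawGadget i)) 1 2 Gadget.count_edgeClawGadget_le
      have hle := fun j => F.coverBound_le_reduce cycleProper_five hM hP hA hF
        (Gadget.cutDominates_edgeClawGadget j) (Gadget.faceCompatible_edgeClawGadget j)
        (by revert j; decide) ih (n := m) (by rw [hm]; rfl)
      have hsum' : (1 : ℝ) * ∑ i : Fin 5, ((F.reduce (edgeClawGadget i)).numCovers : ℝ) ≤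
          2 * M.numCovers := by
        exact_mod_cast hsum
      have hlow := Finset.sum_le_sum fun (i : Fin 5) (_ : i ∈ univ) => hle i
      rw [sum_const, card_univ, Fintype.card_fin, nsmul_eq_mul] at hlow
      rw [hm, coverBound_add_four]
      push_cast at hlow
      -- The tight case: five reduced maps, each with at least `coverBound m` covers, against twice
      -- the number of covers of `M`.
      linarith [coverBound_pos m]

/-- A planar cubic map without bridges has many covers. -/
theorem coverBound_le_numCovers (hM : M.TwoConn) (hP : M.Planar) :
    coverBound (Fintype.card V) ≤ M.numCovers :=
  coverBound_le_numCovers_aux _ V M rfl hM hP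

end induction

end CubicMap

end

section

/-! ### Cubic graphs with a rotation system -/

open Relation Function Set

theorem Equiv.Perm.orbit_of_encard_eq_three {D : Type*} {f : Equiv.Perm D} {x : D}
    (h : {y | f.SameCycle x y}.encard = 3) :
    f (f (f x)) = x ∧ Injective (fun i : Fin 3 => (f ^ (i : ℕ)) x) ∧
      ∀ y, f.SameCycle x y → ∃ i : Fin 3, (f ^ (i : ℕ)) x = y := by
  have h1 : f x ≠ x := by
    intro h1
    have hsub : {y | f.SameCycle x y} ⊆ {x} := by
      rintro y ⟨i, rfl⟩
      exact Equiv.Perm.zpow_apply_eq_self_of_apply_eq_self h1 i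
    have := encard_le_encard hsub
    rw [h, encard_singleton] at this
    exact absurd this (by decide)
  have h2 : f (f x) ≠ x := by
    intro h2
    have hsub : {y | f.SameCycle x y} ⊆ {x, f x} := by
      rintro y ⟨i, rfl⟩
      exact Equiv.Perm.zpow_apply_eq_of_apply_apply_eq_self h2 i
    have := (encard_le_encard hsub).trans (encard_insert_le _ _)
    rw [h, encard_singleton] at this
    exact absurd this (by decide)
  have h12 : f (f x) ≠ f x := fun h => h1 (f.injective h)
  have hmem : ∀ n : ℕ, f.SameCycle x ((f ^ n) x) := fun n => ⟨n, by simp⟩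
  have hsub : ({x, f x, f (f x)} : Set D) ⊆ {y | f.SameCycle x y} := by
    rintro y (rfl | rfl | rfl)
    · exact hmem 0
    · exact hmem 1
    · exact hmem 2
  have hcard : ({x, f x, f (f x)} : Set D).encard = 3 :=
    encard_eq_three.2 ⟨x, f x, f (f x), h1.symm, h2.symm, h12.symm, rfl⟩
  have heq : ({x, f x, f (f x)} : Set D) = {y | f.SameCycle x y} := by
    refine Set.Finite.eq_of_subset_of_encard_le ?_ hsub (by rw [h, hcard])
    exact Set.finite_of_encard_eq_coe (k := 3) hcard
  refine ⟨?_, ?_, ?_⟩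
  · have h3 : f (f (f x)) ∈ ({x, f x, f (f x)} : Set D) := heq ▸ hmem 3
    rcases h3 with h3 | h3 | h3
    · exact h3
    · exact absurd (f.injective h3) h2
    · exact absurd (f.injective h3) h12
  · intro i j hij
    fin_cases i <;> fin_cases j <;>
      simp only [Fin.zero_eta, Fin.mk_one, Fin.reduceFinMk, pow_zero, pow_one, pow_two, Equiv.Perm.one_apply,
        Equiv.Perm.mul_apply] at hij ⊢
    · exact absurd hij.symm h1
    · exact absurd hij.symm h2
    · exact absurd hij h1
    · exact absurd hij.symm h12
    · exact absurd hij h2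
    · exact absurd hij h12
  · intro y hy
    have hy' : y ∈ ({x, f x, f (f x)} : Set D) := heq ▸ hy
    rcases hy' with rfl | rfl | rfl
    · exact ⟨0, rfl⟩
    · exact ⟨1, rfl⟩
    · exact ⟨2, rfl⟩

namespace Graph

variable {α β : Type*} {G : Graph α β}

namespace RotationSystem

variable (R : G.RotationSystem)

theorem isLink_tail (d : G.Darts) : G.IsLink d.1 (R.tail d) (R.tail (G.flip d)) := by
  obtain ⟨e, b⟩ := d
  cases b
  · exact R.isLink e
  · exact (R.isLink e).symm

/-- The incident edges are the union, and the loops the intersection, of the edge sets whose first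
or second dart leaves `v`; the sizes of union and intersection add up to the number of darts. -/
theorem encard_tail_eq (v : α) : {d | R.tail d = v}.encard = G.eDegree v := by
  let A : Bool → Set G.edgeSet := fun b => {e | R.tail (e, b) = v}
  have hinc : G.incidenceSet v = Subtype.val '' (A false ∪ A true) := by
    ext e
    constructor
    · intro he
      have hmem : e ∈ G.edgeSet := Inc.edge_mem he
      refine ⟨⟨e, hmem⟩, ?_, rfl⟩
      exact (Inc.eq_or_eq_of_isLink he (R.isLink ⟨e, hmem⟩)).imp Eq.symm Eq.symm
    · rintro ⟨e, he | he, rfl⟩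
      · exact he ▸ (R.isLink e).inc_left
      · exact he ▸ (R.isLink e).inc_right
  have hloop : G.loopSet v = Subtype.val '' (A false ∩ A true) := by
    ext e
    constructor
    · intro he
      have hmem : e ∈ G.edgeSet := IsLoopAt.edge_mem he
      refine ⟨⟨e, hmem⟩, ?_, rfl⟩
      rcases (R.isLink ⟨e, hmem⟩).eq_and_eq_or_eq_and_eq he with h | h
      · exact h
      · exact h
    · rintro ⟨e, ⟨h1, h2⟩, rfl⟩
      have := R.isLink e
      rw [show R.tail (e, false) = v from h1, show R.tail (e, true) = v from h2] at this
      exact this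
  have hdart : {d | R.tail d = v} = (fun e => (e, false)) '' A false ∪
      (fun e => (e, true)) '' A true := by
    ext ⟨e, b⟩
    cases b <;> simp [A]
  have hdisj : Disjoint ((fun e : G.edgeSet => (e, false)) '' A false)
      ((fun e => (e, true)) '' A true) := by
    rw [Set.disjoint_left]
    rintro _ ⟨e, -, rfl⟩ ⟨e', -, h⟩
    simp at h
  have hinj : ∀ b : Bool, Injective fun e : G.edgeSet => (e, b) := fun b e e' h => by simpa using h
  rw [hdart, encard_union_eq hdisj, (hinj false).encard_image, (hinj true).encard_image, eDegree,
    hinc, hloop, Subtype.val_injective.encard_image, Subtype.val_injective.encard_image,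
    encard_union_add_encard_inter]

theorem tail_mem (d : G.Darts) : R.tail d ∈ G.vertexSet := (R.isLink_tail d).left_mem

/-- In a cubic graph the darts can be numbered along the rotation. -/
theorem exists_dartEquiv (hcubic : G.IsRegular 3) :
    ∃ ψ : G.vertexSet × Fin 3 ≃ G.Darts, (∀ d, R.tail (ψ d) = d.1) ∧
      ∀ d, ψ (d.1, d.2 + 1) = R.rot (ψ d) := by
  have hcard : ∀ v : G.vertexSet, {d | R.tail d = v}.encard = 3 := fun v => by
    rw [R.encard_tail_eq, hcubic v v.2]
    rfl
  have hex : ∀ v : G.vertexSet, ∃ d, R.tail d = v := fun v =>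
    Set.nonempty_of_encard_ne_zero (s := {d | R.tail d = v}) (by rw [hcard v]; decide)
  choose base hbase using hex
  have horb := fun v => Equiv.Perm.orbit_of_encard_eq_three (f := R.rot) (x := base v) (by
    rw [← hcard v]
    congr 1
    ext d
    simp only [Set.mem_ofPred_eq]
    rw [R.sameCycle_iff, hbase, eq_comm])
  have htail : ∀ v (i : ℕ), R.tail ((R.rot ^ i) (base v)) = v := fun v i => by
    rw [← hbase v, ← R.sameCycle_iff]
    have h : R.rot.SameCycle (base v) ((R.rot ^ i) (base v)) := ⟨i, by simp⟩
    exact h.symm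
  refine ⟨Equiv.ofBijective (fun d => (R.rot ^ (d.2 : ℕ)) (base d.1)) ⟨?_, ?_⟩, ?_, ?_⟩
  · rintro ⟨v, i⟩ ⟨w, j⟩ h
    dsimp only at h
    have hvw : v = w := Subtype.ext (by rw [← htail v i, h, htail])
    subst hvw
    rw [(horb v).2.1 h]
  · intro d
    obtain ⟨i, hi⟩ := (horb ⟨R.tail d, R.tail_mem d⟩).2.2 d (by rw [R.sameCycle_iff, hbase])
    exact ⟨(_, i), hi⟩
  · exact fun d => htail d.1 d.2
  · rintro ⟨v, i⟩
    change (R.rot ^ ((i + 1 : Fin 3) : ℕ)) (base v) = R.rot ((R.rot ^ (i : ℕ)) (base v))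
    fin_cases i
    · rfl
    · rfl
    · exact (horb v).1.symm

end RotationSystem

/-- A cubic map whose vertices and edges are those of `G`. -/
structure CubicModel (G : Graph α β) where
  /-- The map. -/
  map : CubicMap G.vertexSet
  /-- The edge of a dart. -/
  edge : G.vertexSet × Fin 3 → β
  isLink : ∀ d, G.IsLink (edge d) d.1 (map.inv d).1
  edge_eq_iff : ∀ d d', edge d' = edge d ↔ d' = d ∨ d' = map.inv d
  exists_edge_eq : ∀ e ∈ G.edgeSet, ∃ d, edge d = e

theorem flip_flip (d : G.Darts) : G.flip (G.flip d) = d := by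
  obtain ⟨e, b⟩ := d
  simp [flip]

theorem flip_ne (d : G.Darts) : G.flip d ≠ d := by
  obtain ⟨e, b⟩ := d
  simp [flip]

theorem flip_fst (d : G.Darts) : (G.flip d).1 = d.1 := rfl

theorem eq_or_eq_flip {d d' : G.Darts} (h : d'.1 = d.1) : d' = d ∨ d' = G.flip d := by
  obtain ⟨e, b⟩ := d
  obtain ⟨e', b'⟩ := d'
  obtain rfl : e' = e := h
  cases b <;> cases b' <;> simp [flip]

/-- The map of a cubic graph with a rotation system. -/
def RotationSystem.model (R : G.RotationSystem) (ψ : G.vertexSet × Fin 3 ≃ G.Darts)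
    (hψ : ∀ d, R.tail (ψ d) = d.1) : CubicModel G where
  map :=
    { inv := fun d => ψ.symm (G.flip (ψ d))
      inv_inv := fun d => by simp [flip_flip]
      inv_ne := fun d => by
        rw [Ne, Equiv.symm_apply_eq]
        exact flip_ne _ }
  edge d := (ψ d).1
  isLink d := by
    have := R.isLink_tail (ψ d)
    rw [hψ, ← ψ.apply_symm_apply (G.flip (ψ d)), hψ] at this
    exact this
  edge_eq_iff d d' := by
    constructor
    · intro h
      refine (eq_or_eq_flip (Subtype.ext h)).imp (fun h => ψ.injective h) fun h => ?_
      rw [Equiv.eq_symm_apply]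
      exact h
    · rintro (rfl | rfl)
      · rfl
      · simp [flip_fst]
  exists_edge_eq e he := ⟨ψ.symm (⟨e, he⟩, false), by simp⟩

/-- Each corner is labelled by its face. The count of labels follows from V − E + F = 2c with 3V =
2E and c ≥ 1. -/
theorem RotationSystem.planar_model (R : G.RotationSystem) [Fintype G.vertexSet]
    [DecidableEq G.vertexSet] (ψ : G.vertexSet × Fin 3 ≃ G.Darts)
    (hψ : ∀ d, R.tail (ψ d) = d.1) (hψ' : ∀ d, ψ (d.1, d.2 + 1) = R.rot (ψ d))
    (hne : G.vertexSet.Nonempty) (hR : R.IsPlane) : (R.model ψ hψ).map.Planar := by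
  classical
  have : Fintype G.Darts := Fintype.ofEquiv _ ψ
  have hfin : Finite (Quotient (Equiv.Perm.SameCycle.setoid R.face)) := inferInstance
  obtain ⟨n, ⟨code⟩⟩ := Finite.exists_equiv_fin (Quotient (Equiv.Perm.SameCycle.setoid R.face))
  let cls : G.Darts → ℕ := fun d => code (Quotient.mk _ d)
  have hcls : ∀ d, cls (R.face d) = cls d := fun d => by
    have : Quotient.mk (Equiv.Perm.SameCycle.setoid R.face) (R.face d) = Quotient.mk _ d :=
      Quotient.sound (show R.face.SameCycle _ _ from ⟨-1, by simp⟩)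
    simp only [cls, this]
  let L : G.vertexSet × Fin 3 → ℕ := fun q => cls (ψ (q.1, q.2 + 2))
  have hL : ∀ d, L (crn d false) = cls (ψ d) := by
    rintro ⟨v, i⟩
    have : i + 1 + 2 = i := by revert i; decide
    simp only [L, crn, cond_false, this]
  have hlink : ∀ d, L (crn d false) = L (crn ((R.model ψ hψ).map.inv d) true) := by
    intro d
    rw [← CubicMap.crn_face, hL, hL, CubicMap.face_apply, hψ']
    have : ψ ((R.model ψ hψ).map.inv d) = G.flip (ψ d) := ψ.apply_symm_apply _
    rw [this]
    exact (hcls (ψ d)).symm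
  refine ⟨L, ?_, ?_⟩
  · intro d b
    cases b
    · exact hlink d
    · have := hlink ((R.model ψ hψ).map.inv d)
      rw [CubicMap.inv_inv] at this
      exact this.symm
  · have himg : Finset.univ.image L = Finset.univ.image (fun i : Fin n => (i : ℕ)) := by
      ext x
      simp only [Finset.mem_image, Finset.mem_univ, true_and]
      constructor
      · rintro ⟨q, rfl⟩
        exact ⟨_, rfl⟩
      · rintro ⟨i, rfl⟩
        obtain ⟨q, rfl⟩ := code.surjective i
        obtain ⟨d, rfl⟩ := Quotient.exists_rep q
        obtain ⟨d, rfl⟩ := ψ.surjective d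
        exact ⟨_, hL d⟩
    have hface : numCycles R.face = n := by
      rw [numCycles, Nat.card_congr code, Nat.card_fin]
    rw [himg, Finset.card_image_of_injective _ Fin.val_injective, Finset.card_univ,
      Fintype.card_fin, ← hface]
    have hrot : numCycles R.rot ≤ Fintype.card G.vertexSet := by
      rw [numCycles, ← Nat.card_eq_fintype_card]
      refine Nat.card_le_card_of_injective (Quotient.lift
        (fun d => (⟨R.tail d, R.tail_mem d⟩ : G.vertexSet))
        (fun d d' h => Subtype.ext ((R.sameCycle_iff d d').1 h))) ?_
      rintro ⟨d⟩ ⟨d'⟩ h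
      exact Quotient.sound ((R.sameCycle_iff d d').2 (congrArg Subtype.val h))
    have hflip : 3 * Fintype.card G.vertexSet ≤ 2 * numCycles G.flip := by
      have hE : Nat.card G.edgeSet ≤ numCycles G.flip := by
        refine Nat.card_le_card_of_injective (fun e : G.edgeSet =>
          Quotient.mk (Equiv.Perm.SameCycle.setoid G.flip) ((e, false) : G.Darts)) ?_
        intro e e' h
        obtain ⟨i, hi⟩ : G.flip.SameCycle (e, false) (e', false) := Quotient.exact h
        rcases Equiv.Perm.zpow_apply_eq_of_apply_apply_eq_self
          (flip_flip ((e, false) : G.Darts)) i with h | h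
        · rw [h] at hi
          exact congrArg Prod.fst hi
        · rw [h] at hi
          exact congrArg Prod.fst hi
      have hD : Nat.card G.Darts = 3 * Fintype.card G.vertexSet := by
        rw [← Nat.card_congr ψ, Nat.card_prod, Nat.card_eq_fintype_card, Nat.card_fin, mul_comm]
      rw [Nat.card_prod, Nat.card_eq_fintype_card (α := Bool), Fintype.card_bool] at hD
      omega
    have hcomp : 1 ≤ R.numComponents := by
      obtain ⟨v, hv⟩ := hne
      have : Nonempty (MulAction.orbitRel.Quotient (Subgroup.closure {R.rot, G.flip}) G.Darts) :=
        ⟨Quotient.mk _ (ψ (⟨v, hv⟩, 0))⟩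
      have : Finite (MulAction.orbitRel.Quotient (Subgroup.closure {R.rot, G.flip}) G.Darts) :=
        Quotient.finite _
      exact Nat.card_pos
    have hplane : numCycles R.rot + numCycles R.face = numCycles G.flip + 2 * R.numComponents := hR
    omega

end Graph

end

section

/-! ### Covers and circuit double covers -/

open Relation Function Set

theorem Relation.ReflTransGen.exists_step {α : Type*} {r : α → α → Prop} {x y : α}
    (h : ReflTransGen r x y) {S : α → Prop} (hx : S x) (hy : ¬ S y) :
    ∃ a b, r a b ∧ S a ∧ ¬ S b := by
  induction h with
  | refl => exact absurd hx hy
  | tail _ hbc ih =>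
    rename_i b c _
    by_cases hb : S b
    · exact ⟨b, c, hbc, hb, hy⟩
    · exact ih hb

namespace Graph

variable {α β : Type*} {G : Graph α β}

/-- Finiteness matters because `ncard` is 0 on infinite sets. A circuit has an edge, so it occurs at
most twice in a cover, and there are finitely many circuits. -/
theorem finite_setOf_isCircuitDoubleCover (hV : G.vertexSet.Finite) (hE : G.edgeSet.Finite) :
    {𝒞 : Multiset (Graph α β) | G.IsCircuitDoubleCover 𝒞}.Finite := by
  classical
  have hC : {C : Graph α β | C.IsCircuitOf G}.Finite := by
    refine Set.Finite.of_injOn (f := fun C => (C.vertexSet, C.edgeSet))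
      (t := 𝒫 G.vertexSet ×ˢ 𝒫 G.edgeSet) ?_ ?_ (hV.finite_subsets.prod hE.finite_subsets)
    · intro C hC
      exact ⟨hC.1.vertexSet_mono, hC.1.edgeSet_mono⟩
    · intro C hC C' hC' h
      have h1 : C.vertexSet = C'.vertexSet := congrArg Prod.fst h
      have h2 : C.edgeSet = C'.edgeSet := congrArg Prod.snd h
      refine Graph.ext h1 fun e x y => ⟨fun he => ?_, fun he => ?_⟩
      · exact (hC'.1.isLink_iff (h2 ▸ he.edge_mem)).2 (he.mono hC.1)
      · exact (hC.1.isLink_iff (h2 ▸ he.edge_mem)).2 (he.mono hC'.1)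
  refine (Set.finite_Icc 0 (2 • hC.toFinset.val)).subset fun 𝒞 h𝒞 =>
    ⟨Multiset.zero_le _, Multiset.le_iff_count.2 fun C => ?_⟩
  by_cases hmem : C ∈ 𝒞
  · have hCG := h𝒞.1 C hmem
    obtain ⟨x, hx⟩ := hCG.2.1.1
    have hedge : (C.incidenceSet x).Nonempty := by
      by_contra hne
      rw [Set.not_nonempty_iff_eq_empty] at hne
      have hl : C.loopSet x = ∅ := Set.subset_empty_iff.1 (hne ▸ C.loopSet_subset_incidenceSet x)
      have := hCG.2.2 x hx
      rw [eDegree, hne, hl] at this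
      simp at this
    obtain ⟨e, he⟩ := hedge
    have heC : e ∈ C.edgeSet := Inc.edge_mem he
    have hcount : Multiset.count C 𝒞 ≤ 2 := by
      rw [← h𝒞.2 e (hCG.1.edgeSet_mono heC), Multiset.count, Multiset.countP_eq_card_filter,
        Multiset.countP_eq_card_filter]
      exact Multiset.card_le_card (Multiset.monotone_filter_right _ fun C' h => h ▸ heC)
    rw [Multiset.count_nsmul, Multiset.count_eq_one_of_mem hC.toFinset.nodup
      (by simpa using hCG)]
    exact hcount
  · rw [Multiset.count_eq_zero_of_notMem hmem]
    exact Nat.zero_le _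

/-! ### From valid twists to circuit double covers -/

namespace CubicModel

variable (N : CubicModel G)

theorem exists_dart {e : β} {x y : α} (h : G.IsLink e x y) :
    ∃ d, N.edge d = e ∧ (d.1 : α) = x ∧ ((N.map.inv d).1 : α) = y := by
  obtain ⟨d, rfl⟩ := N.exists_edge_eq e h.edge_mem
  rcases (N.isLink d).eq_and_eq_or_eq_and_eq h with ⟨h1, h2⟩ | ⟨h1, h2⟩
  · exact ⟨d, rfl, h1, h2⟩
  · exact ⟨N.map.inv d, (N.edge_eq_iff d _).2 (Or.inr rfl), h2, by rw [N.map.inv_inv, h1]⟩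

/-- Connectivity gives an edge leaving `X`; as it is no bridge, a walk between its ends avoids it
and leaves `X` along a second edge. -/
theorem twoConn [Fintype G.vertexSet] [DecidableEq G.vertexSet] (hconn : G.IsConnected)
    (hbridge : G.IsBridgeless) : N.map.TwoConn := by
  intro X hne huniv
  obtain ⟨x, hx⟩ := hne
  obtain ⟨y, hy⟩ : ∃ y, y ∉ X := by
    by_contra! h
    exact huniv (Finset.eq_univ_iff_forall.2 h)
  have hcross : ∀ {H : Graph α β} {a b : G.vertexSet}, H ≤ G → H.Reachable a b → a ∈ X → b ∉ X →
      ∃ d, N.edge d ∈ H.edgeSet ∧ d.1 ∈ X ∧ (N.map.inv d).1 ∉ X := by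
    intro H a b hH hab ha hb
    obtain ⟨u, w, ⟨e, he⟩, ⟨u', hu, rfl⟩, hw⟩ := ReflTransGen.exists_step hab
      (S := fun z => ∃ u ∈ X, (u : α) = z) ⟨a, ha, rfl⟩
      (fun ⟨u, hu, h⟩ => hb (Subtype.ext h ▸ hu))
    obtain ⟨d, hd, h1, h2⟩ := N.exists_dart (he.mono hH)
    refine ⟨d, hd ▸ he.edge_mem, ?_, fun h => hw ⟨_, h, h2⟩⟩
    rwa [show d.1 = u' from Subtype.ext h1]
  obtain ⟨d, -, h1, h2⟩ := hcross le_rfl (hconn.2 x x.2 y y.2) hx hy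
  have hreach : (G.deleteEdges {N.edge d}).Reachable d.1 (N.map.inv d).1 := by
    by_contra h
    exact hbridge (N.edge d) ⟨_, _, N.isLink d, h⟩
  obtain ⟨d', h0, h1', h2'⟩ := hcross deleteEdges_le hreach h1 h2
  have hdd : d' ≠ d := by
    rintro rfl
    simp at h0
  refine Finset.one_lt_card.2 ⟨d', ?_, d, ?_, hdd⟩
  · simp [h1', h2']
  · simp [h1, h2]

variable (T : G.vertexSet × Fin 3 → Bool)

/-- The subgraph that a strand passes through. -/
def strand (κ : Quot (Link N.map.inv T)) : Graph α β where
  vertexSet := {x | ∃ q : G.vertexSet × Fin 3, Quot.mk _ q = κ ∧ (q.1 : α) = x}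
  IsLink e x y := G.IsLink e x y ∧ ∃ d b, N.edge d = e ∧ Quot.mk _ (crn d b) = κ
  edgeSet := {e | ∃ d b, N.edge d = e ∧ Quot.mk _ (crn d b) = κ}
  isLink_symm e _ := ⟨fun _ _ h => ⟨h.1.symm, h.2⟩⟩
  eq_or_eq_of_isLink_of_isLink _ _ _ _ _ h h' := h.1.left_eq_or_eq h'.1
  edge_mem_iff_exists_isLink e := by
    constructor
    · rintro ⟨d, b, rfl, h⟩
      exact ⟨_, _, N.isLink d, d, b, rfl, h⟩
    · rintro ⟨x, y, -, h⟩
      exact h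
  left_mem_of_isLink e x y := by
    rintro ⟨h, d, b, rfl, hκ⟩
    rcases h.left_eq_or_eq (N.isLink d) with rfl | rfl
    · exact ⟨_, hκ, rfl⟩
    · refine ⟨crn (N.map.inv d) (xor (!b) (T d)), ?_, rfl⟩
      rw [← hκ]
      exact (Quot.sound ⟨d, b, N.map.inv_ne d, rfl, rfl⟩).symm

variable {N T}

theorem mk_crn_eq (d : G.vertexSet × Fin 3) (b : Bool) :
    Quot.mk (Link N.map.inv T) (crn d b) =
      Quot.mk _ (crn (N.map.inv d) (xor (!b) (T d))) :=
  Quot.sound ⟨d, b, N.map.inv_ne d, rfl, rfl⟩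

theorem edge_mem_strand {κ : Quot (Link N.map.inv T)} {d : G.vertexSet × Fin 3} :
    N.edge d ∈ (N.strand T κ).edgeSet ↔
      κ = Quot.mk _ (crn d false) ∨ κ = Quot.mk _ (crn d true) := by
  have hor : ∀ b, κ = Quot.mk _ (crn d b) →
      κ = Quot.mk _ (crn d false) ∨ κ = Quot.mk _ (crn d true) := by
    intro b h
    cases b
    · exact Or.inl h
    · exact Or.inr h
  constructor
  · rintro ⟨d', b, he, rfl⟩
    rcases (N.edge_eq_iff d d').1 he with rfl | rfl
    · exact hor b rfl
    · refine hor (xor (!b) (T (N.map.inv d))) ((mk_crn_eq _ b).trans ?_)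
      rw [N.map.inv_inv]
  · rintro (h | h)
    · exact ⟨d, false, rfl, h.symm⟩
    · exact ⟨d, true, rfl, h.symm⟩

theorem strand_le (κ : Quot (Link N.map.inv T)) : N.strand T κ ≤ G :=
  ⟨fun _ ⟨q, _, hq⟩ => hq ▸ q.1.2, fun _ _ _ h => h.1⟩

theorem strand_isConnected (κ : Quot (Link N.map.inv T)) : (N.strand T κ).IsConnected := by
  have hsymm : ∀ {H : Graph α β} {x y : α}, H.Reachable x y → H.Reachable y x := by
    intro H x y h
    have : Std.Symm H.Adj := ⟨fun _ _ h => h.symm⟩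
    exact ReflTransGen.stdSymm.symm _ _ h
  have key : ∀ p q, EqvGen (Link N.map.inv T) p q → (N.strand T (Quot.mk _ p)).Reachable p.1 q.1 := by
    intro p q h
    induction h with
    | rel p q h =>
      obtain ⟨d, b, -, rfl, rfl⟩ := h
      exact ReflTransGen.single ⟨N.edge d, N.isLink d, d, b, rfl, rfl⟩
    | refl p => exact ReflTransGen.refl
    | symm p q h ih =>
      rw [← Quot.eqvGen_sound h]
      exact hsymm ih
    | trans p q r h _ ih1 ih2 =>
      rw [← Quot.eqvGen_sound h] at ih2
      exact ReflTransGen.trans ih1 ih2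
  obtain ⟨p, rfl⟩ := Quot.exists_rep κ
  refine ⟨⟨p.1, p, rfl, rfl⟩, ?_⟩
  rintro _ ⟨q, hq, rfl⟩ _ ⟨r, hr, rfl⟩
  exact (hsymm (key p q (Quot.eqvGen_exact hq.symm))).trans (key p r (Quot.eqvGen_exact hr.symm))

section

variable (hloop : ∀ d, (N.map.inv d).1 ≠ d.1) (hT : StrandsValid N.map.inv T)

include hT in
theorem eq_of_mk_eq {v : G.vertexSet} {i j : Fin 3}
    (h : Quot.mk (Link N.map.inv T) (v, i) = Quot.mk _ (v, j)) : i = j := by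
  by_contra hij
  exact hT v i j hij (Quot.eqvGen_exact h)

-- A valid strand has only one corner at `v`, so its edges there are the two bounding that corner;
-- they are distinct because there are no loops.
include hloop hT in
theorem strand_isRegular (κ : Quot (Link N.map.inv T)) : (N.strand T κ).IsRegular 2 := by
  rintro _ ⟨⟨v, i⟩, rfl, rfl⟩
  have hl : (N.strand T (Quot.mk _ (v, i))).loopSet v = ∅ := by
    rw [Set.eq_empty_iff_forall_notMem]
    rintro e ⟨he, -⟩
    obtain ⟨d, -, h1, h2⟩ := N.exists_dart he
    exact hloop d (Subtype.ext (h2.trans h1.symm))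
  have hi : (N.strand T (Quot.mk _ (v, i))).incidenceSet v =
      {N.edge (v, i + 1), N.edge (v, i + 2)} := by
    ext e
    constructor
    · rintro ⟨y, he, hmem⟩
      obtain ⟨⟨w, j⟩, rfl, h1, -⟩ := N.exists_dart he
      obtain rfl : w = v := Subtype.ext h1
      have hj : i = j + 1 ∨ i = j + 2 :=
        (edge_mem_strand.1 hmem).imp (eq_of_mk_eq hT) (eq_of_mk_eq hT)
      have key : ∀ i j : Fin 3, i = j + 1 ∨ i = j + 2 → j = i + 1 ∨ j = i + 2 := by decide
      rcases key i j hj with rfl | rfl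
      · exact Or.inl rfl
      · exact Or.inr rfl
    · have h3 : ∀ i : Fin 3, i + 1 + 2 = i ∧ i + 2 + 1 = i := by decide
      rintro (rfl | rfl)
      · refine ⟨_, N.isLink _, edge_mem_strand.2 (Or.inr ?_)⟩
        change _ = Quot.mk _ (v, i + 1 + 2)
        rw [(h3 i).1]
      · refine ⟨_, N.isLink _, edge_mem_strand.2 (Or.inl ?_)⟩
        change _ = Quot.mk _ (v, i + 2 + 1)
        rw [(h3 i).2]
  have hne : N.edge (v, i + 1) ≠ N.edge (v, i + 2) := by
    intro h
    rcases (N.edge_eq_iff _ _).1 h with h | h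
    · have : ∀ i : Fin 3, i + 1 ≠ i + 2 := by decide
      exact this i (Prod.ext_iff.1 h).2
    · exact hloop _ (Prod.ext_iff.1 h).1.symm
  rw [eDegree, hl, hi, encard_pair hne, encard_empty, add_zero]
  rfl

variable (N T) in
/-- The strands as a multiset of subgraphs. -/
noncomputable def strands [Finite G.vertexSet] : Multiset (Graph α β) :=
  letI : Fintype (Quot (Link N.map.inv T)) := Fintype.ofFinite _
  Finset.univ.val.map (N.strand T)

theorem mem_strands [Finite G.vertexSet] {C : Graph α β} :
    C ∈ N.strands T ↔ ∃ κ, N.strand T κ = C := by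
  simp [strands]

-- The strands containing an edge are those on its two sides, and these differ because they use
-- different corners at the same end.
include hloop hT in
theorem isCircuitDoubleCover_strands [Finite G.vertexSet] :
    G.IsCircuitDoubleCover (N.strands T) := by
  classical
  let : Fintype (Quot (Link N.map.inv T)) := Fintype.ofFinite _
  constructor
  · intro C hC
    obtain ⟨κ, rfl⟩ := mem_strands.1 hC
    exact ⟨strand_le κ, strand_isConnected κ, strand_isRegular hloop hT κ⟩
  · intro e he
    obtain ⟨d, rfl⟩ := N.exists_edge_eq e he
    have hne : Quot.mk (Link N.map.inv T) (crn d false) ≠ Quot.mk _ (crn d true) := by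
      intro h
      have : ∀ i : Fin 3, i + 1 ≠ i + 2 := by decide
      exact this d.2 (eq_of_mk_eq hT h)
    rw [strands, Multiset.countP_map]
    have hfil : Finset.univ.filter (fun κ => N.edge d ∈ (N.strand T κ).edgeSet) =
        {Quot.mk _ (crn d false), Quot.mk _ (crn d true)} := by
      ext κ
      simp only [Finset.mem_filter, Finset.mem_univ, true_and, Finset.mem_insert,
        Finset.mem_singleton]
      exact edge_mem_strand
    have := congrArg Finset.card hfil
    rw [Finset.card_pair hne] at this
    rw [← this, Finset.card_def, Finset.filter_val]

-- The twist of an edge can be read off the cover: the circuit through the corner between `d` and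
-- its rotational predecessor continues into the analogous corner at the other end exactly when the
-- edge is twisted.
include hT in
theorem twist_eq_true_iff [Finite G.vertexSet] (d : G.vertexSet × Fin 3) :
    T d = true ↔ ∃ C ∈ N.strands T, N.edge d ∈ C.edgeSet ∧ N.edge (d.1, d.2 + 2) ∈ C.edgeSet ∧
      N.edge ((N.map.inv d).1, (N.map.inv d).2 + 2) ∈ C.edgeSet := by
  have hcorner : ∀ (v : G.vertexSet) (i : Fin 3) (κ : Quot (Link N.map.inv T)),
      N.edge (v, i) ∈ (N.strand T κ).edgeSet ∧ N.edge (v, i + 2) ∈ (N.strand T κ).edgeSet ↔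
        κ = Quot.mk _ (v, i + 1) := by
    intro v i κ
    rw [edge_mem_strand, edge_mem_strand]
    change (κ = Quot.mk _ (v, i + 1) ∨ κ = Quot.mk _ (v, i + 2)) ∧
      (κ = Quot.mk _ (v, i + 2 + 1) ∨ κ = Quot.mk _ (v, i + 2 + 2)) ↔ _
    have h3 : ∀ i : Fin 3, i + 2 ≠ i + 2 + 1 ∧ i + 2 ≠ i + 2 + 2 ∧ i + 2 + 2 = i + 1 := by decide
    rw [(h3 i).2.2]
    constructor
    · rintro ⟨h1 | h1, h2⟩
      · exact h1
      · rcases h2 with h2 | h2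
        · exact absurd (eq_of_mk_eq hT (h1.symm.trans h2)) (h3 i).1
        · exact h2
    · exact fun h => ⟨Or.inl h, Or.inr h⟩
  constructor
  · intro h
    refine ⟨_, mem_strands.2 ⟨Quot.mk _ (crn d false), rfl⟩, ?_⟩
    have h1 := (hcorner d.1 d.2 _).2 (rfl : Quot.mk _ (crn d false) = _)
    have h2 := (hcorner (N.map.inv d).1 (N.map.inv d).2 (Quot.mk _ (crn d false))).2 (by
      rw [mk_crn_eq, h]
      rfl)
    exact ⟨h1.1, h1.2, h2.2⟩
  · rintro ⟨C, hC, h1, h2, h3⟩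
    obtain ⟨κ, rfl⟩ := mem_strands.1 hC
    have e1 := (hcorner d.1 d.2 κ).1 ⟨h1, h2⟩
    have h1' : N.edge (N.map.inv d) ∈ (N.strand T κ).edgeSet := by
      rwa [(N.edge_eq_iff d (N.map.inv d)).2 (Or.inr rfl)]
    have e2 := (hcorner (N.map.inv d).1 (N.map.inv d).2 κ).1 ⟨h1', h3⟩
    by_contra hTd
    rw [Bool.not_eq_true] at hTd
    have e3 := mk_crn_eq (N := N) (T := T) d false
    rw [hTd] at e3
    have : ∀ i : Fin 3, i + 1 ≠ i + 2 := by decide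
    exact this (N.map.inv d).2 (eq_of_mk_eq hT (e2.symm.trans (e1.trans e3)))

end

/-- A lower bound needs only that distinct valid twists give distinct covers, and
`twist_eq_true_iff` recovers the twist from the multiset. -/
theorem numCovers_le (hV : G.vertexSet.Finite) (hE : G.edgeSet.Finite)
    (hloop : ∀ d, (N.map.inv d).1 ≠ d.1) : N.map.numCovers ≤ G.numCircuitDoubleCovers := by
  have := hV.to_subtype
  have := (finite_setOf_isCircuitDoubleCover hV hE).to_subtype
  rw [CubicMap.numCovers, numCircuitDoubleCovers, ← Nat.card_coe_set_eq]
  refine Nat.card_le_card_of_injective (fun T =>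
    ⟨N.strands T.1, isCircuitDoubleCover_strands hloop T.2.2⟩) ?_
  rintro ⟨T, hT1, hT⟩ ⟨T', hT1', hT'⟩ h
  have h' : N.strands T = N.strands T' := congrArg Subtype.val h
  refine Subtype.ext (funext fun d => ?_)
  rw [Bool.eq_iff_iff, twist_eq_true_iff hT, twist_eq_true_iff hT', h']

end CubicModel

end Graph

end

theorem theorem6p4 {α β : Type*} (G : Graph α β)
    (hV : G.vertexSet.Finite) (hE : G.edgeSet.Finite)
    (hconn : G.IsConnected) (hbridgeless : G.IsBridgeless) (hcubic : G.IsRegular 3)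
    (hplanar : G.IsPlanar) :
    (5 / 2 : ℝ) ^ ((G.vertexSet.ncard : ℝ) / 4 - 1 / 2) ≤ (G.numCircuitDoubleCovers : ℝ) := by
  classical
  obtain ⟨R, hR⟩ := hplanar
  have : Fintype G.vertexSet := hV.fintype
  obtain ⟨ψ, hψ, hψ'⟩ := R.exists_dartEquiv hcubic
  have hP := R.planar_model ψ hψ hψ' hconn.1 hR
  have hM := (R.model ψ hψ).twoConn hconn hbridgeless
  have hcard : 2 ≤ Fintype.card G.vertexSet := by
    have h0 : 0 < Fintype.card G.vertexSet := Fintype.card_pos_iff.2 hconn.1.to_subtype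
    have h1 := (R.model ψ hψ).map.card_ne_one
    omega
  have hle := CubicMap.coverBound_le_numCovers hM hP
  rw [CubicMap.coverBound, ← Nat.card_eq_fintype_card, Nat.card_coe_set_eq] at hle
  exact hle.trans (by
    exact_mod_cast (R.model ψ hψ).numCovers_le hV hE (hM.inv_fst_ne hcard))
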